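/- **Model.** Let $V$ be a set of $n$ nodes with unique, comparable addresses, and let $\sigma=(\sigma_0,\dots,\sigma_{m-1})$ be a finite sequence of requests $\sigma_t=(u,v)\in V\times V$, $u\neq v$. For integers $c\ge 1$ and $\delta\ge 0$, $\sigma$ is *$(c,\delta)$-sparse* if every contiguous subsequence of length at most $\delta$ involves at most $cn$ distinct pairs $(u,v)$. $H_b(\hat Y\mid\hat X)$ and $H_b(\hat X\mid\hat Y)$ denote the empirical conditional entropies (base $b$; $b=2$ if omitted) of the destination given the source, and of the source given the destination, in a sequence. The cost $\mathrm{Cost}(\mathrm{Stat}_\Delta,\sigma)$ of an optimal fixed network is the minimum, over all graphs on $V$ of maximum degree at most $\Delta$, of the average hop distance of the requests of $\sigma$. A message over the demand-oblivious network costs $D\ge 1$. **Ego-BSTs.** A self-adjusting binary search tree (BST) starts empty, inserts a key at its first access and may restructure itself after each access; an access costs the number of nodes on the search path plus the number of link changes. It is *statically optimal* (with factor $K$) if on every access sequence it pays at most $K$ times the total search cost of any fixed BST that stores all accessed keys. **ReNet.** Put $\theta=4c$ and $\Delta=6\theta=24c$. Each node $u$ has a working set $\mathcal W(u)$, initially empty,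 of its communication partners; $u$ is *small* as long as $|\mathcal W(u)|\le\theta$ and becomes *large* when $|\mathcal W(u)|=\theta+1$. Small partners are joined by a direct link. Each large node $w$ is linked to the root of an ego-BST whose keys are its partners; a small partner occupies its own slot, and for a large partner $v$ the slots of $v$ in the tree of $w$ and of $w$ in the tree of $v$ are both occupied by one small *helper* node, chosen by a coordinator among the small nodes that currently help fewer than $2c$ pairs. A request $(u,v)$ travels over the direct link, down the ego-BST of a large source and/or up the ego-BST of a large destination, after which the ego-BSTs used are adjusted. If $u,v$ are not yet partners, the coordinator is first notified; if $\sum_x|\mathcal W(x)|$ has reached $\theta n/2$ it *resets* the network (all working sets and links are cleared, at message cost $n$); then it adds $u,v$ to each other's working sets, makes a node large if required (creating its ego-BST, inserting its partners, and reassigning the pairs the node was helping) and connects $u$ and $v$. Informing a node costs $D$. The cost of a request is the number of hops (including searches for insertions and unsuccessful searches) plus the number of link changes of the network plus the cost of the coordinator messages. The ReNet starts from the empty network; its *reset windows* $\sigma^{(1)},\sigma^{(2)},\dots$ are the parts of $\sigma$ obtained by cutting before each request at which a reset takes place, and $\mathrm{Cost}(\mathrm{ReNet},\emptyset,\sigma)$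 is its total cost divided by $m$. **Theorem.** For all constants $c\ge1$, $K$ and $a$ there is a constant $C$ such that the following holds for all $n$, $D\ge 1$, $\delta$ with $nD\le a\delta$ (that is, $\delta=\Omega(nD)$), every ReNet whose ego-BSTs are statically optimal with factor $K$, and every $(c,\delta)$-sparse sequence $\sigma$ with $|\sigma|\ge\delta$. 1. While each request is routed and after each request, every node of the ReNet uses at most $\Delta=24c$ ports, and the route charged to a request is at least the hop distance of its endpoints in the current network. 2. The ReNet is statically optimal among $\Delta$-degree-bounded networks: $\mathrm{Cost}(\mathrm{ReNet},\emptyset,\sigma)\le C\cdot\mathrm{Cost}(\mathrm{Stat}_\Delta,\sigma)$. 3. Every reset window except possibly the last has length at least $\delta$, and on every reset window $\tau$ with $|\tau|\ge\delta$ the total cost (routing, reconfiguration and coordinator messages) is at most $C\,|\tau|\,\bigl(1+H(\hat Y_\tau\mid\hat X_\tau)+H(\hat X_\tau\mid\hat Y_\tau)\bigr)$. The total cost on $\sigma$ is at most $C$ times the sum over all reset windows $\tau$ of $|\tau|\bigl(1+H(\hat Y_\tau\mid\hat X_\tau)+H(\hat X_\tau\mid\hat Y_\tau)\bigr)$, and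 $\mathrm{Cost}(\mathrm{ReNet},\emptyset,\sigma)\le C\bigl(1+H(\hat Y_\sigma\mid\hat X_\sigma)+H(\hat X_\sigma\mid\hat Y_\sigma)\bigr)$. These bounds match the entropy lower bound for fixed networks: there is an absolute constant $C$ with $\max\bigl(H_\Delta(\hat Y_\sigma\mid\hat X_\sigma),H_\Delta(\hat X_\sigma\mid\hat Y_\sigma)\bigr)\le C\cdot\mathrm{Cost}(\mathrm{Stat}_\Delta,\sigma)$ for every $\Delta\ge2$ and every sequence $\sigma$ of requests between distinct nodes. Moreover, splay trees are statically optimal: there is a $K$ such that on every ordered key set the splay tree is statically optimal with factor $K$. -/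

import Mathlib

open scoped ENNReal

/-! ### Binary search trees -/

section Trees

variable {α : Type}

/-- The keys of a tree, from left to right. -/
def keys : BinaryTree α → List α
  | .nil => []
  | .node a l r => keys l ++ a :: keys r

/-- A binary search tree: the keys strictly increase from left to right. -/
def IsBST [LinearOrder α] (t : BinaryTree α) : Prop := (keys t).Pairwise (· < ·)

/-- Number of nodes visited by the binary search for `k` in `t`. If `k` is stored in `t`, this is
one plus the depth of `k`, i.e. the hop distance of `k` from an owner linked to the root. -/
def searchLen [LinearOrder α] (k : α) : BinaryTree α → ℕ
  | .nil => 0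
  | .node a l r => 1 + (if k < a then searchLen k l else if a < k then searchLen k r else 0)

/-- The links of a tree hanging below `p` (one link from each node to its parent). -/
def linksBelow (p : Option α) : BinaryTree α → Multiset (Sym2 (Option α))
  | .nil => 0
  | .node a l r => s(p, some a) ::ₘ (linksBelow (some a) l + linksBelow (some a) r)

/-- The links of an ego-tree; `none` stands for the owner of the tree, which is linked to the
root. -/
def treeLinks (t : BinaryTree α) : Multiset (Sym2 (Option α)) := linksBelow none t

/-- Number of link changes (removed links plus added links) between two collections of links. -/
def linkChanges {β : Type} [DecidableEq β] (A B : Multiset β) : ℕ :=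
  Multiset.card (A - B) + Multiset.card (B - A)

end Trees

/-- A (deterministic, online) self-adjusting binary search tree: a state, possibly with
auxiliary information, that determines a binary search tree, and the operations `insert`
(for keys which are not stored) and `adjust` (after the access to a stored key). -/
structure SelfAdjustingBST (α : Type) [LinearOrder α] where
  State : Type
  tree : State → BinaryTree α
  init : State
  insert : α → State → State
  adjust : α → State → State
  tree_init : tree init = .nil
  isBST_tree : ∀ s, IsBST (tree s)
  mem_insert : ∀ k s, k ∉ keys (tree s) →
    ∀ x, x ∈ keys (tree (insert k s)) ↔ x = k ∨ x ∈ keys (tree s)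
  mem_adjust : ∀ k s, k ∈ keys (tree s) →
    ∀ x, x ∈ keys (tree (adjust k s)) ↔ x ∈ keys (tree s)

namespace SelfAdjustingBST

variable {α : Type} [LinearOrder α] (B : SelfAdjustingBST α)

/-- Serve an access to `k`: the first access to a key inserts it. -/
def access (k : α) (s : B.State) : B.State :=
  if k ∈ keys (B.tree s) then B.adjust k s else B.insert k s

/-- Cost of an access: length of the search plus number of link changes. -/
def accessCost (k : α) (s : B.State) : ℕ :=
  searchLen k (B.tree s) + linkChanges (treeLinks (B.tree s)) (treeLinks (B.tree (B.access k s)))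

/-- Total cost of a sequence of accesses, starting in state `s`. -/
def totalCost : B.State → List α → ℕ
  | _, [] => 0
  | s, k :: ks => B.accessCost k s + totalCost (B.access k s) ks

/-- Static optimality with factor `K`: started empty, on every access sequence the tree pays
at most `K` times as much as any fixed binary search tree that stores all the accessed keys. -/
def IsStaticallyOptimal (K : ℕ) : Prop :=
  ∀ (ks : List α) (T : BinaryTree α), IsBST T → (∀ k ∈ ks, k ∈ keys T) →
    B.totalCost B.init ks ≤ K * (ks.map fun k => searchLen k T).sum

end SelfAdjustingBST

/-! ### Splay trees -/

namespace Splay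

variable {α : Type}

/-- One step of a search path: the node that was left, with its other subtree.
`wentLeft a r`: from `a` to its left child; `wentRight a l`: from `a` to its right child. -/
inductive Crumb (α : Type) where
  | wentLeft (a : α) (r : BinaryTree α)
  | wentRight (a : α) (l : BinaryTree α)

/-- The subtree at which the search for `k` ends, and the search path to it, deepest step first. -/
def descend [LinearOrder α] (k : α) : BinaryTree α → List (Crumb α) → BinaryTree α × List (Crumb α)
  | .nil, ps => (.nil, ps)
  | .node a l r, ps =>
    if k < a then descend k l (.wentLeft a r :: ps)
    else if a < k then descend k r (.wentRight a l :: ps)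
    else (.node a l r, ps)

/-- Bottom-up splaying of the node `x` with subtrees `l` and `r`: zig-zig and zig-zag steps,
and a final zig if one step of the path is left. -/
def splayUp (x : α) : BinaryTree α → BinaryTree α → List (Crumb α) → BinaryTree α
  | l, r, [] => .node x l r
  | l, r, [.wentLeft p c] => .node x l (.node p r c)
  | l, r, [.wentRight p c] => .node x (.node p c l) r
  | l, r, .wentLeft p c :: .wentLeft g d :: ps => splayUp x l (.node p r (.node g c d)) ps
  | l, r, .wentRight p c :: .wentRight g d :: ps => splayUp x (.node p (.node g d c) l) r ps
  | l, r, .wentLeft p c :: .wentRight g d :: ps => splayUp x (.node g d l) (.node p r c) ps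
  | l, r, .wentRight p c :: .wentLeft g d :: ps => splayUp x (.node p c l) (.node g r d) ps

/-- Search for `k`, append it as a leaf if it is missing, and splay it to the root. -/
def splay [LinearOrder α] (k : α) (t : BinaryTree α) : BinaryTree α :=
  match descend k t [] with
  | (.nil, ps) => splayUp k .nil .nil ps
  | (.node x l r, ps) => splayUp x l r ps

/-- The keys to the left of a search path. -/
def keysBefore : List (Crumb α) → List α
  | [] => []
  | .wentLeft _ _ :: ps => keysBefore ps
  | .wentRight a l :: ps => keysBefore ps ++ (keys l ++ [a])

/-- The keys to the right of a search path. -/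
def keysAfter : List (Crumb α) → List α
  | [] => []
  | .wentLeft a r :: ps => a :: keys r ++ keysAfter ps
  | .wentRight _ _ :: ps => keysAfter ps

theorem keys_splayUp (x : α) (l r : BinaryTree α) (ps : List (Crumb α)) :
    keys (splayUp x l r ps) = keysBefore ps ++ (keys l ++ x :: keys r) ++ keysAfter ps := by
  fun_induction splayUp x l r ps <;> simp_all [keys, keysBefore, keysAfter]

theorem descend_spec [LinearOrder α] (k : α) (t : BinaryTree α) (ps : List (Crumb α))
    (h : (keysBefore ps ++ keys t ++ keysAfter ps).Pairwise (· < ·))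
    (h1 : ∀ x ∈ keysBefore ps, x < k) (h2 : ∀ x ∈ keysAfter ps, k < x) :
    keysBefore (descend k t ps).2 ++ keys (descend k t ps).1 ++ keysAfter (descend k t ps).2
        = keysBefore ps ++ keys t ++ keysAfter ps ∧
      (∀ x ∈ keysBefore (descend k t ps).2, x < k) ∧
      (∀ x ∈ keysAfter (descend k t ps).2, k < x) ∧
      ∀ a l r, (descend k t ps).1 = .node a l r → a = k := by
  induction t generalizing ps with
  | nil => exact ⟨rfl, h1, h2, by simp [descend]⟩
  | node a l r ihl ihr =>
    unfold descend
    split_ifs with c1 c2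
    · have e : keysBefore (Crumb.wentLeft a r :: ps) ++ keys l ++ keysAfter (.wentLeft a r :: ps)
          = keysBefore ps ++ keys (.node a l r) ++ keysAfter ps := by
        simp [keys, keysBefore, keysAfter]
      rw [← e]
      refine ihl _ (e ▸ h) h1 ?_
      simp only [keys, List.pairwise_append, List.pairwise_cons] at h
      intro x hx
      simp only [keysAfter, List.cons_append, List.mem_cons, List.mem_append] at hx
      rcases hx with rfl | hx | hx
      · exact c1
      · exact c1.trans (h.1.2.1.2.1.1 x hx)
      · exact h2 x hx
    · have e : keysBefore (Crumb.wentRight a l :: ps) ++ keys r ++ keysAfter (.wentRight a l :: ps)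
          = keysBefore ps ++ keys (.node a l r) ++ keysAfter ps := by
        simp [keys, keysBefore, keysAfter]
      rw [← e]
      refine ihr _ (e ▸ h) ?_ h2
      simp only [keys, List.pairwise_append, List.pairwise_cons] at h
      intro x hx
      simp only [keysBefore, List.mem_append, List.mem_singleton] at hx
      rcases hx with hx | hx | rfl
      · exact h1 x hx
      · exact (h.1.2.1.2.2 x hx a (by simp)).trans c2
      · exact c2
    · refine ⟨rfl, h1, h2, ?_⟩
      intro b l' r' hb
      injection hb with hb _ _
      exact hb ▸ le_antisymm (not_lt.mp c1) (not_lt.mp c2)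

theorem splay_spec [LinearOrder α] (k : α) (t : BinaryTree α) (h : IsBST t) :
    IsBST (splay k t) ∧ ∀ x, x ∈ keys (splay k t) ↔ x = k ∨ x ∈ keys t := by
  obtain ⟨e, h1, h2, h3⟩ := descend_spec k t []
    (by simpa only [IsBST, keysBefore, keysAfter, List.nil_append, List.append_nil] using h)
    (by simp [keysBefore]) (by simp [keysAfter])
  simp only [keysBefore, keysAfter, List.nil_append, List.append_nil] at e
  unfold IsBST splay
  generalize descend k t [] = d at e h1 h2 h3 ⊢
  obtain ⟨s, ps⟩ := d
  rcases s with _ | ⟨a, l, r⟩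
  · simp only [keys, List.append_nil] at e
    have h' : (keysBefore ps ++ keysAfter ps).Pairwise (· < ·) := e ▸ h
    rw [List.pairwise_append] at h'
    simp only [keys_splayUp, keys, List.nil_append]
    constructor
    · simp only [List.pairwise_append, List.append_assoc, List.singleton_append,
        List.pairwise_cons, List.mem_cons]
      refine ⟨h'.1, ⟨h2, h'.2.1⟩, ?_⟩
      rintro x hx y (rfl | hy)
      · exact h1 x hx
      · exact h'.2.2 x hx y hy
    · intro x
      rw [← e]
      simp only [List.mem_append, List.mem_singleton]
      tauto
  · obtain rfl := h3 a l r rfl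
    simp only [keys_splayUp]
    simp only [keys] at e
    rw [e]
    refine ⟨h, fun x => ⟨Or.inr, ?_⟩⟩
    rintro (rfl | hx)
    · rw [← e]; simp
    · exact hx

end Splay

/-- The splay tree as a self-adjusting binary search tree. -/
def splayTree (α : Type) [LinearOrder α] : SelfAdjustingBST α where
  State := {t : BinaryTree α // IsBST t}
  tree := Subtype.val
  init := ⟨.nil, List.Pairwise.nil⟩
  insert k t := ⟨Splay.splay k t.1, (Splay.splay_spec k t.1 t.2).1⟩
  adjust k t := ⟨Splay.splay k t.1, (Splay.splay_spec k t.1 t.2).1⟩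
  tree_init := rfl
  isBST_tree := Subtype.prop
  mem_insert k t _ := (Splay.splay_spec k t.1 t.2).2
  mem_adjust k t hk x := by
    rw [(Splay.splay_spec k t.1 t.2).2 x]
    exact or_iff_right_of_imp fun h => h ▸ hk

/-! ### Demands: sparsity and empirical entropy -/

section Demand

variable {V : Type} [Fintype V] [DecidableEq V]

/-- `(c, δ)`-sparse communication: every contiguous subsequence of length at most `δ` involves
at most `c * n` distinct source-destination pairs. -/
def IsSparse (c δ : ℕ) (σ : List (V × V)) : Prop :=
  ∀ τ : List (V × V), τ <:+: σ → τ.length ≤ δ → τ.toFinset.card ≤ c * Fintype.card V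

/-- Frequency of the request `(x, y)` in `σ`. -/
noncomputable def freq (σ : List (V × V)) (x y : V) : ℝ := (σ.count (x, y) : ℝ) / σ.length

/-- Frequency of `x` as a source in `σ`. -/
noncomputable def freqSrc (σ : List (V × V)) (x : V) : ℝ :=
  (σ.countP (fun r => r.1 = x) : ℝ) / σ.length

/-- Frequency of `y` as a destination in `σ`. -/
noncomputable def freqDst (σ : List (V × V)) (y : V) : ℝ :=
  (σ.countP (fun r => r.2 = y) : ℝ) / σ.length

/-- Empirical conditional entropy `H_b(Y | X)` of the destination given the source. -/
noncomputable def entropyDstGivenSrc (b : ℝ) (σ : List (V × V)) : ℝ :=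
  -∑ x, freqSrc σ x *
    ∑ y, (freq σ x y / freqSrc σ x) * Real.logb b (freq σ x y / freqSrc σ x)

/-- Empirical conditional entropy `H_b(X | Y)` of the source given the destination. -/
noncomputable def entropySrcGivenDst (b : ℝ) (σ : List (V × V)) : ℝ :=
  -∑ y, freqDst σ y *
    ∑ x, (freq σ x y / freqDst σ y) * Real.logb b (freq σ x y / freqDst σ y)

/-- Average cost of the fixed network `N` on `σ`: the average hop distance of the requests
(infinite if some request cannot be routed). -/
noncomputable def fixedCost (N : SimpleGraph V) (σ : List (V × V)) : ℝ≥0∞ :=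
  (((σ.map fun r => N.edist r.1 r.2).sum : ℕ∞) : ℝ≥0∞) / σ.length

/-- Average cost on `σ` of an optimal fixed network of maximum degree at most `Δ`. -/
noncomputable def optFixedCost (Δ : ℕ) (σ : List (V × V)) : ℝ≥0∞ :=
  ⨅ (N : SimpleGraph V) (_ : ∀ v, (N.neighborSet v).ncard ≤ Δ), fixedCost N σ

end Demand

/-! ### Networks with parallel links -/

section Networks

variable {V : Type} [DecidableEq V]

/-- Number of ports of `v` that are in use. -/
def ports (N : Multiset (Sym2 V)) (v : V) : ℕ := N.countP (v ∈ ·)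

/-- The graph whose edges are the links of `N`. -/
def linkGraph (N : Multiset (Sym2 V)) : SimpleGraph V := SimpleGraph.fromEdgeSet {e | e ∈ N}

end Networks

/-! ### ReNet -/

/-- The parameters of a ReNet on the node set `V`, ordered by the node addresses:
the sparsity `c`, the cost `D` of a message over the demand-oblivious network, the
self-adjusting tree that serves as ego-BST, and the rule which the coordinator uses to select
one of the available helper nodes. -/
structure ReNet (V : Type) [LinearOrder V] where
  c : ℕ
  D : ℕ
  bst : SelfAdjustingBST V
  pick : Finset V → V
  pick_mem : ∀ s : Finset V, s.Nonempty → pick s ∈ s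

namespace ReNet

variable {V : Type} [Fintype V] [LinearOrder V] (R : ReNet V)

/-- Nodes with more than `θ` partners are large. -/
def threshold : ℕ := 4 * R.c

/-- The degree bound `Δ`. -/
def maxDegree : ℕ := 6 * R.threshold

/-- The global state of a ReNet. -/
structure State where
  /-- the working sets -/
  W : V → Finset V
  /-- the large nodes -/
  large : Finset V
  /-- the ego-BSTs (in use for large nodes only) -/
  ego : V → R.bst.State
  /-- the helper node of a pair of large nodes -/
  helper : Sym2 V → Option V
  /-- hops travelled on ego-BSTs and direct links for the current request -/
  hops : ℕ
  /-- cost of the coordinator messages for the current request -/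
  msgs : ℕ

namespace State

variable {R} (st : R.State)

/-- The ego-BST of `w`. -/
def egoTree (w : V) : BinaryTree V := R.bst.tree (st.ego w)

/-- The node that occupies the slot with key `k` in the ego-BST of `w`: the node `k` itself if
it is small, the helper of the pair `w, k` if `k` is large. The owner `none` is `w`. -/
def host (w : V) : Option V → V
  | none => w
  | some k => if k ∈ st.large then (st.helper s(w, k)).getD k else k

/-- The current network: the direct links between small partners and the links of the ego-BSTs
of the large nodes. -/
def network : Multiset (Sym2 V) :=
  ((Finset.univ.filter fun p : V × V =>
      p.1 < p.2 ∧ p.2 ∈ st.W p.1 ∧ p.1 ∉ st.large ∧ p.2 ∉ st.large).val.map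
    fun p => s(p.1, p.2)) +
  ∑ w ∈ st.large, (treeLinks (st.egoTree w)).map (Sym2.map (st.host w))

/-- The network is full: the total size of the working sets has reached `θ n / 2`. -/
def IsFull : Prop := R.threshold * Fintype.card V ≤ 2 * ∑ v, (st.W v).card

instance : Decidable st.IsFull := inferInstanceAs (Decidable (_ ≤ _))

/-- The pairs of large nodes for which `x` is the helper. -/
def helps (x : V) : Finset (Sym2 V) := Finset.univ.filter fun e => st.helper e = some x

/-- The small nodes with room for helping another pair: helping takes six ports per pair, and
`3θ` ports are set aside for it. -/
def available : Finset V :=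
  Finset.univ.filter fun x => x ∉ st.large ∧ 6 * ((st.helps x).card + 1) ≤ 3 * R.threshold

end State

/-- The initial state; its network is empty. -/
def init : R.State where
  W _ := ∅
  large := ∅
  ego _ := R.bst.init
  helper _ := none
  hops := 0
  msgs := 0

/-- Send `m` messages over the demand-oblivious network. -/
def notify (m : ℕ) (st : R.State) : R.State := { st with msgs := st.msgs + m * R.D }

/-- Find a helper node for the pair `e`, replacing the previous one if there is any. -/
def assignHelper (e : Sym2 V) (st : R.State) : R.State :=
  R.notify 1 { st with helper := Function.update st.helper e (some (R.pick st.available)) }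

/-- Insert the key `k` into the ego-BST of `w`, unless it is stored there already. -/
def egoInsert (w k : V) (st : R.State) : R.State :=
  if k ∈ keys (st.egoTree w) then st
  else { st with
    hops := st.hops + searchLen k (st.egoTree w)
    ego := Function.update st.ego w (R.bst.insert k (st.ego w)) }

/-- The coordinator informs the partners `u`, `v` and provides a route between them. Two small
nodes get a direct link (see `State.network`). -/
def connect (u v : V) (st : R.State) : R.State :=
  let st := R.notify 2 st
  if u ∈ st.large then
    if v ∈ st.large then
      let st := if st.helper s(u, v) = none then R.assignHelper s(u, v) st else st
      R.egoInsert v u (R.egoInsert u v st)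
    else R.egoInsert u v st
  else if v ∈ st.large then R.egoInsert v u st
  else st

/-- `u` becomes large: its ego-BST is created and its partners are connected through it, and the
pairs for which `u` was the helper get another helper. -/
def makeLarge (u : V) (st : R.State) : R.State :=
  let st := R.notify 1
    { st with large := insert u st.large, ego := Function.update st.ego u R.bst.init }
  let st := ((st.W u).sort (· ≤ ·)).foldl (fun st v => R.connect u v st) st
  let nodes := (Finset.univ : Finset V).sort (· ≤ ·)
  let roles := ((nodes.product nodes).filter fun p => p.1 < p.2 ∧ s(p.1, p.2) ∈ st.helps u).map
    fun p => s(p.1, p.2)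
  roles.foldl (fun st e => R.assignHelper e st) st

/-- Clear all forwarding tables and working sets; the broadcast along a spanning tree costs `n`. -/
def reset (st : R.State) : R.State :=
  { R.init with hops := st.hops, msgs := st.msgs + Fintype.card V }

/-- Add `v` to the working set of `u`; `u` becomes large when it has `θ + 1` partners. -/
def addPartner (u v : V) (st : R.State) : R.State :=
  let st := { st with W := Function.update st.W u (insert v (st.W u)) }
  if u ∉ st.large ∧ (st.W u).card = R.threshold + 1 then R.makeLarge u st else st

/-- The coordinator's reaction to a new pair of communication partners. -/
def addRoute (u v : V) (st : R.State) : R.State :=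
  let st := R.notify 1 st
  let st := if st.IsFull then R.reset st else st
  R.connect u v (R.addPartner v u (R.addPartner u v st))

/-- The length of the route from `u` to `v`: a direct link between small nodes; down the ego-BST
of a large source; up the ego-BST of a large destination; or both, via the helper node. -/
def routeLen (u v : V) (st : R.State) : ℕ :=
  if u ∉ st.large ∧ v ∉ st.large then 1
  else (if u ∈ st.large then searchLen v (st.egoTree u) else 0) +
    (if v ∈ st.large then searchLen u (st.egoTree v) else 0)

/-- Adjust the ego-BST of `w` after a request that used its slot `k`; small nodes have none. -/
def egoAdjust (w k : V) (st : R.State) : R.State :=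
  if w ∈ st.large then { st with ego := Function.update st.ego w (R.bst.adjust k (st.ego w)) }
  else st

/-- The state in which the request `(u, v)` is routed. A request between new partners first
triggers `addRoute`; a large source detects that the partner is new by an unsuccessful search. -/
def prepare (u v : V) (st : R.State) : R.State :=
  let st := { st with hops := 0, msgs := 0 }
  if v ∈ st.W u then st
  else R.addRoute u v
    { st with hops := st.hops + if u ∈ st.large then searchLen v (st.egoTree u) else 0 }

/-- Route the request `(u, v)` and adjust the ego-BSTs that were used. -/
def route (u v : V) (st : R.State) : R.State :=
  R.egoAdjust v u (R.egoAdjust u v { st with hops := st.hops + R.routeLen u v st })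

/-- A served request: the request, and the states before the request, when it is routed, and
afterwards. -/
structure Step where
  req : V × V
  before : R.State
  routed : R.State
  after : R.State

/-- Serve one request. -/
def serve (st : R.State) (r : V × V) : R.Step where
  req := r
  before := st
  routed := R.prepare r.1 r.2 st
  after := R.route r.1 r.2 (R.prepare r.1 r.2 st)

namespace Step

variable {R} (s : R.Step)

/-- Whether the coordinator called for a reset when the request arrived. -/
def isReset : Bool := decide (s.req.2 ∉ s.before.W s.req.1 ∧ s.before.IsFull)

/-- The cost of a request: hops, link changes, and coordinator messages. -/
def cost : ℕ :=
  s.after.hops + linkChanges s.before.network s.after.network + s.after.msgs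

end Step

/-- The run of the ReNet on a sequence of requests. -/
def run : R.State → List (V × V) → List R.Step
  | _, [] => []
  | st, r :: σ => R.serve st r :: run (R.serve st r).after σ

/-- The total cost of a part of a run. -/
def totalCost {R : ReNet V} (steps : List R.Step) : ℕ := (steps.map Step.cost).sum

/-- The (average) cost of the ReNet on `σ`, starting from the empty network. -/
noncomputable def avgCost (σ : List (V × V)) : ℝ :=
  (totalCost (R.run R.init σ) : ℝ) / σ.length

/-- The reset windows: the run is cut before each request at which a reset takes place. -/
def windows (σ : List (V × V)) : List (List R.Step) :=
  (R.run R.init σ).splitBy fun _ s => !s.isReset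

/-- The requests of a part of a run. -/
def requests {R : ReNet V} (steps : List R.Step) : List (V × V) := steps.map Step.req

end ReNet

/-! ### Link changes -/

section LinkChanges

variable {β γ : Type} [DecidableEq β] [DecidableEq γ]

/-! The upper bound compares every ego-BST with a fixed search tree chosen in hindsight. While a
node is large, its ego-BST runs on a list of accesses, its history. All insertions, searches and
rotations are charged to the cost of the histories, and static optimality bounds that cost by `K`
times the search cost in any fixed trees. For a node `w`, the fixed tree is weight-balanced for the
mean of two distributions: destinations given source `w`, and sources given destination `w`. Search
lengths in it are logarithms of inverse conditional probabilities up to a constant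
(`exists_tree_searchLen_le`), so summing over the requests of a window yields its length times a
constant plus the two conditional entropies (`Tracks.cost_le_of_distribution`).

The remaining cost is for setting up partnerships: messages, helper changes, conversion of small
nodes into large ones. It is paid by `D` times the potential `setupCost`, which is `O(c n)` within a
window because the working sets have total size at most `2 c n`; a reset adds `O(c n)`. A reset
needs more than `c n` distinct pairs since the last one, so sparsity makes each completed window at
least `δ` long (`Tracks.length_ge`), and `n D ≤ a δ` amortises the overhead (`length_mul_le`). For
the bound with the entropies of the whole sequence, all windows are compared with the same
conditional frequencies, those of the whole sequence, so that the logarithms add up exactly to its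
entropy.

Helpers always exist: fewer than half of the nodes are large and there are at most `c n` pairs,
while each small node can help `2 c` of them (`Sound.available_nonempty`). A small node spends at
most three ports per partner and six per helped pair, and a large node just one, which gives the
degree bound (`Stable.ports_le`).

For the lower bound, a node has at most `Δ ^ d` nodes at distance `d`, so weights `Δ ^ (-2 d)` over
the other nodes sum to at most one, and Gibbs' inequality bounds the entropy by twice the mean
distance. As hop distances are at least one and `Δ` is a constant, upper and lower bound combine to
static optimality (`avgCost_le_optFixedCost`).

Splay trees are handled by the access lemma (`potential_splayUp`) with weight `4 ^ (-s)` for a key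
of search length `s` in the fixed tree. The rank of a subtree counts all keys of the fixed tree
between the bounds of the subtree, stored or not, so an insertion does not raise the ranks of the
ancestors. -/

@[simp] theorem linkChanges_self (A : Multiset β) : linkChanges A A = 0 := by
  simp [linkChanges]

theorem linkChanges_triangle (A B C : Multiset β) :
    linkChanges A C ≤ linkChanges A B + linkChanges B C := by
  have h1 := Multiset.card_le_card (tsub_le_tsub_add_tsub (a := A) (b := B) (c := C))
  have h2 := Multiset.card_le_card (tsub_le_tsub_add_tsub (a := C) (b := B) (c := A))
  simp only [Multiset.card_add] at h1 h2
  unfold linkChanges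
  omega

theorem linkChanges_add (A B A' B' : Multiset β) :
    linkChanges (A + A') (B + B') ≤ linkChanges A B + linkChanges A' B' := by
  have h1 := Multiset.card_le_card (add_tsub_add_le_tsub_add_tsub (a := A) (b := A') (c := B) (d := B'))
  have h2 := Multiset.card_le_card (add_tsub_add_le_tsub_add_tsub (a := B) (b := B') (c := A) (d := A'))
  simp only [Multiset.card_add] at h1 h2
  unfold linkChanges
  omega

theorem linkChanges_le_card (A B : Multiset β) :
    linkChanges A B ≤ Multiset.card A + Multiset.card B := by
  have h1 := Multiset.card_le_card (tsub_le_self (a := A) (b := B))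
  have h2 := Multiset.card_le_card (tsub_le_self (a := B) (b := A))
  unfold linkChanges
  omega

/-- `A ≤ (A - B) + B` survives the map, so a renaming can only create further cancellations. This
reduces changes between physical nodes to changes between tree slots. -/
theorem linkChanges_map (f : β → γ) (A B : Multiset β) :
    linkChanges (A.map f) (B.map f) ≤ linkChanges A B := by
  have key : ∀ A B : Multiset β, Multiset.card (A.map f - B.map f) ≤ Multiset.card (A - B) := by
    intro A B
    rw [← Multiset.card_map f (A - B)]
    apply Multiset.card_le_card
    rw [tsub_le_iff_right, ← Multiset.map_add]
    exact Multiset.map_le_map (by rw [← tsub_le_iff_right])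
  exact Nat.add_le_add (key A B) (key B A)

theorem linkChanges_cons_le (a b : β) (A B : Multiset β) :
    linkChanges (a ::ₘ A) (b ::ₘ B) ≤ 2 + linkChanges A B := by
  rw [← Multiset.singleton_add a A, ← Multiset.singleton_add b B]
  have := linkChanges_le_card ({a} : Multiset β) {b}
  simp only [Multiset.card_singleton] at this
  have := linkChanges_add {a} {b} A B
  omega

theorem linkChanges_sum {ι : Type} (s : Finset ι) (f g : ι → Multiset β) :
    linkChanges (∑ i ∈ s, f i) (∑ i ∈ s, g i) ≤ ∑ i ∈ s, linkChanges (f i) (g i) := by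
  classical
  induction s using Finset.induction_on with
  | empty => simp
  | insert i s hi ih =>
    simp only [Finset.sum_insert hi]
    exact (linkChanges_add _ _ _ _).trans (Nat.add_le_add_left ih _)

end LinkChanges

section

variable {α : Type} [DecidableEq α]

/-- Only the topmost link mentions the parent, so moving a subtree costs one removal and one
addition. -/
theorem linkChanges_linksBelow (p q : Option α) (t : BinaryTree α) :
    linkChanges (linksBelow p t) (linksBelow q t) ≤ 2 := by
  cases t with
  | nil => simp [linksBelow]
  | node a l r =>
    simp only [linksBelow]
    exact (linkChanges_cons_le _ _ _ _).trans (by simp)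

end

/-! ### Static optimality of splay trees -/

namespace Splay

/-! ### Link changes caused by a splay. -/

section Links

variable {α : Type}

/-- The parent of the subtree at the end of a search path. -/
def pathParent : List (Crumb α) → Option α
  | [] => none
  | .wentLeft a _ :: _ => some a
  | .wentRight a _ :: _ => some a

/-- The links of a tree outside of the subtree at the end of a search path. -/
def pathLinks : List (Crumb α) → Multiset (Sym2 (Option α))
  | [] => 0
  | .wentLeft a t :: ps => s(pathParent ps, some a) ::ₘ (linksBelow (some a) t + pathLinks ps)
  | .wentRight a t :: ps => s(pathParent ps, some a) ::ₘ (linksBelow (some a) t + pathLinks ps)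

theorem linkChanges_linksBelow_add [DecidableEq α] (p q : Option α) (t : BinaryTree α)
    (A B : Multiset (Sym2 (Option α))) :
    linkChanges (linksBelow p t + A) (linksBelow q t + B) ≤ 2 + linkChanges A B :=
  (linkChanges_add _ _ _ _).trans (Nat.add_le_add_right (linkChanges_linksBelow p q t) _)

/-- A zig replaces two links of the path and rehangs three subtrees: five links, each removed and
added. -/
theorem linkChanges_rotate [DecidableEq α] (a a' b b' : Sym2 (Option α))
    (p q u p' q' u' : Option α) (l r s : BinaryTree α) (A B : Multiset (Sym2 (Option α))) :
    linkChanges (a ::ₘ b ::ₘ (linksBelow p l + (linksBelow q r + (linksBelow u s + A))))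
      (a' ::ₘ b' ::ₘ (linksBelow p' l + (linksBelow q' r + (linksBelow u' s + B)))) ≤
      10 + linkChanges A B := by
  refine (linkChanges_cons_le _ _ _ _).trans ?_
  have h1 := linkChanges_cons_le b b' (linksBelow p l + (linksBelow q r + (linksBelow u s + A)))
    (linksBelow p' l + (linksBelow q' r + (linksBelow u' s + B)))
  have h2 := linkChanges_linksBelow_add p p' l (linksBelow q r + (linksBelow u s + A))
    (linksBelow q' r + (linksBelow u' s + B))
  have h3 := linkChanges_linksBelow_add q q' r (linksBelow u s + A) (linksBelow u' s + B)
  have h4 := linkChanges_linksBelow_add u u' s A B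
  omega

/-- A double rotation touches three links of the path and four subtrees: seven links, each removed
and added. -/
theorem linkChanges_rotate_twice [DecidableEq α] (a a' b b' c c' : Sym2 (Option α))
    (p q u v p' q' u' v' : Option α) (l r s t : BinaryTree α) (M : Multiset (Sym2 (Option α))) :
    linkChanges (a ::ₘ b ::ₘ (linksBelow p l + (linksBelow q r + (linksBelow u s
        + (c ::ₘ (linksBelow v t + M))))))
      (a' ::ₘ b' ::ₘ (linksBelow p' l + (linksBelow q' r + (linksBelow u' s
        + (c' ::ₘ (linksBelow v' t + M)))))) ≤ 14 := by
  have h1 := linkChanges_rotate a a' b b' p q u p' q' u' l r s (c ::ₘ (linksBelow v t + M))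
    (c' ::ₘ (linksBelow v' t + M))
  have h2 := linkChanges_cons_le c c' (linksBelow v t + M) (linksBelow v' t + M)
  have h3 := linkChanges_linksBelow_add v v' t M M
  rw [linkChanges_self] at h3
  omega

/-- Cutting the tree at the search path writes its links as those of the subtree plus those of the
path. Each double rotation then rewrites only the part around two crumbs, and the links of the
remaining path cancel. -/
theorem linkChanges_splayUp [DecidableEq α] (x : α) (l r : BinaryTree α) (ps : List (Crumb α)) :
    linkChanges (linksBelow (pathParent ps) (.node x l r) + pathLinks ps)
      (treeLinks (splayUp x l r ps)) ≤ 14 * ps.length := by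
  fun_induction splayUp x l r ps with
  | case1 l r => simp [pathParent, pathLinks, treeLinks]
  | case2 l r p c =>
    refine le_trans ?_ ((linkChanges_rotate s(some p, some x) s(none, some x) s(none, some p)
      s(some x, some p) (some x) (some x) (some p) (some x) (some p) (some p) l r c 0 0).trans
        (b := 10 + _) (by simp))
    apply le_of_eq
    congr 1 <;>
    · simp only [linksBelow, treeLinks, pathLinks, pathParent, ← Multiset.singleton_add]
      abel
  | case3 l r p c =>
    refine le_trans ?_ ((linkChanges_rotate s(some p, some x) s(none, some x) s(none, some p)
      s(some x, some p) (some x) (some x) (some p) (some p) (some x) (some p) l r c 0 0).trans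
        (b := 10 + _) (by simp))
    apply le_of_eq
    congr 1 <;>
    · simp only [linksBelow, treeLinks, pathLinks, pathParent, ← Multiset.singleton_add]
      abel
  | case4 l r p c g d ps ih =>
    refine (linkChanges_triangle _ _ _).trans ((Nat.add_le_add ?_ ih).trans (b := 14 + _) ?_)
    · convert linkChanges_rotate_twice s(some p, some x) s(pathParent ps, some x) s(some g, some p)
        s(some x, some p) s(pathParent ps, some g) s(some p, some g) (some x) (some x) (some p)
        (some g) (some x) (some p) (some g) (some g) l r c d (pathLinks ps) using 2 <;>
      · simp only [linksBelow, pathLinks, pathParent, ← Multiset.singleton_add]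
        abel
    · simp only [List.length_cons]; omega
  | case5 l r p c g d ps ih =>
    refine (linkChanges_triangle _ _ _).trans ((Nat.add_le_add ?_ ih).trans (b := 14 + _) ?_)
    · convert linkChanges_rotate_twice s(some p, some x) s(pathParent ps, some x) s(some g, some p)
        s(some x, some p) s(pathParent ps, some g) s(some p, some g) (some x) (some x) (some p)
        (some g) (some p) (some x) (some g) (some g) l r c d (pathLinks ps) using 2 <;>
      · simp only [linksBelow, pathLinks, pathParent, ← Multiset.singleton_add]
        abel
    · simp only [List.length_cons]; omega
  | case6 l r p c g d ps ih =>
    refine (linkChanges_triangle _ _ _).trans ((Nat.add_le_add ?_ ih).trans (b := 14 + _) ?_)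
    · convert linkChanges_rotate_twice s(some p, some x) s(pathParent ps, some x) s(some g, some p)
        s(some x, some p) s(pathParent ps, some g) s(some x, some g) (some x) (some x) (some p)
        (some g) (some g) (some p) (some p) (some g) l r c d (pathLinks ps) using 2 <;>
      · simp only [linksBelow, pathLinks, pathParent, ← Multiset.singleton_add]
        abel
    · simp only [List.length_cons]; omega
  | case7 l r p c g d ps ih =>
    refine (linkChanges_triangle _ _ _).trans ((Nat.add_le_add ?_ ih).trans (b := 14 + _) ?_)
    · convert linkChanges_rotate_twice s(some p, some x) s(pathParent ps, some x) s(some g, some p)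
        s(some x, some p) s(pathParent ps, some g) s(some x, some g) (some x) (some x) (some p)
        (some g) (some p) (some g) (some p) (some g) l r c d (pathLinks ps) using 2 <;>
      · simp only [linksBelow, pathLinks, pathParent, ← Multiset.singleton_add]
        abel
    · simp only [List.length_cons]; omega

end Links
end Splay

/-- The number of nodes on the path to `k` is positive unless the tree is empty. -/
theorem one_le_searchLen {α : Type} [LinearOrder α] {k : α} {t : BinaryTree α} (h : k ∈ keys t) :
    1 ≤ searchLen k t := by
  cases t with
  | nil => simp [keys] at h
  | node a l r => simp only [searchLen]; omega

theorem isBST_node {α : Type} [LinearOrder α] {a : α} {l r : BinaryTree α} :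
    IsBST (.node a l r) ↔
      IsBST l ∧ IsBST r ∧ (∀ x ∈ keys l, x < a) ∧ ∀ x ∈ keys r, a < x := by
  simp only [IsBST, keys, List.pairwise_append, List.pairwise_cons, List.mem_cons]
  constructor
  · rintro ⟨h1, ⟨h2, h3⟩, h4⟩
    exact ⟨h1, h3, fun x hx => h4 x hx a (Or.inl rfl), h2⟩
  · rintro ⟨h1, h2, h3, h4⟩
    refine ⟨h1, ⟨h4, h2⟩, ?_⟩
    rintro x hx y (rfl | hy)
    · exact h3 x hx
    · exact (h3 x hx).trans (h4 y hy)

theorem IsBST.nodup {α : Type} [LinearOrder α] {t : BinaryTree α} (h : IsBST t) :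
    (keys t).Nodup :=
  List.Pairwise.imp (fun h => ne_of_lt h) h

namespace Splay

/-! ### The access lemma. -/

section Potential

variable {α : Type} [LinearOrder α] (S : Finset α) (w : α → ℝ)

/-- Total weight of the keys of `S` between two bounds. -/
noncomputable def mass (lo : WithBot α) (hi : WithTop α) : ℝ :=
  ∑ k ∈ S.filter fun k : α => lo < (k : WithBot α) ∧ (k : WithTop α) < hi, w k

/-- The rank of the interval between two bounds. -/
noncomputable def rank (lo : WithBot α) (hi : WithTop α) : ℝ := Real.logb 2 (mass S w lo hi)

/-- The keys of the tree belong to `S` and are ordered between the bounds. -/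
def Within (lo : WithBot α) (hi : WithTop α) : BinaryTree α → Prop
  | .nil => True
  | .node a l r => (a ∈ S ∧ lo < (a : WithBot α) ∧ (a : WithTop α) < hi) ∧
      Within lo a l ∧ Within a hi r

/-- The potential of a tree whose keys lie between the bounds. -/
noncomputable def potential (lo : WithBot α) (hi : WithTop α) : BinaryTree α → ℝ
  | .nil => 0
  | .node a l r => rank S w lo hi + potential lo a l + potential a hi r

/-- The lower bound of the subtree at the end of a search path. -/
def pathLo : List (Crumb α) → WithBot α
  | [] => ⊥
  | .wentLeft _ _ :: ps => pathLo ps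
  | .wentRight a _ :: _ => a

/-- The upper bound of the subtree at the end of a search path. -/
def pathHi : List (Crumb α) → WithTop α
  | [] => ⊤
  | .wentLeft a _ :: _ => a
  | .wentRight _ _ :: ps => pathHi ps

/-- The keys on and beside the path belong to `S` and are ordered. -/
def PathWithin : List (Crumb α) → Prop
  | [] => True
  | .wentLeft a r :: ps => (a ∈ S ∧ pathLo ps < (a : WithBot α) ∧ (a : WithTop α) < pathHi ps) ∧
      Within S a (pathHi ps) r ∧ PathWithin ps
  | .wentRight a l :: ps => (a ∈ S ∧ pathLo ps < (a : WithBot α) ∧ (a : WithTop α) < pathHi ps) ∧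
      Within S (pathLo ps) a l ∧ PathWithin ps

/-- The potential of the nodes on and beside the path. -/
noncomputable def pathPotential : List (Crumb α) → ℝ
  | [] => 0
  | .wentLeft a r :: ps =>
      rank S w (pathLo ps) (pathHi ps) + potential S w a (pathHi ps) r + pathPotential ps
  | .wentRight a l :: ps =>
      rank S w (pathLo ps) (pathHi ps) + potential S w (pathLo ps) a l + pathPotential ps

variable {S w}

theorem mass_mono (hw : ∀ k ∈ S, 0 < w k) {lo lo' : WithBot α} {hi hi' : WithTop α}
    (h1 : lo' ≤ lo) (h2 : hi ≤ hi') : mass S w lo hi ≤ mass S w lo' hi' := by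
  apply Finset.sum_le_sum_of_subset_of_nonneg
  · intro k hk
    simp only [Finset.mem_filter] at hk ⊢
    exact ⟨hk.1, h1.trans_lt hk.2.1, hk.2.2.trans_le h2⟩
  · intro k hk _
    exact (hw k (Finset.mem_of_mem_filter k hk)).le

theorem le_mass (hw : ∀ k ∈ S, 0 < w k) {lo : WithBot α} {hi : WithTop α} {x : α} (hx : x ∈ S)
    (h1 : lo < (x : WithBot α)) (h2 : (x : WithTop α) < hi) : w x ≤ mass S w lo hi :=
  Finset.single_le_sum (f := w) (fun k hk => (hw k (Finset.mem_of_mem_filter k hk)).le)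
    (Finset.mem_filter.2 ⟨hx, h1, h2⟩)

theorem mass_add_le (hw : ∀ k ∈ S, 0 < w k) {lo : WithBot α} {hi : WithTop α} {p : α}
    (h1 : lo < (p : WithBot α)) (h2 : (p : WithTop α) < hi) :
    mass S w lo p + mass S w p hi ≤ mass S w lo hi := by
  unfold mass
  rw [← Finset.sum_union]
  · apply Finset.sum_le_sum_of_subset_of_nonneg
    · intro k hk
      simp only [Finset.mem_filter, Finset.mem_union] at hk ⊢
      rcases hk with ⟨hk, h3, h4⟩ | ⟨hk, h3, h4⟩
      · exact ⟨hk, h3, h4.trans h2⟩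
      · exact ⟨hk, h1.trans h3, h4⟩
    · intro k hk _
      exact (hw k (Finset.mem_of_mem_filter k hk)).le
  · rw [Finset.disjoint_left]
    intro k hk hk'
    simp only [Finset.mem_filter, WithTop.coe_lt_coe, WithBot.coe_lt_coe] at hk hk'
    exact lt_asymm hk.2.2 hk'.2.1

theorem rank_mono (hw : ∀ k ∈ S, 0 < w k) {lo lo' : WithBot α} {hi hi' : WithTop α} {x : α}
    (hx : x ∈ S) (hlo : lo < (x : WithBot α)) (hhi : (x : WithTop α) < hi)
    (h1 : lo' ≤ lo) (h2 : hi ≤ hi') : rank S w lo hi ≤ rank S w lo' hi' :=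
  Real.logb_le_logb_of_le one_lt_two ((hw x hx).trans_le (le_mass hw hx hlo hhi))
    (mass_mono hw h1 h2)

/-- This is the inequality of arithmetic and geometric means, `a b ≤ (c / 2) ^ 2`. The gain of two
pays for the two path steps consumed by a double rotation. -/
theorem logb_add_logb_le {a b c : ℝ} (ha : 0 < a) (hb : 0 < b) (h : a + b ≤ c) :
    Real.logb 2 a + Real.logb 2 b ≤ 2 * Real.logb 2 c - 2 := by
  have hc : 0 < c := by linarith
  rw [← Real.logb_mul ha.ne' hb.ne']
  have h4 : Real.logb 2 (4 : ℝ) = 2 := by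
    rw [show (4 : ℝ) = 2 ^ (2 : ℕ) by norm_num, Real.logb_pow, Real.logb_self_eq_one one_lt_two]
    norm_num
  have : 2 * Real.logb 2 c - 2 = Real.logb 2 (c ^ 2 / 4) := by
    rw [Real.logb_div (by positivity) (by norm_num), Real.logb_pow, h4]
    norm_num
  rw [this]
  apply Real.logb_le_logb_of_le one_lt_two (by positivity)
  nlinarith [sq_nonneg (a - b), mul_pos ha hb]

theorem rank_add_rank_le (hw : ∀ k ∈ S, 0 < w k) {lo : WithBot α} {hi : WithTop α} {p x y : α}
    (h1 : lo < (p : WithBot α)) (h2 : (p : WithTop α) < hi) (hx : x ∈ S) (hy : y ∈ S)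
    (hx1 : lo < (x : WithBot α)) (hx2 : x < p) (hy1 : p < y) (hy2 : (y : WithTop α) < hi) :
    rank S w lo p + rank S w p hi ≤ 2 * rank S w lo hi - 2 :=
  logb_add_logb_le
    ((hw x hx).trans_le (le_mass hw hx hx1 (WithTop.coe_lt_coe.2 hx2)))
    ((hw y hy).trans_le (le_mass hw hy (WithBot.coe_lt_coe.2 hy1) hy2))
    (mass_add_le hw h1 h2)

/-- The access lemma: the amortised number of rotations. -/
theorem potential_splayUp (hw : ∀ k ∈ S, 0 < w k) (x : α) (hx : x ∈ S) (l r : BinaryTree α)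
    (ps : List (Crumb α)) (hlo : pathLo ps < (x : WithBot α)) (hhi : (x : WithTop α) < pathHi ps)
    (hps : PathWithin S ps) :
    potential S w ⊥ ⊤ (splayUp x l r ps) + ps.length ≤
      potential S w (pathLo ps) (pathHi ps) (.node x l r) + pathPotential S w ps +
        3 * (rank S w ⊥ ⊤ - rank S w (pathLo ps) (pathHi ps)) + 1 := by
  fun_induction splayUp x l r ps with
  | case1 l r => simp [potential, pathPotential, pathLo, pathHi]
  | case2 l r p c =>
    simp only [potential, pathPotential, pathLo, pathHi, PathWithin, List.length_singleton] at *
    have hxp : x < p := WithTop.coe_lt_coe.1 hhi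
    have h1 := rank_mono hw hps.1.1 (WithBot.coe_lt_coe.2 hxp) (WithTop.coe_lt_top p)
      (bot_le : ⊥ ≤ (x : WithBot α)) le_rfl
    have h2 := rank_mono hw hx (WithBot.bot_lt_coe x) hhi le_rfl (le_top : (p : WithTop α) ≤ ⊤)
    push_cast
    linarith
  | case3 l r p c =>
    simp only [potential, pathPotential, pathLo, pathHi, PathWithin, List.length_singleton] at *
    have hxp : p < x := WithBot.coe_lt_coe.1 hlo
    have h1 := rank_mono hw hps.1.1 (WithBot.bot_lt_coe p) (WithTop.coe_lt_coe.2 hxp)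
      le_rfl (le_top : (x : WithTop α) ≤ ⊤)
    have h2 := rank_mono hw hx hlo (WithTop.coe_lt_top x) bot_le le_rfl
    push_cast
    linarith
  | case4 l r p c g d ps ih =>
    simp only [potential, pathPotential, pathLo, pathHi, PathWithin, List.length_cons] at *
    obtain ⟨⟨hp, hp1, hp2⟩, hc, ⟨hg, hg1, hg2⟩, hd, hps⟩ := hps
    have hxp : x < p := WithTop.coe_lt_coe.1 hhi
    have hpg : p < g := WithTop.coe_lt_coe.1 hp2
    have ih := ih hlo ((WithTop.coe_lt_coe.2 (hxp.trans hpg)).trans hg2) hps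
    -- Zig-zig: the old interval of `x` ends at `p` and the new interval of `g` starts there, so the
    -- two are disjoint.
    have h1 := rank_add_rank_le hw hp1 (hp2.trans hg2) hx hg hlo hxp hpg hg2
    have h2 := rank_mono hw hp (WithBot.coe_lt_coe.2 hxp) (hp2.trans hg2) hlo.le le_rfl
    have h3 := rank_mono hw hx hlo hhi le_rfl hp2.le
    push_cast at ih ⊢
    linarith
  | case5 l r p c g d ps ih =>
    simp only [potential, pathPotential, pathLo, pathHi, PathWithin, List.length_cons] at *
    obtain ⟨⟨hp, hp1, hp2⟩, hc, ⟨hg, hg1, hg2⟩, hd, hps⟩ := hps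
    have hxp : p < x := WithBot.coe_lt_coe.1 hlo
    have hpg : g < p := WithBot.coe_lt_coe.1 hp1
    have ih := ih (hg1.trans (WithBot.coe_lt_coe.2 (hpg.trans hxp))) hhi hps
    have h1 := rank_add_rank_le hw (hg1.trans hp1) hp2 hg hx hg1 hpg hxp hhi
    have h2 := rank_mono hw hp (hg1.trans hp1) (WithTop.coe_lt_coe.2 hxp) le_rfl hhi.le
    have h3 := rank_mono hw hx hlo hhi hp1.le le_rfl
    push_cast at ih ⊢
    linarith
  | case6 l r p c g d ps ih =>
    simp only [potential, pathPotential, pathLo, pathHi, PathWithin, List.length_cons] at *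
    obtain ⟨⟨hp, hp1, hp2⟩, hc, ⟨hg, hg1, hg2⟩, hd, hps⟩ := hps
    have hxp : x < p := WithTop.coe_lt_coe.1 hhi
    have hgx : g < x := WithBot.coe_lt_coe.1 hlo
    have ih := ih (hg1.trans hlo) (hhi.trans hp2) hps
    -- Zig-zag: the new intervals of `g` and `p` are the disjoint ones on the two sides of `x`.
    have h1 := rank_add_rank_le hw (hg1.trans hlo) (hhi.trans hp2) hg hp hg1 hgx hxp hp2
    have h2 := rank_mono hw hx hlo hhi hg1.le hp2.le
    have h3 := rank_mono hw hx hlo hhi le_rfl hp2.le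
    push_cast at ih ⊢
    linarith
  | case7 l r p c g d ps ih =>
    simp only [potential, pathPotential, pathLo, pathHi, PathWithin, List.length_cons] at *
    obtain ⟨⟨hp, hp1, hp2⟩, hc, ⟨hg, hg1, hg2⟩, hd, hps⟩ := hps
    have hxp : p < x := WithBot.coe_lt_coe.1 hlo
    have hgx : x < g := WithTop.coe_lt_coe.1 hhi
    have ih := ih (hp1.trans hlo) (hhi.trans hg2) hps
    have h1 := rank_add_rank_le hw (hp1.trans hlo) (hhi.trans hg2) hp hg hp1 hxp hgx hg2
    have h2 := rank_mono hw hx hlo hhi hp1.le hg2.le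
    have h3 := rank_mono hw hx hlo hhi hp1.le le_rfl
    push_cast at ih ⊢
    linarith

/-- Descending only regroups the summands of the potential between the current subtree and the path,
because the bounds stored along the path are those the subtree sees. -/
theorem descend_within (k : α) (t : BinaryTree α) (ps : List (Crumb α))
    (ht : Within S (pathLo ps) (pathHi ps) t) (hps : PathWithin S ps)
    (hlo : pathLo ps < (k : WithBot α)) (hhi : (k : WithTop α) < pathHi ps) :
    PathWithin S (descend k t ps).2 ∧
      pathLo (descend k t ps).2 < (k : WithBot α) ∧ (k : WithTop α) < pathHi (descend k t ps).2 ∧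
      potential S w (pathLo (descend k t ps).2) (pathHi (descend k t ps).2) (descend k t ps).1 +
        pathPotential S w (descend k t ps).2 =
          potential S w (pathLo ps) (pathHi ps) t + pathPotential S w ps := by
  induction t generalizing ps with
  | nil => exact ⟨hps, hlo, hhi, rfl⟩
  | node a l r ihl ihr =>
    obtain ⟨ha, hl, hr⟩ := ht
    unfold descend
    split_ifs with c1 c2
    · obtain ⟨h1, h2, h3, h4⟩ := ihl (.wentLeft a r :: ps) hl ⟨ha, hr, hps⟩ hlo
        (WithTop.coe_lt_coe.2 c1)
      refine ⟨h1, h2, h3, h4.trans ?_⟩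
      simp only [potential, pathPotential, pathLo, pathHi]
      ring
    · obtain ⟨h1, h2, h3, h4⟩ := ihr (.wentRight a l :: ps) hr ⟨ha, hl, hps⟩
        (WithBot.coe_lt_coe.2 c2) hhi
      refine ⟨h1, h2, h3, h4.trans ?_⟩
      simp only [potential, pathPotential, pathLo, pathHi]
      ring
    · exact ⟨hps, hlo, hhi, rfl⟩

/-- The search visits one node more than there are path steps if it succeeds, and equally many if it
ends at an empty subtree; both cases are covered by the slack of one. -/
theorem length_descend (k : α) (t : BinaryTree α) (ps : List (Crumb α)) :
    (descend k t ps).2.length ≤ searchLen k t + ps.length ∧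
      searchLen k t + ps.length ≤ (descend k t ps).2.length + 1 ∧
      ∀ a l r, (descend k t ps).1 = .node a l r → a = k := by
  induction t generalizing ps with
  | nil => simp [descend, searchLen]
  | node a l r ihl ihr =>
    unfold descend searchLen
    split_ifs with c1 c2
    · have := ihl (.wentLeft a r :: ps)
      simp only [List.length_cons] at this
      exact ⟨by omega, by omega, this.2.2⟩
    · have := ihr (.wentRight a l :: ps)
      simp only [List.length_cons] at this
      exact ⟨by omega, by omega, this.2.2⟩
    · refine ⟨by dsimp only; omega, by dsimp only; omega, ?_⟩
      intro b l' r' hb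
      injection hb with hb _ _
      exact hb ▸ le_antisymm (not_lt.mp c1) (not_lt.mp c2)

theorem descend_links (k : α) (t : BinaryTree α) (ps : List (Crumb α)) :
    linksBelow (pathParent (descend k t ps).2) (descend k t ps).1 + pathLinks (descend k t ps).2 =
      linksBelow (pathParent ps) t + pathLinks ps := by
  induction t generalizing ps with
  | nil => rfl
  | node a l r ihl ihr =>
    unfold descend
    split_ifs with c1 c2
    · rw [ihl]
      simp only [linksBelow, pathLinks, pathParent, ← Multiset.singleton_add]
      abel
    · rw [ihr]
      simp only [linksBelow, pathLinks, pathParent, ← Multiset.singleton_add]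
      abel
    · rfl

/-- The additional one is the link of the new leaf when the key was missing. -/
theorem linkChanges_splay (k : α) (t : BinaryTree α) :
    linkChanges (treeLinks t) (treeLinks (splay k t)) ≤ 14 * searchLen k t + 1 := by
  have h1 := length_descend k t []
  have h2 := descend_links k t []
  have e : treeLinks t = linksBelow (pathParent []) t + pathLinks [] := by
    simp [treeLinks, pathParent, pathLinks]
  rw [e, ← h2]
  unfold splay
  generalize descend k t [] = d at h1 ⊢
  obtain ⟨s, ps⟩ := d
  simp only [List.length_nil, add_zero] at h1
  rcases s with _ | ⟨a, l, r⟩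
  · have h3 := linkChanges_splayUp k .nil .nil ps
    have h4 := linkChanges_triangle (linksBelow (pathParent ps) .nil + pathLinks ps)
      (linksBelow (pathParent ps) (.node k .nil .nil) + pathLinks ps)
      (treeLinks (splayUp k .nil .nil ps))
    have h5 := linkChanges_add (linksBelow (pathParent ps) .nil)
      (linksBelow (pathParent ps) (.node k .nil .nil)) (pathLinks ps) (pathLinks ps)
    have h6 := linkChanges_le_card (linksBelow (pathParent ps) .nil)
      (linksBelow (pathParent ps) (.node k .nil .nil))
    rw [linkChanges_self] at h5
    simp only [linksBelow, Multiset.card_zero, Multiset.card_cons, add_zero] at h6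
    simp only [linksBelow, add_zero] at h3 h4 h5 ⊢
    omega
  · have h3 := linkChanges_splayUp a l r ps
    simp only at h3 ⊢
    omega

theorem within_of_isBST {lo : WithBot α} {hi : WithTop α} {t : BinaryTree α} (h : IsBST t)
    (h' : ∀ x ∈ keys t, x ∈ S ∧ lo < (x : WithBot α) ∧ (x : WithTop α) < hi) :
    Within S lo hi t := by
  induction t generalizing lo hi with
  | nil => trivial
  | node a l r ihl ihr =>
    rw [isBST_node] at h
    refine ⟨h' a (by simp [keys]), ihl h.1 fun x hx => ?_, ihr h.2.1 fun x hx => ?_⟩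
    · have := h' x (by simp [keys, hx])
      exact ⟨this.1, this.2.1, WithTop.coe_lt_coe.2 (h.2.2.1 x hx)⟩
    · have := h' x (by simp [keys, hx])
      exact ⟨this.1, WithBot.coe_lt_coe.2 (h.2.2.2 x hx), this.2.2⟩

/-- The interval of a node contains its own key. This bounds the final potential from below, which
may be negative as the weights are at most one. -/
theorem sum_le_potential (hw : ∀ k ∈ S, 0 < w k) {lo : WithBot α} {hi : WithTop α}
    {t : BinaryTree α} (h : Within S lo hi t) :
    ((keys t).map fun k => Real.logb 2 (w k)).sum ≤ potential S w lo hi t := by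
  induction t generalizing lo hi with
  | nil => simp [keys, potential]
  | node a l r ihl ihr =>
    obtain ⟨⟨ha, h1, h2⟩, hl, hr⟩ := h
    have := ihl hl
    have := ihr hr
    have : Real.logb 2 (w a) ≤ rank S w lo hi :=
      Real.logb_le_logb_of_le one_lt_two (hw a ha) (le_mass hw ha h1 h2)
    simp only [keys, potential, List.map_append, List.map_cons, List.sum_append, List.sum_cons]
    linarith

/-- The amortised cost of an access. -/
theorem potential_splay (hw : ∀ k ∈ S, 0 < w k) (hS : mass S w ⊥ ⊤ ≤ 1) {k : α} (hk : k ∈ S)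
    {t : BinaryTree α} (ht : Within S ⊥ ⊤ t) :
    potential S w ⊥ ⊤ (splay k t) + searchLen k t ≤
      potential S w ⊥ ⊤ t - 3 * Real.logb 2 (w k) + 2 := by
  obtain ⟨h1, h2, h3, h4⟩ := descend_within (w := w) k t [] ht trivial (WithBot.bot_lt_coe k)
    (WithTop.coe_lt_top k)
  obtain ⟨h5, h6, h7⟩ := length_descend k t []
  have hR : rank S w ⊥ ⊤ ≤ 0 := by
    have := Real.logb_le_logb_of_le one_lt_two ((hw k hk).trans_le (le_mass hw hk
      (WithBot.bot_lt_coe k) (WithTop.coe_lt_top k))) hS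
    rwa [Real.logb_one] at this
  unfold splay
  generalize descend k t [] = d at h1 h2 h3 h4 h5 h6 h7 ⊢
  obtain ⟨s, ps⟩ := d
  simp only [pathPotential, pathLo, pathHi, add_zero, List.length_nil] at h1 h2 h3 h4 h5 h6
  have h8 : Real.logb 2 (w k) ≤ rank S w (pathLo ps) (pathHi ps) :=
    Real.logb_le_logb_of_le one_lt_two (hw k hk) (le_mass hw hk h2 h3)
  have h9 := rank_mono hw hk h2 h3 bot_le le_top
  have h6' : (searchLen k t : ℝ) ≤ ps.length + 1 := by exact_mod_cast h6
  rcases s with _ | ⟨a, l, r⟩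
  -- Appending a missing key leaves the ranks on the path unchanged, since masses count all keys of
  -- `S`. Only the rank of the new leaf is added, and it lies between the logarithm of the weight
  -- and zero.
  · have := potential_splayUp hw k hk .nil .nil ps h2 h3 h1
    simp only [potential] at this h4 ⊢
    linarith
  · obtain rfl := h7 a l r rfl
    have := potential_splayUp hw a hk l r ps h2 h3 h1
    simp only at this ⊢
    linarith

end Potential

/-! ### From the access lemma to static optimality. -/

section StaticOptimality

variable {α : Type} [LinearOrder α]

/-- Kraft's inequality for search trees. -/
theorem sum_pow_searchLen_le {T : BinaryTree α} (hT : IsBST T) :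
    ((keys T).map fun k => (1 / 4 : ℝ) ^ searchLen k T).sum ≤ 1 := by
  induction T with
  | nil => simp [keys]
  | node a l r ihl ihr =>
    obtain ⟨hl, hr, h1, h2⟩ := isBST_node.1 hT
    have e1 : (keys l).map (fun k => (1 / 4 : ℝ) ^ searchLen k (.node a l r)) =
        (keys l).map fun k => (1 / 4 : ℝ) * (1 / 4 : ℝ) ^ searchLen k l := by
      apply List.map_congr_left
      intro k hk
      simp [searchLen, h1 k hk, pow_add]
    have e2 : (keys r).map (fun k => (1 / 4 : ℝ) ^ searchLen k (.node a l r)) =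
        (keys r).map fun k => (1 / 4 : ℝ) * (1 / 4 : ℝ) ^ searchLen k r := by
      apply List.map_congr_left
      intro k hk
      simp [searchLen, h2 k hk, (h2 k hk).not_gt, pow_add]
    simp only [keys, List.map_append, List.map_cons, List.sum_append, List.sum_cons, e1, e2,
      List.sum_map_mul_left]
    have := ihl hl
    have := ihr hr
    -- A root and two subtrees contribute at most `1/4 + 1/4 + 1/4`. The base `1/2` would break this
    -- induction, and `1/4` keeps binary logarithms integral.
    have e3 : searchLen a (.node a l r) = 1 := by simp [searchLen]
    rw [e3]
    linarith

theorem splayTree_access (k : α) (t : (splayTree α).State) :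
    ((splayTree α).access k t).1 = splay k t.1 := by
  unfold SelfAdjustingBST.access
  split_ifs <;> rfl

/-- Each visited node costs one hop and fourteen link changes, so the amortised search length `2 - 3
log w` is multiplied by 15; the link of a new leaf turns 30 into 31. The potentials telescope. -/
theorem splayTree_totalCost {S : Finset α} {w : α → ℝ} (hw : ∀ k ∈ S, 0 < w k)
    (hS : mass S w ⊥ ⊤ ≤ 1) (ks : List α) (hks : ∀ k ∈ ks, k ∈ S) (t : (splayTree α).State)
    (ht : ∀ k ∈ keys t.1, k ∈ S) :
    ∃ t' : BinaryTree α, IsBST t' ∧ (∀ k, k ∈ keys t' ↔ k ∈ ks ∨ k ∈ keys t.1) ∧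
      ((splayTree α).totalCost t ks : ℝ) ≤
        15 * (potential S w ⊥ ⊤ t.1 - potential S w ⊥ ⊤ t') +
          (ks.map fun k => 31 - 45 * Real.logb 2 (w k)).sum := by
  induction ks generalizing t with
  | nil => exact ⟨t.1, t.2, by simp, by simp [SelfAdjustingBST.totalCost]⟩
  | cons k ks ih =>
    have e := splayTree_access k t
    have hmem : ∀ x, x ∈ keys ((splayTree α).access k t).1 ↔ x = k ∨ x ∈ keys t.1 := by
      rw [e]; exact (splay_spec k t.1 t.2).2
    have hk : k ∈ S := hks k (by simp)
    obtain ⟨t', h1, h2, h3⟩ := ih (fun x hx => hks x (by simp [hx])) ((splayTree α).access k t) (by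
      intro x hx
      rcases (hmem x).1 hx with rfl | hx
      · exact hk
      · exact ht x hx)
    refine ⟨t', h1, ?_, ?_⟩
    · intro x
      rw [h2, hmem, List.mem_cons]
      tauto
    · have h4 := potential_splay hw hS hk (within_of_isBST (lo := ⊥) (hi := ⊤) t.2
        fun x hx => ⟨ht x hx, WithBot.bot_lt_coe x, WithTop.coe_lt_top x⟩)
      have h5 : ((splayTree α).accessCost k t : ℝ) ≤ 15 * searchLen k t.1 + 1 := by
        have := linkChanges_splay k t.1
        have h6 : (splayTree α).accessCost k t = searchLen k t.1 +
            linkChanges (treeLinks t.1) (treeLinks (splay k t.1)) := by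
          rw [← e]; rfl
        rw [h6]
        exact_mod_cast (by omega : _ ≤ 15 * searchLen k t.1 + 1)
      simp only [SelfAdjustingBST.totalCost, List.map_cons, List.sum_cons]
      push_cast
      rw [e] at h3
      linarith

end StaticOptimality

end Splay

/-- Splay trees are statically optimal. -/
theorem splayTree_isStaticallyOptimal (α : Type) [LinearOrder α] :
    (splayTree α).IsStaticallyOptimal 151 := by
  intro ks T hT hks
  have hw : ∀ k ∈ (keys T).toFinset, 0 < (fun k => (1 / 4 : ℝ) ^ searchLen k T) k := by
    intro k _
    positivity
  have hlog : ∀ k, Real.logb 2 ((1 / 4 : ℝ) ^ searchLen k T) = -2 * searchLen k T := by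
    intro k
    rw [Real.logb_pow, show (1 / 4 : ℝ) = ((2 : ℝ) ^ (2 : ℕ))⁻¹ by norm_num, Real.logb_inv,
      Real.logb_pow, Real.logb_self_eq_one one_lt_two]
    norm_num
    ring
  have hmass : Splay.mass (keys T).toFinset (fun k => (1 / 4 : ℝ) ^ searchLen k T) ⊥ ⊤ ≤ 1 := by
    have := Splay.sum_pow_searchLen_le hT
    rw [← List.sum_toFinset _ hT.nodup] at this
    simpa [Splay.mass] using this
  obtain ⟨t', h1, h2, h3⟩ := Splay.splayTree_totalCost hw hmass ks
    (fun k hk => List.mem_toFinset.2 (hks k hk)) (splayTree α).init (by simp [splayTree, keys])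
  have h4 := Splay.sum_le_potential hw (Splay.within_of_isBST (lo := ⊥) (hi := ⊤) h1
    (S := (keys T).toFinset) (fun x hx => by
      have : x ∈ ks := by
        have := (h2 x).1 hx
        simpa [splayTree, keys] using this
      exact ⟨List.mem_toFinset.2 (hks x this), WithBot.bot_lt_coe x, WithTop.coe_lt_top x⟩))
  simp only [hlog] at h3 h4
  have h5 : Splay.potential (keys T).toFinset (fun k => (1 / 4 : ℝ) ^ searchLen k T) ⊥ ⊤
      (splayTree α).init.1 = 0 := rfl
  -- The keys left at the end are distinct and each was accessed, so the negative final potential is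
  -- charged to one access per key.
  have h6 : ((keys t').map fun k => searchLen k T).sum ≤ (ks.map fun k => searchLen k T).sum := by
    have hsub : List.Subperm (keys t') ks := by
      apply h1.nodup.subperm
      intro x hx
      have := (h2 x).1 hx
      simpa [splayTree, keys] using this
    obtain ⟨l, hl, hl'⟩ := hsub
    rw [← (hl.map _).sum_eq]
    exact (hl'.map _).sum_le_sum (by simp)
  -- A search visits at least one node, so the constant 31 is absorbed into `31 + 90 = 121`. The
  -- final potential accounts for the other `15 * 2 = 30` of the 151.
  have h7 : ∀ k ∈ ks, (31 - 45 * (-2 * (searchLen k T : ℝ))) ≤ 121 * searchLen k T := by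
    intro k hk
    have : (1 : ℝ) ≤ searchLen k T := by exact_mod_cast one_le_searchLen (hks k hk)
    linarith
  have h8 := List.sum_le_sum h7
  have h9 : ((keys t').map fun k => -2 * (searchLen k T : ℝ)).sum =
      -2 * (((keys t').map fun k => searchLen k T).sum : ℕ) := by
    rw [List.sum_map_mul_left, Nat.cast_list_sum, List.map_map]; rfl
  have h10 : (ks.map fun k => 121 * (searchLen k T : ℝ)).sum =
      121 * ((ks.map fun k => searchLen k T).sum : ℕ) := by
    rw [List.sum_map_mul_left, Nat.cast_list_sum, List.map_map]; rfl
  have h6' : (((keys t').map fun k => searchLen k T).sum : ℝ) ≤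
      ((ks.map fun k => searchLen k T).sum : ℕ) := by exact_mod_cast h6
  rw [h5] at h3
  rw [h9] at h4
  rw [h10] at h8
  have : ((splayTree α).totalCost (splayTree α).init ks : ℝ) ≤
      (151 * (ks.map fun k => searchLen k T).sum : ℕ) := by
    push_cast at *
    linarith
  exact_mod_cast this

/-! ### Weight-balanced trees -/

section WeightBalanced

variable {α : Type}

/-- The element at which the prefix sums first exceed `h`; for half of the total it is the weighted
median. -/
theorem exists_split_of_lt_sum (w : α → ℝ) (ks : List α) (h : ℝ) (h0 : 0 ≤ h)
    (h1 : h < (ks.map w).sum) :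
    ∃ l a r, ks = l ++ a :: r ∧ (l.map w).sum ≤ h ∧ h < (l.map w).sum + w a := by
  induction ks generalizing h with
  | nil => simp at h1; linarith
  | cons k ks ih =>
    by_cases hk : h < w k
    · exact ⟨[], k, ks, rfl, by simpa using h0, by simpa using hk⟩
    · push Not at hk
      obtain ⟨l, a, r, e, h2, h3⟩ := ih (h - w k) (by linarith) (by simp at h1; linarith)
      refine ⟨k :: l, a, r, by simp [e], ?_, ?_⟩ <;> simp <;> linarith

/-- With the weighted median at the root, both subtrees carry at most half of the weight, so each
level of depth halves the weight available to a key. -/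
theorem exists_weight_balanced_tree [LinearOrder α] (w : α → ℝ) (ks : List α)
    (hks : ks.Pairwise (· < ·)) (hw : ∀ k ∈ ks, 0 < w k) :
    ∃ T : BinaryTree α, keys T = ks ∧
      ∀ k ∈ ks, w k * 2 ^ searchLen k T ≤ 2 * (ks.map w).sum := by
  induction hn : ks.length using Nat.strong_induction_on generalizing ks with
  | _ n ih =>
    subst hn
    rcases ks.eq_nil_or_concat with rfl | ⟨_, _, hne⟩
    · exact ⟨.nil, rfl, by simp⟩
    have hpos : 0 < (ks.map w).sum := by
      apply List.sum_pos
      · intro x hx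
        obtain ⟨k, hk, rfl⟩ := List.mem_map.1 hx
        exact hw k hk
      · simp [hne]
    obtain ⟨l, a, r, rfl, h1, h2⟩ := exists_split_of_lt_sum w ks ((ks.map w).sum / 2)
      (by linarith) (by linarith)
    have h3 := hks
    simp only [List.pairwise_append, List.pairwise_cons, List.mem_cons] at h3
    obtain ⟨hl, ⟨har, hr⟩, hlr⟩ := h3
    obtain ⟨L, hL, hL'⟩ := ih l.length (by simp) l hl (fun k hk => hw k (by simp [hk])) rfl
    obtain ⟨R, hR, hR'⟩ := ih r.length (by simp; omega) r hr (fun k hk => hw k (by simp [hk])) rfl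
    simp only [List.map_append, List.map_cons, List.sum_append, List.sum_cons] at h1 h2 hpos ⊢
    have hwl : 0 ≤ (l.map w).sum := List.sum_nonneg (by
      intro x hx
      obtain ⟨k, hk, rfl⟩ := List.mem_map.1 hx
      exact (hw k (by simp [hk])).le)
    have hwr : 0 ≤ (r.map w).sum := List.sum_nonneg (by
      intro x hx
      obtain ⟨k, hk, rfl⟩ := List.mem_map.1 hx
      exact (hw k (by simp [hk])).le)
    refine ⟨.node a L R, by simp [keys, hL, hR], ?_⟩
    intro k hk
    simp only [List.mem_append, List.mem_cons] at hk
    rcases hk with hk | rfl | hk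
    · have := hL' k hk
      have h4 : k < a := hlr k hk a (Or.inl rfl)
      simp only [searchLen, h4, if_true, pow_add, pow_one]
      linarith
    · simp only [searchLen, lt_irrefl, if_false, add_zero, pow_one]
      linarith
    · have := hR' k hk
      have h4 : a < k := har k hk
      simp only [searchLen, h4, h4.not_gt, if_true, if_false, pow_add, pow_one]
      linarith

/-- For every subprobability there is a search tree in which the search lengths are bounded by the
logarithms of the inverse probabilities. -/
theorem exists_tree_searchLen_le [LinearOrder α] [Fintype α] (w : α → ℝ) (hw : ∀ k, 0 ≤ w k)
    (hsum : ∑ k, w k ≤ 1) :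
    ∃ T : BinaryTree α, IsBST T ∧ (∀ k, k ∈ keys T ↔ 0 < w k) ∧
      ∀ k, 0 < w k → (searchLen k T : ℝ) ≤ 1 - Real.logb 2 (w k) := by
  obtain ⟨T, h1, h2⟩ := exists_weight_balanced_tree w
    ((Finset.univ.filter fun k => 0 < w k).sort (· ≤ ·)) (Finset.sortedLT_sort _).pairwise
    (by simp)
  have hsum' : (((Finset.univ.filter fun k => 0 < w k).sort (· ≤ ·)).map w).sum ≤ 1 := by
    refine le_trans (le_of_eq ?_) ((Finset.sum_le_univ_sum_of_nonneg hw
      (s := Finset.univ.filter fun k => 0 < w k)).trans hsum)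
    rw [← List.sum_toFinset _ (Finset.sort_nodup _ _), Finset.sort_toFinset]
  refine ⟨T, by rw [IsBST, h1]; exact (Finset.sortedLT_sort _).pairwise, by simp [h1], ?_⟩
  intro k hk
  have h3 := h2 k (by simpa using hk)
  have h4 : w k * 2 ^ searchLen k T ≤ 2 := by linarith
  have h5 := Real.logb_le_logb_of_le one_lt_two (by positivity) h4
  rw [Real.logb_mul hk.ne' (by positivity), Real.logb_pow,
    Real.logb_self_eq_one one_lt_two] at h5
  linarith

end WeightBalanced

/-! ### Conditional entropies -/

section Entropy

variable {V : Type} [DecidableEq V]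

theorem countP_pos_of_mem {σ : List (V × V)} {x y : V} (h : (x, y) ∈ σ) :
    (0 : ℝ) < σ.countP fun r => r.1 = x := by
  exact_mod_cast List.countP_pos_iff.2 ⟨(x, y), h, by simp⟩

/-- The conditional frequency of the destination `y`, given the source `x`. -/
noncomputable def condFreq (σ : List (V × V)) (x y : V) : ℝ :=
  (σ.count (x, y) : ℝ) / σ.countP fun r => r.1 = x

theorem condFreq_nonneg (σ : List (V × V)) (x y : V) : 0 ≤ condFreq σ x y := by
  unfold condFreq; positivity

theorem condFreq_pos {σ : List (V × V)} {x y : V} (h : (x, y) ∈ σ) : 0 < condFreq σ x y :=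
  div_pos (by exact_mod_cast List.count_pos_iff.2 h) (countP_pos_of_mem h)

theorem condFreq_swap_pos {σ : List (V × V)} {x y : V} (h : (x, y) ∈ σ) :
    0 < condFreq (σ.map Prod.swap) y x :=
  condFreq_pos (List.mem_map.2 ⟨(x, y), h, rfl⟩)

variable [Fintype V]

theorem sum_map_eq_sum_count (σ : List (V × V)) (f : V → V → ℝ) :
    (σ.map fun r => f r.1 r.2).sum = ∑ x, ∑ y, (σ.count (x, y) : ℝ) * f x y := by
  induction σ with
  | nil => simp
  | cons r σ ih =>
    obtain ⟨a, b⟩ := r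
    have : ∀ x y, (((a, b) :: σ).count (x, y) : ℝ) * f x y =
        (σ.count (x, y) : ℝ) * f x y + if a = x then if b = y then f x y else 0 else 0 := by
      intro x y
      rw [List.count_cons]
      by_cases h : a = x <;> by_cases h' : b = y <;> simp [h, h', add_mul]
    simp only [this, Finset.sum_add_distrib, List.map_cons, List.sum_cons, ih]
    simp [add_comm]

theorem sum_count_eq_countP (σ : List (V × V)) (x : V) :
    ∑ y, (σ.count (x, y) : ℝ) = σ.countP fun r => r.1 = x := by
  induction σ with
  | nil => simp
  | cons r σ ih =>
    obtain ⟨a, b⟩ := r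
    simp only [List.count_cons, List.countP_cons, Nat.cast_add, Finset.sum_add_distrib, ih]
    congr 1
    by_cases h : a = x
    · subst h; simp
    · simp [h]

theorem sum_condFreq_le (σ : List (V × V)) (x : V) : ∑ y, condFreq σ x y ≤ 1 := by
  simp only [condFreq, ← Finset.sum_div, sum_count_eq_countP]
  exact div_self_le_one _

/-- The joint frequency over the marginal one is the conditional frequency, and summing over pairs
with multiplicity is summing over requests. The entropy is thus a sum of code lengths, which can be
split along windows. -/
theorem length_mul_entropyDstGivenSrc (b : ℝ) (σ : List (V × V)) :
    σ.length * entropyDstGivenSrc b σ =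
      (σ.map fun r => -Real.logb b (condFreq σ r.1 r.2)).sum := by
  rcases σ.eq_nil_or_concat with rfl | ⟨_, _, hne⟩
  · simp
  have hl : (0 : ℝ) < σ.length := by simp [hne]; positivity
  rw [sum_map_eq_sum_count σ fun x y => -Real.logb b (condFreq σ x y)]
  simp only [entropyDstGivenSrc, mul_neg, Finset.mul_sum, Finset.sum_neg_distrib]
  congr 1
  refine Finset.sum_congr rfl fun x _ => Finset.sum_congr rfl fun y _ => ?_
  have e : freq σ x y / freqSrc σ x = condFreq σ x y := by
    simp only [freq, freqSrc, condFreq]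
    exact div_div_div_cancel_right₀ hl.ne' _ _
  rw [e]
  by_cases h : (x, y) ∈ σ
  · have := countP_pos_of_mem h
    simp only [freqSrc, condFreq]
    field_simp
  · have : σ.count (x, y) = 0 := List.count_eq_zero_of_not_mem h
    simp [condFreq, this]

/-- Gibbs' inequality. -/
theorem length_mul_entropyDstGivenSrc_le {b : ℝ} (hb : 1 < b) (σ : List (V × V)) (g : V → V → ℝ)
    (hg : ∀ x y, 0 ≤ g x y) (hpos : ∀ r ∈ σ, 0 < g r.1 r.2) (hsum : ∀ x, ∑ y, g x y ≤ 1) :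
    σ.length * entropyDstGivenSrc b σ ≤ (σ.map fun r => -Real.logb b (g r.1 r.2)).sum := by
  rw [length_mul_entropyDstGivenSrc, sum_map_eq_sum_count σ fun x y => -Real.logb b (condFreq σ x y),
    sum_map_eq_sum_count σ fun x y => -Real.logb b (g x y), ← sub_nonneg]
  have hlog : 0 < Real.log b := Real.log_pos hb
  -- This is `log z ≤ z - 1` at the ratio `z` of the two conditional weights. Summed over `y`, the
  -- left side is nonnegative because `g x` has total at most one.
  have key : ∀ x y, ((σ.count (x, y) : ℝ) - (σ.countP fun r => r.1 = x) * g x y) / Real.log b ≤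
      (σ.count (x, y) : ℝ) * -Real.logb b (g x y) -
        (σ.count (x, y) : ℝ) * -Real.logb b (condFreq σ x y) := by
    intro x y
    by_cases h : (x, y) ∈ σ
    · have h1 := countP_pos_of_mem h
      have h2 : (0 : ℝ) < σ.count (x, y) := by exact_mod_cast List.count_pos_iff.2 h
      have h3 := hpos _ h
      have h4 := condFreq_pos h
      have h5 := Real.log_le_sub_one_of_pos (div_pos h3 h4)
      rw [Real.log_div h3.ne' h4.ne'] at h5
      have h6 : (σ.count (x, y) : ℝ) * (g x y / condFreq σ x y - 1) =
          (σ.countP fun r => r.1 = x) * g x y - σ.count (x, y) := by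
        simp only [condFreq]
        field_simp
      have h7 := mul_le_mul_of_nonneg_left h5 h2.le
      rw [h6] at h7
      simp only [Real.logb]
      rw [div_le_iff₀ hlog]
      field_simp
      linarith
    · have : σ.count (x, y) = 0 := List.count_eq_zero_of_not_mem h
      simp only [this, Nat.cast_zero, zero_mul, zero_sub, sub_zero]
      apply div_nonpos_of_nonpos_of_nonneg _ hlog.le
      have := hg x y
      have : (0 : ℝ) ≤ (σ.countP fun r => r.1 = x) * g x y := by positivity
      linarith
  rw [← Finset.sum_sub_distrib]
  refine Finset.sum_nonneg fun x _ => ?_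
  rw [← Finset.sum_sub_distrib]
  refine le_trans ?_ (Finset.sum_le_sum fun y _ => key x y)
  rw [← Finset.sum_div, Finset.sum_sub_distrib, ← Finset.mul_sum, sum_count_eq_countP]
  apply div_nonneg _ hlog.le
  nlinarith [hsum x, (Nat.cast_nonneg (σ.countP fun r => r.1 = x) : (0 : ℝ) ≤ _)]

/-- Reversing all requests exchanges the two entropies, so each fact needs a proof for only one of
them. -/
theorem entropySrcGivenDst_eq_swap (b : ℝ) (σ : List (V × V)) :
    entropySrcGivenDst b σ = entropyDstGivenSrc b (σ.map Prod.swap) := by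
  have h1 : ∀ x y, freq (σ.map Prod.swap) y x = freq σ x y := by
    intro x y
    simp only [freq, List.length_map]
    rw [← List.count_map_of_injective σ Prod.swap Prod.swap_injective (x, y)]
    rfl
  have h2 : ∀ y, freqSrc (σ.map Prod.swap) y = freqDst σ y := by
    intro y
    simp only [freqSrc, freqDst, List.length_map, List.countP_map]
    rfl
  simp only [entropySrcGivenDst, entropyDstGivenSrc, h1, h2]

theorem length_mul_entropySrcGivenDst (b : ℝ) (σ : List (V × V)) :
    σ.length * entropySrcGivenDst b σ =
      (σ.map fun r => -Real.logb b (condFreq (σ.map Prod.swap) r.2 r.1)).sum := by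
  have := length_mul_entropyDstGivenSrc b (σ.map Prod.swap)
  simp only [List.length_map, List.map_map] at this
  rw [entropySrcGivenDst_eq_swap, this]
  rfl

theorem condFreq_le_one (σ : List (V × V)) (x y : V) : condFreq σ x y ≤ 1 :=
  (Finset.single_le_sum (f := fun y => condFreq σ x y) (fun y _ => condFreq_nonneg σ x y)
    (Finset.mem_univ y)).trans (sum_condFreq_le σ x)

theorem entropyDstGivenSrc_nonneg {b : ℝ} (hb : 1 < b) (σ : List (V × V)) :
    0 ≤ entropyDstGivenSrc b σ := by
  rcases σ.eq_nil_or_concat with rfl | ⟨_, _, hne⟩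
  · simp [entropyDstGivenSrc, freq, freqSrc]
  have hl : (0 : ℝ) < σ.length := by simp [hne]; positivity
  refine nonneg_of_mul_nonneg_right ?_ hl
  rw [length_mul_entropyDstGivenSrc]
  apply List.sum_nonneg
  intro z hz
  obtain ⟨r, hr, rfl⟩ := List.mem_map.1 hz
  have := Real.logb_nonpos hb (condFreq_nonneg σ r.1 r.2) (condFreq_le_one σ r.1 r.2)
  linarith

theorem entropySrcGivenDst_nonneg {b : ℝ} (hb : 1 < b) (σ : List (V × V)) :
    0 ≤ entropySrcGivenDst b σ := by
  rw [entropySrcGivenDst_eq_swap]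
  exact entropyDstGivenSrc_nonneg hb _

theorem entropyDstGivenSrc_two {b : ℝ} (hb : 1 < b) (σ : List (V × V)) :
    entropyDstGivenSrc 2 σ = Real.logb 2 b * entropyDstGivenSrc b σ := by
  have h : ∀ z : ℝ, Real.logb 2 z = Real.logb 2 b * Real.logb b z := by
    intro z
    have h1 : Real.log b ≠ 0 := (Real.log_pos hb).ne'
    have h2 : Real.log 2 ≠ 0 := (Real.log_pos one_lt_two).ne'
    simp only [Real.logb]
    field_simp
  simp only [entropyDstGivenSrc, mul_neg, Finset.mul_sum]
  congr 1
  refine Finset.sum_congr rfl fun x _ => Finset.sum_congr rfl fun y _ => ?_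
  rw [h]
  ring

theorem entropySrcGivenDst_two {b : ℝ} (hb : 1 < b) (σ : List (V × V)) :
    entropySrcGivenDst 2 σ = Real.logb 2 b * entropySrcGivenDst b σ := by
  rw [entropySrcGivenDst_eq_swap, entropySrcGivenDst_eq_swap, entropyDstGivenSrc_two hb]

end Entropy

/-! ### The entropy lower bound for fixed networks -/

section FixedNetworks

variable {V : Type} [Fintype V] [DecidableEq V]

-- The last but one node of a shortest walk lies on the preceding sphere, and each node there has at
-- most `Δ` neighbours.
open Classical in
theorem card_edist_eq_le (N : SimpleGraph V) {Δ : ℕ} (hN : ∀ v, (N.neighborSet v).ncard ≤ Δ)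
    (x : V) (d : ℕ) : (Finset.univ.filter fun y => N.edist x y = d).card ≤ Δ ^ d := by
  induction d with
  | zero =>
    simp only [Nat.cast_zero, SimpleGraph.edist_eq_zero_iff, pow_zero]
    exact Finset.card_le_one.2 (by simp)
  | succ d ih =>
    have hsub : (Finset.univ.filter fun y => N.edist x y = (d + 1 : ℕ)) ⊆
        (Finset.univ.filter fun y => N.edist x y = d).biUnion fun z => N.neighborFinset z := by
      intro y hy
      simp only [Finset.mem_filter, Finset.mem_univ, true_and, Finset.mem_biUnion,
        SimpleGraph.mem_neighborFinset] at hy ⊢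
      obtain ⟨p, hp⟩ := SimpleGraph.exists_walk_of_edist_eq_coe hy
      have hn : ¬ p.Nil := by
        intro h
        have := SimpleGraph.Walk.length_eq_zero_iff.2 h
        omega
      refine ⟨p.penultimate, ?_, p.adj_penultimate hn⟩
      have h1 : N.edist x p.penultimate ≤ d := by
        refine (SimpleGraph.edist_le p.dropLast).trans ?_
        have : p.dropLast.length = d := by
          simp [hp]
        rw [this]
      have h2 : N.edist x y ≤ N.edist x p.penultimate + 1 := by
        refine (SimpleGraph.edist_triangle (v := p.penultimate)).trans ?_
        gcongr
        rw [SimpleGraph.edist_eq_one_iff_adj.2 (p.adj_penultimate hn)]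
      rw [hy] at h2
      refine le_antisymm h1 ?_
      push_cast at h2
      exact (ENat.add_le_add_iff_right (by simp)).1 h2
    refine (Finset.card_le_card hsub).trans (Finset.card_biUnion_le.trans ?_)
    rw [pow_succ]
    refine (Finset.sum_le_card_nsmul _ _ Δ fun z _ => ?_).trans ?_
    · have := hN z
      rwa [← Nat.card_coe_set_eq, Nat.card_eq_fintype_card, SimpleGraph.card_neighborSet_eq_degree,
        ← SimpleGraph.card_neighborFinset_eq_degree] at this
    · exact Nat.mul_le_mul_right _ ih

open Classical in
/-- The weights of the destinations `y` in the lower bound; they sum up to at most one. -/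
noncomputable def distWeight (N : SimpleGraph V) (Δ : ℕ) (x y : V) : ℝ :=
  if x ≠ y ∧ N.edist x y ≠ ⊤ then ((Δ : ℝ)⁻¹) ^ (2 * N.dist x y) else 0

omit [Fintype V] in
theorem distWeight_nonneg (N : SimpleGraph V) (Δ : ℕ) (x y : V) : 0 ≤ distWeight N Δ x y := by
  unfold distWeight
  split_ifs <;> positivity

/-- The sphere of radius `d` contributes at most `Δ ^ d * Δ ^ (-2 d) ≤ 2 ^ (-d)`. The sum stays
below one because the centre itself has weight zero, and so have unreachable nodes, for which `dist`
takes the default value zero. -/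
theorem sum_distWeight_le (N : SimpleGraph V) {Δ : ℕ} (hΔ : 2 ≤ Δ)
    (hN : ∀ v, (N.neighborSet v).ncard ≤ Δ) (x : V) : ∑ y, distWeight N Δ x y ≤ 1 := by
  classical
  have hΔ' : (2 : ℝ) ≤ Δ := by exact_mod_cast hΔ
  obtain ⟨M, hM⟩ : ∃ M, ∀ y, N.dist x y < M :=
    ⟨∑ y, N.dist x y + 1, fun y => Nat.lt_succ_of_le
      (Finset.single_le_sum (f := fun y => N.dist x y) (fun _ _ => Nat.zero_le _)
        (Finset.mem_univ y))⟩
  rw [← Finset.sum_fiberwise_of_maps_to (s := Finset.univ) (t := Finset.range M)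
    (g := fun y => N.dist x y) (fun y _ => Finset.mem_range.2 (hM y))]
  have h1 : ∀ d, ∑ y with N.dist x y = d, distWeight N Δ x y ≤ if d = 0 then 0 else (1 / 2) ^ d := by
    intro d
    have h2 : ∀ y, N.dist x y = d → x ≠ y → N.edist x y ≠ ⊤ → N.edist x y = d ∧ d ≠ 0 := by
      intro y hy hxy ht
      have h3 : N.edist x y = d := by
        rw [← hy, SimpleGraph.dist, ENat.natCast_toNat ht]
      refine ⟨h3, ?_⟩
      rintro rfl
      exact hxy (SimpleGraph.edist_eq_zero_iff.1 h3)
    split_ifs with hd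
    · apply Finset.sum_nonpos
      intro y hy
      unfold distWeight
      split_ifs with h
      · exact absurd hd (h2 y (by simpa using hy) h.1 h.2).2
      · exact le_rfl
    · have h4 : ∑ y with N.dist x y = d, distWeight N Δ x y ≤
          ∑ y with N.edist x y = d, ((Δ : ℝ)⁻¹) ^ (2 * d) := by
        rw [Finset.sum_filter, Finset.sum_filter]
        refine Finset.sum_le_sum fun y _ => ?_
        unfold distWeight
        split_ifs with a b c e
        · rw [a]
        · exact absurd (h2 y a b.1 b.2).1 c
        · positivity
        · exact le_rfl
        · positivity
        · exact le_rfl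
      refine h4.trans ?_
      rw [Finset.sum_const, nsmul_eq_mul]
      have h5 : ((Finset.univ.filter fun y => N.edist x y = d).card : ℝ) ≤ (Δ : ℝ) ^ d := by
        exact_mod_cast card_edist_eq_le N hN x d
      have h6 : (0 : ℝ) < Δ := by linarith
      calc _ ≤ (Δ : ℝ) ^ d * ((Δ : ℝ)⁻¹) ^ (2 * d) := by gcongr
        _ = ((Δ : ℝ)⁻¹) ^ d := by
          rw [two_mul, pow_add, ← mul_assoc, ← mul_pow, mul_inv_cancel₀ h6.ne', one_pow, one_mul]
        _ ≤ (1 / 2) ^ d := by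
          apply pow_le_pow_left₀ (by positivity)
          rw [one_div]
          exact inv_anti₀ two_pos hΔ'
  refine (Finset.sum_le_sum fun d _ => h1 d).trans ?_
  -- The partial geometric sum without its term at zero; the empty range needs its own case.
  have h3 : ∀ M, ∑ d ∈ Finset.range M, (if d = 0 then (0 : ℝ) else (1 / 2) ^ d) ≤
      if M = 0 then 0 else 1 - 2 * (1 / 2) ^ M := by
    intro M
    induction M with
    | zero => simp
    | succ M ih =>
      rw [Finset.sum_range_succ]
      rcases Nat.eq_zero_or_pos M with rfl | hM
      · norm_num
      · simp only [hM.ne', if_false, Nat.succ_ne_zero, pow_succ] at ih ⊢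
        linarith
  refine (h3 M).trans ?_
  split_ifs
  · exact zero_le_one
  · have : (0 : ℝ) ≤ (1 / 2) ^ M := by positivity
    linarith

/-- Gibbs' inequality with the distance weights, whose logarithm to base `Δ` is minus twice the
distance. -/
theorem entropyDstGivenSrc_le_dist (N : SimpleGraph V) {Δ : ℕ} (hΔ : 2 ≤ Δ)
    (hN : ∀ v, (N.neighborSet v).ncard ≤ Δ) (σ : List (V × V)) (hσ : ∀ r ∈ σ, r.1 ≠ r.2)
    (hconn : ∀ r ∈ σ, N.edist r.1 r.2 ≠ ⊤) :
    σ.length * entropyDstGivenSrc Δ σ ≤ 2 * (σ.map fun r => (N.dist r.1 r.2 : ℝ)).sum := by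
  have hΔ' : (1 : ℝ) < Δ := by exact_mod_cast (by omega : 1 < Δ)
  have hpos : ∀ r ∈ σ, distWeight N Δ r.1 r.2 = ((Δ : ℝ)⁻¹) ^ (2 * N.dist r.1 r.2) := by
    intro r hr
    rw [distWeight, if_pos ⟨hσ r hr, hconn r hr⟩]
  refine (length_mul_entropyDstGivenSrc_le hΔ' σ (distWeight N Δ) (distWeight_nonneg N Δ)
    (fun r hr => by rw [hpos r hr]; positivity) (sum_distWeight_le N hΔ hN)).trans ?_
  rw [← List.sum_map_mul_left]
  apply le_of_eq
  congr 1
  refine List.map_congr_left fun r hr => ?_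
  rw [hpos r hr, Real.logb_pow, Real.logb_inv, Real.logb_self_eq_one hΔ']
  push_cast
  ring

omit [Fintype V] [DecidableEq V] in
theorem fixedCost_eq_of_connected (N : SimpleGraph V) (σ : List (V × V))
    (hconn : ∀ r ∈ σ, N.edist r.1 r.2 ≠ ⊤) :
    fixedCost N σ = (((σ.map fun r => N.dist r.1 r.2).sum : ℕ) : ℝ≥0∞) / σ.length := by
  unfold fixedCost
  congr 1
  have : (σ.map fun r => N.edist r.1 r.2).sum = (((σ.map fun r => N.dist r.1 r.2).sum : ℕ) : ℕ∞) := by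
    rw [Nat.cast_list_sum, List.map_map]
    congr 1
    refine List.map_congr_left fun r hr => ?_
    simp only [Function.comp, SimpleGraph.dist]
    exact (ENat.natCast_toNat (hconn r hr)).symm
  rw [this, ENat.toENNReal_coe]

omit [Fintype V] [DecidableEq V] in
theorem fixedCost_eq_top (N : SimpleGraph V) (σ : List (V × V)) {r : V × V} (hr : r ∈ σ)
    (h : N.edist r.1 r.2 = ⊤) : fixedCost N σ = ⊤ := by
  unfold fixedCost
  have : (σ.map fun r => N.edist r.1 r.2).sum = ⊤ := by
    rw [← top_le_iff, ← h]
    exact List.single_le_sum (by simp) _ (List.mem_map.2 ⟨r, hr, rfl⟩)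
  rw [this]
  exact ENNReal.top_div_of_ne_top (by simp)

/-- The entropy lower bound. -/
theorem entropy_le_optFixedCost {Δ : ℕ} (hΔ : 2 ≤ Δ) (σ : List (V × V))
    (hσ : ∀ r ∈ σ, r.1 ≠ r.2) :
    ENNReal.ofReal (max (entropyDstGivenSrc Δ σ) (entropySrcGivenDst Δ σ)) ≤
      2 * optFixedCost Δ σ := by
  have h2 : max (entropyDstGivenSrc Δ σ) (entropySrcGivenDst Δ σ) =
      2 * (max (entropyDstGivenSrc Δ σ) (entropySrcGivenDst Δ σ) / 2) := by ring
  rw [h2, ENNReal.ofReal_mul zero_le_two, ENNReal.ofReal_ofNat]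
  gcongr
  refine le_iInf₂ fun N hN => ?_
  rcases σ.eq_nil_or_concat with rfl | ⟨_, _, hne⟩
  · simp [entropyDstGivenSrc, entropySrcGivenDst, freq, freqSrc, freqDst]
  have hl : (0 : ℝ) < σ.length := by simp [hne]; positivity
  by_cases hconn : ∀ r ∈ σ, N.edist r.1 r.2 ≠ ⊤
  · rw [fixedCost_eq_of_connected N σ hconn, ← ENNReal.ofReal_natCast, ← ENNReal.ofReal_natCast,
      ← ENNReal.ofReal_div_of_pos hl]
    apply ENNReal.ofReal_le_ofReal
    have h3 := entropyDstGivenSrc_le_dist N hΔ hN σ hσ hconn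
    -- Distances are symmetric, so the reversed sequence gives the bound for the other entropy.
    have h4 := entropyDstGivenSrc_le_dist N hΔ hN (σ.map Prod.swap)
      (by
        intro r hr
        obtain ⟨s, hs, rfl⟩ := List.mem_map.1 hr
        exact (hσ s hs).symm)
      (by
        intro r hr
        obtain ⟨s, hs, rfl⟩ := List.mem_map.1 hr
        rw [SimpleGraph.edist_comm]
        exact hconn s hs)
    rw [← entropySrcGivenDst_eq_swap, List.length_map, List.map_map] at h4
    have h5 : ((fun r : V × V => (N.dist r.1 r.2 : ℝ)) ∘ Prod.swap) =
        fun r : V × V => (N.dist r.1 r.2 : ℝ) := by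
      funext r
      simp [SimpleGraph.dist_comm]
    rw [h5] at h4
    rw [Nat.cast_list_sum, List.map_map]
    rw [div_le_div_iff₀ two_pos hl, max_mul_of_nonneg _ _ hl.le]
    apply max_le
    · linarith [show (σ.map (Nat.cast ∘ fun r : V × V => N.dist r.1 r.2)).sum =
        (σ.map fun r => (N.dist r.1 r.2 : ℝ)).sum from rfl]
    · linarith [show (σ.map (Nat.cast ∘ fun r : V × V => N.dist r.1 r.2)).sum =
        (σ.map fun r => (N.dist r.1 r.2 : ℝ)).sum from rfl]
  · push Not at hconn
    obtain ⟨r, hr, h⟩ := hconn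
    rw [fixedCost_eq_top N σ hr h]
    exact le_top

theorem one_le_optFixedCost (Δ : ℕ) {σ : List (V × V)} (hσ : ∀ r ∈ σ, r.1 ≠ r.2) (hne : σ ≠ []) :
    1 ≤ optFixedCost Δ σ := by
  refine le_iInf₂ fun N _ => ?_
  have hl : σ.length ≠ 0 := by simpa using hne
  by_cases hconn : ∀ r ∈ σ, N.edist r.1 r.2 ≠ ⊤
  · rw [fixedCost_eq_of_connected N σ hconn, ENNReal.le_div_iff_mul_le (by simp [hne]) (by simp),
      one_mul]
    norm_cast
    have := List.card_nsmul_le_sum (σ.map fun r => N.dist r.1 r.2) 1 (by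
      intro d hd
      obtain ⟨r, hr, rfl⟩ := List.mem_map.1 hd
      rw [Nat.one_le_iff_ne_zero, SimpleGraph.dist, Ne, ENat.toNat_eq_zero, not_or,
        SimpleGraph.edist_eq_zero_iff]
      exact ⟨hσ r hr, hconn r hr⟩)
    simpa using this
  · push Not at hconn
    obtain ⟨r, hr, h⟩ := hconn
    rw [fixedCost_eq_top N σ hr h]
    exact le_top

end FixedNetworks

/-! ### Links of search trees -/

section TreeLinks

variable {α : Type}

theorem card_linksBelow (p : Option α) (t : BinaryTree α) :
    Multiset.card (linksBelow p t) = (keys t).length := by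
  induction t generalizing p with
  | nil => rfl
  | node a l r ihl ihr =>
    simp only [linksBelow, keys, Multiset.card_cons, Multiset.card_add, ihl, ihr,
      List.length_append, List.length_cons]
    omega

theorem searchLen_le_length [LinearOrder α] (k : α) (t : BinaryTree α) :
    searchLen k t ≤ (keys t).length := by
  induction t with
  | nil => simp [searchLen]
  | node a l r ihl ihr =>
    simp only [searchLen, keys, List.length_append, List.length_cons]
    split_ifs <;> omega

variable [DecidableEq α]

theorem countP_linksBelow_eq_zero {p o : Option α} {t : BinaryTree α} (hp : o ≠ p)
    (ho : ∀ k ∈ keys t, o ≠ some k) : (linksBelow p t).countP (o ∈ ·) = 0 := by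
  induction t generalizing p with
  | nil => rfl
  | node a l r ihl ihr =>
    have ha : o ≠ some a := ho a (by simp [keys])
    simp only [linksBelow, Multiset.countP_cons, Multiset.countP_add, Sym2.mem_iff]
    rw [ihl ha fun k hk => ho k (by simp [keys, hk]), ihr ha fun k hk => ho k (by simp [keys, hk])]
    simp [hp, ha]

theorem countP_linksBelow_parent_le {p : Option α} {t : BinaryTree α}
    (hp : ∀ k ∈ keys t, p ≠ some k) : (linksBelow p t).countP (p ∈ ·) ≤ 1 := by
  cases t with
  | nil => simp [linksBelow]
  | node a l r =>
    have ha : p ≠ some a := hp a (by simp [keys])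
    simp only [linksBelow, Multiset.countP_cons, Multiset.countP_add]
    rw [countP_linksBelow_eq_zero ha fun k hk => hp k (by simp [keys, hk]),
      countP_linksBelow_eq_zero ha fun k hk => hp k (by simp [keys, hk])]
    split_ifs <;> simp

/-- A slot has one link to its parent and at most two to its children. -/
theorem countP_linksBelow_le {p : Option α} {t : BinaryTree α} (ht : (keys t).Nodup) {k : α}
    (hp : some k ≠ p) : (linksBelow p t).countP (some k ∈ ·) ≤ 3 := by
  induction t generalizing p with
  | nil => simp [linksBelow]
  | node a l r ihl ihr =>
    simp only [keys, List.nodup_append, List.nodup_cons] at ht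
    obtain ⟨hl, ⟨har, hr⟩, hd⟩ := ht
    have hal : a ∉ keys l := fun h => hd a h a (by simp) rfl
    simp only [linksBelow, Multiset.countP_cons, Multiset.countP_add, Sym2.mem_iff, hp, false_or,
      Option.some_inj]
    by_cases hk : k = a
    · subst hk
      have h1 := countP_linksBelow_parent_le (p := some k) (t := l)
        fun x hx h => hal (Option.some_inj.1 h ▸ hx)
      have h2 := countP_linksBelow_parent_le (p := some k) (t := r)
        fun x hx h => har (Option.some_inj.1 h ▸ hx)
      rw [if_pos rfl]
      omega
    · have hka : some k ≠ some a := fun h => hk (Option.some_inj.1 h)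
      rw [if_neg hk]
      by_cases hkl : k ∈ keys l
      · rw [countP_linksBelow_eq_zero (t := r) hka fun x hx h =>
          hd k hkl x (by simp [hx]) (Option.some_inj.1 h)]
        exact ihl hl hka
      · rw [countP_linksBelow_eq_zero (t := l) hka fun x hx h => hkl (Option.some_inj.1 h ▸ hx)]
        simpa using ihr hr hka

theorem countP_treeLinks_none (t : BinaryTree α) : (treeLinks t).countP (none ∈ ·) ≤ 1 :=
  countP_linksBelow_parent_le (by simp)

theorem countP_treeLinks_le {t : BinaryTree α} (ht : (keys t).Nodup) (k : α) :
    (treeLinks t).countP (some k ∈ ·) ≤ 3 :=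
  countP_linksBelow_le ht (by simp)

theorem countP_treeLinks_eq_zero {t : BinaryTree α} {k : α} (hk : k ∉ keys t) :
    (treeLinks t).countP (some k ∈ ·) = 0 :=
  countP_linksBelow_eq_zero (by simp) fun _ hx h => hk (Option.some_inj.1 h ▸ hx)

/-- Renaming the ends of links: every end of a link accounts for the ports of its image. -/
theorem countP_map_le_sum {β : Type} [DecidableEq β] (M : Multiset (Sym2 (Option α)))
    (f : Option α → β) (x : β) (s : Finset α) (hs : ∀ e ∈ M, ∀ k, some k ∈ e → f (some k) = x → k ∈ s) :
    (M.map (Sym2.map f)).countP (x ∈ ·) ≤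
      (if f none = x then M.countP (none ∈ ·) else 0) + ∑ k ∈ s, M.countP (some k ∈ ·) := by
  induction M using Multiset.induction_on with
  | empty => simp
  | cons e M ih =>
    have ih := ih fun e he => hs e (Multiset.mem_cons_of_mem he)
    have hs := hs e (Multiset.mem_cons_self e M)
    simp only [Multiset.map_cons, Multiset.countP_cons, Finset.sum_add_distrib]
    have h1 : (if x ∈ Sym2.map f e then 1 else 0) ≤
        (if f none = x then (if none ∈ e then 1 else 0) else 0) +
          ∑ k ∈ s, (if some k ∈ e then 1 else 0) := by
      split_ifs with h2 h3 h4
      · omega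
      · obtain ⟨o, ho, rfl⟩ := Sym2.mem_map.1 h2
        rcases o with _ | k
        · exact absurd ho h4
        · have := Finset.single_le_sum (f := fun k => if some k ∈ e then 1 else 0)
            (fun _ _ => Nat.zero_le _) (hs k ho rfl)
          simp only [ho, if_true] at this
          omega
      · obtain ⟨o, ho, rfl⟩ := Sym2.mem_map.1 h2
        rcases o with _ | k
        · exact absurd rfl h3
        · have := Finset.single_le_sum (f := fun k => if some k ∈ e then 1 else 0)
            (fun _ _ => Nat.zero_le _) (hs k ho rfl)
          simp only [ho, if_true] at this
          omega
      all_goals omega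
    split_ifs at ih h1 ⊢ <;> omega

/-- When a single slot gets another host, only the links at that slot change, and each is removed
once and added once. -/
theorem linkChanges_map_map_le {β : Type} [DecidableEq β] (M : Multiset (Sym2 (Option α)))
    (f g : Option α → β) (o : Option α) (h : ∀ o', o' ≠ o → f o' = g o') :
    linkChanges (M.map (Sym2.map f)) (M.map (Sym2.map g)) ≤ 2 * M.countP (o ∈ ·) := by
  induction M using Multiset.induction_on with
  | empty => simp
  | cons e M ih =>
    simp only [Multiset.map_cons, Multiset.countP_cons]
    by_cases ho : o ∈ e
    · rw [if_pos ho]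
      have := linkChanges_cons_le (Sym2.map f e) (Sym2.map g e) (M.map (Sym2.map f))
        (M.map (Sym2.map g))
      omega
    · have : Sym2.map f e = Sym2.map g e :=
        Sym2.map_congr fun x hx => h x fun hxo => ho (hxo ▸ hx)
      rw [this, if_neg ho, ← Multiset.singleton_add, ← Multiset.singleton_add]
      refine (linkChanges_add _ _ _ _).trans ?_
      rw [linkChanges_self]
      omega

end TreeLinks

theorem linkChanges_finset_map {β γ : Type} [DecidableEq β] [DecidableEq γ] (s t : Finset β)
    (f : β → γ) :
    linkChanges (s.val.map f) (t.val.map f) ≤ (s \ t).card + (t \ s).card := by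
  refine (linkChanges_map f _ _).trans (le_of_eq ?_)
  simp only [linkChanges, Finset.card, Finset.sdiff_val]

theorem edist_linkGraph_le_one {V : Type} [DecidableEq V] {N : Multiset (Sym2 V)} {x y : V}
    (h : s(x, y) ∈ N) : (linkGraph N).edist x y ≤ 1 := by
  rw [SimpleGraph.edist_le_one_iff_adj_or_eq]
  by_cases hxy : x = y
  · exact Or.inr hxy
  · exact Or.inl ((SimpleGraph.fromEdgeSet_adj _).2 ⟨h, hxy⟩)

/-- The search path maps to a walk between the hosts; hosts that coincide can only shorten it. -/
theorem edist_linkGraph_le_searchLen {α V : Type} [LinearOrder α] [DecidableEq V]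
    {N : Multiset (Sym2 V)} (f : Option α → V) {t : BinaryTree α} (ht : IsBST t) {p : Option α}
    (hN : ∀ e ∈ linksBelow p t, Sym2.map f e ∈ N) {k : α} (hk : k ∈ keys t) :
    (linkGraph N).edist (f p) (f (some k)) ≤ searchLen k t := by
  induction t generalizing p with
  | nil => simp [keys] at hk
  | node a l r ihl ihr =>
    obtain ⟨hl, hr, h1, h2⟩ := isBST_node.1 ht
    have h3 : (linkGraph N).edist (f p) (f (some a)) ≤ 1 :=
      edist_linkGraph_le_one (hN s(p, some a) (by simp [linksBelow]))
    simp only [keys, List.mem_append, List.mem_cons] at hk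
    rcases hk with hk | rfl | hk
    · have h4 := ihl hl (p := some a) (fun e he => hN e (by simp [linksBelow, he])) hk
      simp only [searchLen, h1 k hk, if_true, Nat.cast_add, Nat.cast_one]
      exact SimpleGraph.edist_triangle.trans (add_le_add h3 h4)
    · simpa [searchLen] using h3
    · have h4 := ihr hr (p := some a) (fun e he => hN e (by simp [linksBelow, he])) hk
      simp only [searchLen, h2 k hk, (h2 k hk).not_gt, if_true, if_false, Nat.cast_add,
        Nat.cast_one]
      exact SimpleGraph.edist_triangle.trans (add_le_add h3 h4)

/-! ### Access histories -/

namespace SelfAdjustingBST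

variable {α : Type} [LinearOrder α] (B : SelfAdjustingBST α)

/-- The state after a sequence of accesses, started empty. -/
def afterAccesses (ks : List α) : B.State := ks.foldl (fun s k => B.access k s) B.init

theorem afterAccesses_append (ks : List α) (k : α) :
    B.afterAccesses (ks ++ [k]) = B.access k (B.afterAccesses ks) := by
  simp [afterAccesses]

theorem mem_keys_access (k : α) (s : B.State) (x : α) :
    x ∈ keys (B.tree (B.access k s)) ↔ x = k ∨ x ∈ keys (B.tree s) := by
  unfold access
  split_ifs with h
  · rw [B.mem_adjust k s h]
    exact (or_iff_right_of_imp fun e => e ▸ h).symm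
  · exact B.mem_insert k s h x

theorem mem_keys_afterAccesses (ks : List α) (x : α) :
    x ∈ keys (B.tree (B.afterAccesses ks)) ↔ x ∈ ks := by
  induction ks using List.reverseRecOn with
  | nil => simp [afterAccesses, B.tree_init, keys]
  | append_singleton ks k ih =>
    rw [afterAccesses_append, mem_keys_access, ih]
    simp [or_comm]

theorem totalCost_append (s : B.State) (ks ls : List α) :
    B.totalCost s (ks ++ ls) =
      B.totalCost s ks + B.totalCost (ks.foldl (fun s k => B.access k s) s) ls := by
  induction ks generalizing s with
  | nil => simp [totalCost]
  | cons k ks ih => simp [totalCost, ih, add_assoc]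

theorem totalCost_append_singleton (ks : List α) (k : α) :
    B.totalCost B.init (ks ++ [k]) =
      B.totalCost B.init ks + B.accessCost k (B.afterAccesses ks) := by
  rw [totalCost_append]
  simp [totalCost, afterAccesses]

theorem totalCost_le_append (ks ls : List α) :
    B.totalCost B.init ks ≤ B.totalCost B.init (ks ++ ls) := by
  rw [totalCost_append]
  exact Nat.le_add_right _ _

end SelfAdjustingBST

/-! ### Invariants with access histories as ghost state. -/

namespace ReNet

variable {V : Type} [Fintype V] [LinearOrder V] {R : ReNet V}

/-- Working sets that the coordinator admits: a symmetric partner relation of bounded size. -/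
structure Admissible (R : ReNet V) (A : V → Finset V) : Prop where
  symm : ∀ {x y}, y ∈ A x → x ∈ A y
  irrefl : ∀ x, x ∉ A x
  sum_le : ∑ x, (A x).card ≤ 2 * R.c * Fintype.card V
  c_pos : 1 ≤ R.c

/-- The total cost of the ego-BSTs with access histories `h`. -/
def histCost (R : ReNet V) (h : V → List V) : ℕ := ∑ w, R.bst.totalCost R.bst.init (h w)

/-- The state is consistent with the access histories `h` of the ego-BSTs and does not go beyond
the working sets `A`. -/
structure Sound (A : V → Finset V) (h : V → List V) (st : R.State) : Prop where
  ego_eq : ∀ w ∈ st.large, st.ego w = R.bst.afterAccesses (h w)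
  hist_nil : ∀ w, w ∉ st.large → h w = []
  hist_sub : ∀ w, ∀ k ∈ h w, k ∈ A w
  W_sub : ∀ w, st.W w ⊆ A w
  large_card : ∀ w ∈ st.large, R.threshold < (A w).card
  helper_pair : ∀ e x, st.helper e = some x →
    ∃ a b, e = s(a, b) ∧ a ∈ st.large ∧ b ∈ st.large ∧ b ∈ A a
  helps_card : ∀ x, (st.helps x).card ≤ 2 * R.c

/-- The total cost of passing from `st` to `st'` is at most `b`, up to the cost of the accesses
by which the histories are extended. -/
structure Moves (b : ℕ) (h h' : V → List V) (st st' : R.State) : Prop where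
  cost : st'.hops + st'.msgs + linkChanges st.network st'.network + histCost R h ≤
    st.hops + st.msgs + histCost R h' + b
  ext : ∀ w, ∃ l, h' w = h w ++ l ∧ l.Nodup ∧ ∀ k ∈ l, k ∉ h w

theorem Moves.trans {b b' : ℕ} {h h' h'' : V → List V} {st st' st'' : R.State}
    (m : Moves b h h' st st') (m' : Moves b' h' h'' st' st'') :
    Moves (b + b') h h'' st st'' where
  cost := by
    have := linkChanges_triangle st.network st'.network st''.network
    have := m.cost
    have := m'.cost
    omega
  ext w := by
    obtain ⟨l, h1, h2, h3⟩ := m.ext w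
    obtain ⟨l', h1', h2', h3'⟩ := m'.ext w
    rw [h1] at h1' h3'
    refine ⟨l ++ l', by rw [h1', List.append_assoc], ?_, ?_⟩
    · exact List.nodup_append.2 ⟨h2, h2', fun x hx y hy e => h3' y hy (by simp [← e, hx])⟩
    · intro k hk
      rcases List.mem_append.1 hk with hk | hk
      · exact h3 k hk
      · exact fun hk' => h3' k hk (by simp [hk'])

theorem Moves.mono {b b' : ℕ} {h h' : V → List V} {st st' : R.State}
    (m : Moves b h h' st st') (hb : b ≤ b') : Moves b' h h' st st' where
  cost := m.cost.trans (by omega)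
  ext := m.ext

theorem Moves.subset {b : ℕ} {h h' : V → List V} {st st' : R.State}
    (m : Moves b h h' st st') {w k : V} (hk : k ∈ h w) : k ∈ h' w := by
  obtain ⟨l, h1, -, -⟩ := m.ext w
  simp [h1, hk]

/-- A move that leaves the working sets and the set of large nodes as they are. -/
structure Evolves (b : ℕ) (h h' : V → List V) (st st' : R.State) : Prop extends
    Moves b h h' st st' where
  W_eq : st'.W = st.W
  large_eq : st'.large = st.large
  helper_mono : ∀ e, st.helper e ≠ none → st'.helper e ≠ none
  helper_new : ∀ e x, st'.helper e = some x → st.helper e = some x ∨ x ∉ st.large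

theorem Evolves.trans {b b' : ℕ} {h h' h'' : V → List V} {st st' st'' : R.State}
    (m : Evolves b h h' st st') (m' : Evolves b' h' h'' st' st'') :
    Evolves (b + b') h h'' st st'' where
  toMoves := m.toMoves.trans m'.toMoves
  W_eq := m'.W_eq.trans m.W_eq
  large_eq := m'.large_eq.trans m.large_eq
  helper_mono e he := m'.helper_mono e (m.helper_mono e he)
  helper_new e x he := by
    rcases m'.helper_new e x he with h | h
    · exact m.helper_new e x h
    · exact Or.inr (m.large_eq ▸ h)

theorem Evolves.mono {b b' : ℕ} {h h' : V → List V} {st st' : R.State}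
    (m : Evolves b h h' st st') (hb : b ≤ b') : Evolves b' h h' st st' :=
  { m with toMoves := m.toMoves.mono hb }

theorem Evolves.refl (h : V → List V) (st : R.State) : Evolves 0 h h st st where
  cost := by simp
  ext w := ⟨[], by simp⟩
  W_eq := rfl
  large_eq := rfl
  helper_mono _ he := he
  helper_new _ _ he := Or.inl he

/-! ### Counting: helpers are always available. -/

section Counting

variable {A : V → Finset V} {h : V → List V} {st : R.State}

theorem Sound.mem_keys (hs : Sound A h st) {w : V} (hw : w ∈ st.large) (k : V) :
    k ∈ keys (st.egoTree w) ↔ k ∈ h w := by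
  rw [State.egoTree, hs.ego_eq w hw, SelfAdjustingBST.mem_keys_afterAccesses]

theorem Sound.helper_eq_none (hs : Sound A h st) {u : V} (hu : u ∉ st.large) (w : V) :
    st.helper s(w, u) = none := by
  by_contra hne
  obtain ⟨x, hx⟩ := Option.ne_none_iff_exists'.1 hne
  obtain ⟨a, b, e, ha, hb, -⟩ := hs.helper_pair _ x hx
  rcases Sym2.eq_iff.1 e with ⟨rfl, rfl⟩ | ⟨rfl, rfl⟩
  · exact hu hb
  · exact hu ha

/-- The handshake lemma for the graph of partners. -/
theorem Admissible.two_mul_card_pairs (hA : Admissible R A) :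
    2 * (Finset.univ.filter fun e : Sym2 V => ∃ a b, e = s(a, b) ∧ b ∈ A a).card =
      ∑ x, (A x).card := by
  classical
  let G : SimpleGraph V :=
    { Adj := fun x y => y ∈ A x
      symm := ⟨fun x y hxy => hA.symm hxy⟩
      loopless := ⟨fun x => hA.irrefl x⟩ }
  have h1 := G.sum_degrees_eq_twice_card_edges
  have h2 : ∀ x, G.degree x = (A x).card := by
    intro x
    rw [← SimpleGraph.card_neighborFinset_eq_degree]
    congr 1
    ext y
    rw [SimpleGraph.mem_neighborFinset]
  have h3 : G.edgeFinset = Finset.univ.filter fun e : Sym2 V => ∃ a b, e = s(a, b) ∧ b ∈ A a := by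
    ext e
    induction e with
    | _ x y =>
      simp only [SimpleGraph.mem_edgeFinset, SimpleGraph.mem_edgeSet, Finset.mem_filter,
        Finset.mem_univ, true_and]
      constructor
      · exact fun hxy => ⟨x, y, rfl, hxy⟩
      · rintro ⟨a, b, e, hab⟩
        rcases Sym2.eq_iff.1 e with ⟨rfl, rfl⟩ | ⟨rfl, rfl⟩
        · exact hab
        · exact hA.symm hab
  rw [← h3, ← h1]
  exact Finset.sum_congr rfl fun x _ => h2 x

/-- Each large node has at least `4 c + 1` partners in `A`, out of a total of at most `2 c n`. The
node `v` only witnesses that `n` is positive. -/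
theorem Sound.two_mul_card_large_lt (hA : Admissible R A) (hs : Sound A h st) (v : V) :
    2 * st.large.card < Fintype.card V := by
  have h1 : st.large.card * (R.threshold + 1) ≤ ∑ x, (A x).card := by
    refine le_trans ?_ (Finset.sum_le_sum_of_subset (Finset.subset_univ st.large))
    rw [← smul_eq_mul]
    exact Finset.card_nsmul_le_sum _ _ _ fun w hw => hs.large_card w hw
  have h2 := hA.sum_le
  have h3 : 0 < Fintype.card V := Fintype.card_pos_iff.2 ⟨v⟩
  simp only [threshold] at h1
  have h4 := hA.c_pos
  by_contra hcon
  push Not at hcon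
  nlinarith

theorem mem_available {x : V} :
    x ∈ st.available ↔ x ∉ st.large ∧ (st.helps x).card < 2 * R.c := by
  rw [State.available, Finset.mem_filter, threshold]
  simp only [Finset.mem_univ, true_and, and_congr_right_iff]
  omega

/-- Otherwise more than `n / 2` small nodes would help at least `2 c` pairs each, and a pair has
only one helper; but there are at most `c n` pairs of partners. -/
theorem Sound.available_nonempty (hA : Admissible R A) (hs : Sound A h st) (v : V) :
    st.available.Nonempty := by
  by_contra hne
  rw [Finset.not_nonempty_iff_eq_empty] at hne
  have h1 : ∀ x ∈ Finset.univ \ st.large, 2 * R.c ≤ (st.helps x).card := by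
    intro x hx
    by_contra hlt
    have : x ∈ st.available := by
      rw [mem_available]
      exact ⟨by simpa using hx, by omega⟩
    simp [hne] at this
  have h2 := Finset.card_nsmul_le_sum _ _ _ h1
  have h3 : ∑ x ∈ Finset.univ \ st.large, (st.helps x).card ≤
      (Finset.univ.filter fun e : Sym2 V => ∃ a b, e = s(a, b) ∧ b ∈ A a).card := by
    rw [← Finset.card_biUnion]
    · apply Finset.card_le_card
      intro e he
      simp only [Finset.mem_biUnion, State.helps, Finset.mem_filter, Finset.mem_univ,
        true_and] at he ⊢
      obtain ⟨x, -, hx⟩ := he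
      obtain ⟨a, b, e, -, -, hab⟩ := hs.helper_pair _ x hx
      exact ⟨a, b, e, hab⟩
    · intro x _ y _ hxy
      rw [Function.onFun, Finset.disjoint_left]
      intro e he he'
      simp only [State.helps, Finset.mem_filter, Finset.mem_univ, true_and] at he he'
      exact hxy (Option.some_inj.1 (he.symm.trans he'))
  have h4 := hA.two_mul_card_pairs
  have h5 := hA.sum_le
  have h6 := hs.two_mul_card_large_lt hA v
  have h7 : (Finset.univ \ st.large).card = Fintype.card V - st.large.card := by
    rw [Finset.card_sdiff_of_subset (Finset.subset_univ _), Finset.card_univ]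
  rw [h7, smul_eq_mul] at h2
  have h8 := hA.c_pos
  have h9 : Fintype.card V < 2 * (Fintype.card V - st.large.card) := by omega
  nlinarith

end Counting

/-! #### The elementary operations -/

section Operations

variable {A : V → Finset V} {h : V → List V} {st : R.State}

theorem network_eq (st : R.State) :
    st.network = ((Finset.univ.filter fun p : V × V =>
      p.1 < p.2 ∧ p.2 ∈ st.W p.1 ∧ p.1 ∉ st.large ∧ p.2 ∉ st.large).val.map
        fun p => s(p.1, p.2)) +
      ∑ w ∈ st.large, (treeLinks (st.egoTree w)).map (Sym2.map (st.host w)) := rfl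

theorem linkChanges_network_le {st st' : R.State} (hW : st'.W = st.W)
    (hl : st'.large = st.large) :
    linkChanges st.network st'.network ≤ ∑ w ∈ st.large,
      linkChanges ((treeLinks (st.egoTree w)).map (Sym2.map (st.host w)))
        ((treeLinks (st'.egoTree w)).map (Sym2.map (st'.host w))) := by
  rw [network_eq, network_eq, hW, hl]
  refine (linkChanges_add _ _ _ _).trans ?_
  rw [linkChanges_self, zero_add]
  exact linkChanges_sum _ _ _

theorem linkChanges_update_ego (st : R.State) (w : V) (s : R.bst.State) (x y : ℕ) :
    linkChanges st.network
      ({ st with ego := Function.update st.ego w s, hops := x, msgs := y } : R.State).network ≤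
      linkChanges (treeLinks (st.egoTree w)) (treeLinks (R.bst.tree s)) := by
  refine (linkChanges_network_le (st := st) (by rfl) (by rfl)).trans ?_
  refine (Finset.sum_le_sum (g := fun x : V => if x = w then
    linkChanges (treeLinks (st.egoTree w)) (treeLinks (R.bst.tree s)) else 0) ?_).trans ?_
  · intro x _
    split_ifs with hx
    · subst hx
      refine (linkChanges_map _ _ _).trans (le_of_eq ?_)
      simp [State.egoTree]
    · apply le_of_eq
      simp only [State.egoTree, Function.update_of_ne hx]
      exact linkChanges_self _
  · rw [Finset.sum_ite_eq']
    split_ifs <;> omega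

theorem histCost_update_append (R : ReNet V) (h : V → List V) (w k : V) :
    histCost R (Function.update h w (h w ++ [k])) =
      histCost R h + R.bst.accessCost k (R.bst.afterAccesses (h w)) := by
  simp only [histCost]
  rw [← Finset.add_sum_erase _ _ (Finset.mem_univ w),
    ← Finset.add_sum_erase (a := w) _ (fun w => R.bst.totalCost R.bst.init (h w))
      (Finset.mem_univ w), Function.update_self, SelfAdjustingBST.totalCost_append_singleton]
  have : ∑ x ∈ Finset.univ.erase w,
      R.bst.totalCost R.bst.init (Function.update h w (h w ++ [k]) x) =
      ∑ x ∈ Finset.univ.erase w, R.bst.totalCost R.bst.init (h x) :=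
    Finset.sum_congr rfl fun x hx => by rw [Function.update_of_ne (Finset.ne_of_mem_erase hx)]
  rw [this]
  omega

/-- An access to the ego-BST of a large node keeps the state sound. -/
theorem Sound.update_ego (hs : Sound A h st) {w k : V} (hw : w ∈ st.large) (hk : k ∈ A w)
    {s : R.bst.State} (hsk : s = R.bst.access k (st.ego w)) (x y : ℕ) :
    Sound A (Function.update h w (h w ++ [k]))
      ({ st with ego := Function.update st.ego w s, hops := x, msgs := y } : R.State) where
  ego_eq z hz := by
    by_cases hzw : z = w
    · subst hzw
      simp only [Function.update_self]
      rw [SelfAdjustingBST.afterAccesses_append, ← hs.ego_eq z hw, hsk]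
    · simp only [Function.update_of_ne hzw]
      exact hs.ego_eq z hz
  hist_nil z hz := by
    rw [Function.update_of_ne (fun e => hz (by rw [e]; exact hw))]
    exact hs.hist_nil z hz
  hist_sub z k' hk' := by
    by_cases hzw : z = w
    · subst hzw
      rw [Function.update_self] at hk'
      rcases List.mem_append.1 hk' with hk' | hk'
      · exact hs.hist_sub z k' hk'
      · rw [List.mem_singleton.1 hk']
        exact hk
    · rw [Function.update_of_ne hzw] at hk'
      exact hs.hist_sub z k' hk'
  W_sub := hs.W_sub
  large_card := hs.large_card
  helper_pair := hs.helper_pair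
  helps_card := hs.helps_card

theorem Sound.congr {st' : R.State} (hs : Sound A h st) (h1 : st'.W = st.W)
    (h2 : st'.large = st.large) (h3 : st'.ego = st.ego) (h4 : st'.helper = st.helper) :
    Sound A h st' where
  ego_eq w hw := by rw [h3]; exact hs.ego_eq w (h2 ▸ hw)
  hist_nil w hw := hs.hist_nil w (h2 ▸ hw)
  hist_sub := hs.hist_sub
  W_sub w := by rw [h1]; exact hs.W_sub w
  large_card w hw := hs.large_card w (h2 ▸ hw)
  helper_pair e x hx := by rw [h2]; exact hs.helper_pair e x (h4 ▸ hx)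
  helps_card x := by simpa only [State.helps, h4] using hs.helps_card x

theorem Sound.mono {B : V → Finset V} (hs : Sound A h st) (hAB : ∀ w, A w ⊆ B w) :
    Sound B h st where
  ego_eq := hs.ego_eq
  hist_nil := hs.hist_nil
  hist_sub w k hk := hAB w (hs.hist_sub w k hk)
  W_sub w := (hs.W_sub w).trans (hAB w)
  large_card w hw := (hs.large_card w hw).trans_le (Finset.card_le_card (hAB w))
  helper_pair e x hx := by
    obtain ⟨a, b, h1, h2, h3, h4⟩ := hs.helper_pair e x hx
    exact ⟨a, b, h1, h2, h3, hAB a h4⟩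
  helps_card := hs.helps_card

theorem sound_notify (hs : Sound A h st) (m : ℕ) : Sound A h (R.notify m st) :=
  hs.congr rfl rfl rfl rfl

theorem evolves_notify (h : V → List V) (st : R.State) (m : ℕ) :
    Evolves (m * R.D) h h st (R.notify m st) where
  cost := by
    have : (R.notify m st).network = st.network := rfl
    rw [this, linkChanges_self]
    simp only [notify]
    omega
  ext w := ⟨[], by simp⟩
  W_eq := rfl
  large_eq := rfl
  helper_mono _ he := he
  helper_new _ _ he := Or.inl he

/-- The search and the link changes of an insertion are exactly the cost of one more access in the
history, so nothing is left to pay. -/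
theorem exists_egoInsert (hs : Sound A h st) {w k : V} (hw : w ∈ st.large) (hk : k ∈ A w) :
    ∃ h', Sound A h' (R.egoInsert w k st) ∧ Evolves 0 h h' st (R.egoInsert w k st) ∧
      k ∈ h' w ∧ (R.egoInsert w k st).helper = st.helper := by
  unfold egoInsert
  split_ifs with hmem
  · exact ⟨h, hs, Evolves.refl h st, (hs.mem_keys hw k).1 hmem, rfl⟩
  · have hacc : R.bst.insert k (st.ego w) = R.bst.access k (st.ego w) := by
      exact (if_neg hmem).symm
    refine ⟨Function.update h w (h w ++ [k]), hs.update_ego hw hk hacc _ _, ⟨⟨?_, ?_⟩, rfl, rfl,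
      fun _ he => he, fun _ _ he => Or.inl he⟩, by simp, rfl⟩
    · have h1 := linkChanges_update_ego st w (R.bst.insert k (st.ego w))
        (st.hops + searchLen k (st.egoTree w)) st.msgs
      rw [histCost_update_append, ← hs.ego_eq w hw, SelfAdjustingBST.accessCost, ← hacc]
      simp only [State.egoTree] at h1 ⊢
      omega
    · intro z
      by_cases hz : z = w
      · subst hz
        refine ⟨[k], by simp, by simp, ?_⟩
        simpa [hs.mem_keys hw k] using hmem
      · exact ⟨[], by simp [Function.update_of_ne hz]⟩

/-- The helper hosts the slot of `b` in the tree of `a` and that of `a` in the tree of `b`. Each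
slot has at most three links, each changed by one removal and one addition. -/
theorem linkChanges_update_helper (st : R.State) (a b : V) (o : Option V) (x y : ℕ) :
    linkChanges st.network
      ({ st with helper := Function.update st.helper s(a, b) o, hops := x, msgs := y } :
        R.State).network ≤ 12 := by
  refine (linkChanges_network_le (st := st) (by rfl) (by rfl)).trans ?_
  refine (Finset.sum_le_sum (g := fun x : V => (if x = a then 6 else 0) + if x = b then 6 else 0)
    ?_).trans ?_
  · intro z _
    have hnd : (keys (st.egoTree z)).Nodup := (R.bst.isBST_tree _).nodup
    have key : ∀ k, (∀ k', k' ≠ k → s(z, k') ≠ s(a, b)) →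
        linkChanges ((treeLinks (st.egoTree z)).map (Sym2.map (st.host z)))
          ((treeLinks (st.egoTree z)).map (Sym2.map (State.host (R := R) { st with
            helper := Function.update st.helper s(a, b) o, hops := x, msgs := y } z))) ≤ 6 := by
      intro k hk
      refine (linkChanges_map_map_le _ _ _ (some k) ?_).trans
        (Nat.mul_le_mul_left 2 (countP_treeLinks_le hnd k))
      intro o' ho'
      rcases o' with _ | k'
      · rfl
      · simp only [State.host]
        rw [Function.update_of_ne (hk k' fun e => ho' (by rw [e]))]
    by_cases hza : z = a
    · rw [if_pos hza]
      refine (key b fun k' hk' e => ?_).trans (Nat.le_add_right _ _)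
      rw [hza] at e
      exact hk' (Sym2.congr_right.1 e)
    · rw [if_neg hza]
      by_cases hzb : z = b
      · rw [if_pos hzb]
        refine (key a fun k' hk' e => ?_).trans (Nat.le_add_left _ _)
        rw [hzb, Sym2.eq_swap] at e
        exact hk' (Sym2.congr_left.1 e)
      · rw [if_neg hzb]
        apply le_of_eq
        have : State.host (R := R) { st with
            helper := Function.update st.helper s(a, b) o, hops := x, msgs := y } z =
            st.host z := by
          funext o'
          rcases o' with _ | k'
          · rfl
          · simp only [State.host]
            rw [Function.update_of_ne]
            intro e
            rcases Sym2.eq_iff.1 e with ⟨h1, -⟩ | ⟨h1, -⟩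
            · exact hza h1
            · exact hzb h1
        rw [this]
        exact linkChanges_self _
  · rw [Finset.sum_add_distrib, Finset.sum_ite_eq', Finset.sum_ite_eq']
    split_ifs <;> omega

/-- The selected node helps fewer than `2 c` pairs beforehand, so the capacity is respected
afterwards; the load of every other node cannot grow. -/
theorem exists_assignHelper (hA : Admissible R A) (hs : Sound A h st) {a b : V}
    (ha : a ∈ st.large) (hb : b ∈ st.large) (hab : b ∈ A a) :
    Sound A h (R.assignHelper s(a, b) st) ∧
      Evolves (R.D + 12) h h st (R.assignHelper s(a, b) st) ∧
      ∃ x, (R.assignHelper s(a, b) st).helper s(a, b) = some x ∧ x ∉ st.large := by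
  have hpick := R.pick_mem _ (hs.available_nonempty hA a)
  set x := R.pick st.available with hx
  rw [mem_available] at hpick
  have hhelper : (R.assignHelper s(a, b) st).helper =
      Function.update st.helper s(a, b) (some x) := rfl
  refine ⟨?_, ⟨⟨?_, fun w => ⟨[], by simp⟩⟩, rfl, rfl, ?_, ?_⟩, x, ?_, hpick.1⟩
  · refine ⟨hs.ego_eq, hs.hist_nil, hs.hist_sub, hs.W_sub, hs.large_card, ?_, ?_⟩
    · intro e y hy
      rw [hhelper] at hy
      by_cases he : e = s(a, b)
      · exact ⟨a, b, he, ha, hb, hab⟩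
      · rw [Function.update_of_ne he] at hy
        exact hs.helper_pair e y hy
    · intro y
      by_cases hy : y = x
      · have h1 : (R.assignHelper s(a, b) st).helps y ⊆ insert s(a, b) (st.helps y) := by
          intro e he
          simp only [State.helps, Finset.mem_filter, Finset.mem_univ, true_and, hhelper,
            Finset.mem_insert] at he ⊢
          by_cases hee : e = s(a, b)
          · exact Or.inl hee
          · rw [Function.update_of_ne hee] at he
            exact Or.inr he
        have h2 := (Finset.card_le_card h1).trans (Finset.card_insert_le _ _)
        rw [hy] at h2 ⊢
        omega
      · have h1 : (R.assignHelper s(a, b) st).helps y ⊆ st.helps y := by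
          intro e he
          simp only [State.helps, Finset.mem_filter, Finset.mem_univ, true_and, hhelper] at he ⊢
          by_cases hee : e = s(a, b)
          · rw [hee, Function.update_self, Option.some_inj] at he
            exact absurd he.symm hy
          · rwa [Function.update_of_ne hee] at he
        exact (Finset.card_le_card h1).trans (hs.helps_card y)
  · have h1 := linkChanges_update_helper st a b (some x) st.hops (st.msgs + 1 * R.D)
    have h2 : (R.assignHelper s(a, b) st).network =
      ({ st with helper := Function.update st.helper s(a, b) (some x), hops := st.hops,
                 msgs := st.msgs + 1 * R.D } : R.State).network := rfl
    rw [h2]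
    simp only [assignHelper, notify]
    omega
  · intro e he
    rw [hhelper]
    by_cases hee : e = s(a, b)
    · simp [hee]
    · rwa [Function.update_of_ne hee]
  · intro e y hy
    rw [hhelper] at hy
    by_cases hee : e = s(a, b)
    · rw [hee, Function.update_self, Option.some_inj] at hy
      exact Or.inr (hy ▸ hpick.1)
    · rw [Function.update_of_ne hee] at hy
      exact Or.inl hy
  · rw [hhelper, Function.update_self]

/-- The partners receive two messages, and at most one helper is assigned; insertions are paid by
the histories. -/
theorem exists_connect (hA : Admissible R A) (hs : Sound A h st) {u v : V} (huv : v ∈ A u) :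
    ∃ h', Sound A h' (R.connect u v st) ∧
      Evolves (3 * R.D + 12) h h' st (R.connect u v st) ∧
      (u ∈ st.large → v ∈ h' u) ∧ (v ∈ st.large → u ∈ h' v) ∧
      (u ∈ st.large → v ∈ st.large → (R.connect u v st).helper s(u, v) ≠ none) := by
  have hs1 := sound_notify hs 2
  have he1 := evolves_notify h st 2
  have hl1 : (R.notify 2 st).large = st.large := rfl
  unfold connect
  by_cases hu : u ∈ st.large
  · by_cases hv : v ∈ st.large
    · simp only [hl1, hu, hv, if_true]
      obtain ⟨h2, hs2, he2, hx⟩ : ∃ h2, Sound A h2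
          (if (R.notify 2 st).helper s(u, v) = none then R.assignHelper s(u, v) (R.notify 2 st)
            else R.notify 2 st) ∧ Evolves (R.D + 12) h h2 (R.notify 2 st)
          (if (R.notify 2 st).helper s(u, v) = none then R.assignHelper s(u, v) (R.notify 2 st)
            else R.notify 2 st) ∧
          (if (R.notify 2 st).helper s(u, v) = none then R.assignHelper s(u, v) (R.notify 2 st)
            else R.notify 2 st).helper s(u, v) ≠ none := by
        split_ifs with hnone
        · obtain ⟨h1, h2, x, hx, -⟩ := exists_assignHelper hA hs1 (a := u) (b := v) hu hv huv
          exact ⟨h, h1, h2, by rw [hx]; simp⟩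
        · exact ⟨h, hs1, (Evolves.refl h _).mono (by omega), hnone⟩
      generalize (if (R.notify 2 st).helper s(u, v) = none then
        R.assignHelper s(u, v) (R.notify 2 st) else R.notify 2 st) = st2 at hs2 he2 hx
      obtain ⟨h3, hs3, he3, hk3, hh3⟩ := exists_egoInsert hs2 (w := u) (k := v)
        (by rw [he2.large_eq]; exact hu) huv
      obtain ⟨h4, hs4, he4, hk4, hh4⟩ := exists_egoInsert hs3 (w := v) (k := u)
        (by rw [he3.large_eq, he2.large_eq]; exact hv) (hA.symm huv)
      refine ⟨h4, hs4, (((he1.trans he2).trans he3).trans he4).mono (by omega),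
        fun _ => he4.subset hk3, fun _ => hk4, fun _ _ => ?_⟩
      rw [hh4, hh3]
      exact hx
    · simp only [hl1, hu, hv, if_true, if_false]
      obtain ⟨h3, hs3, he3, hk3, hh3⟩ := exists_egoInsert hs1 (w := u) (k := v) hu huv
      exact ⟨h3, hs3, (he1.trans he3).mono (by omega), fun _ => hk3, fun h => h.elim,
        fun _ h => h.elim⟩
  · by_cases hv : v ∈ st.large
    · simp only [hl1, hu, hv, if_true, if_false]
      obtain ⟨h3, hs3, he3, hk3, hh3⟩ := exists_egoInsert hs1 (w := v) (k := u) hv (hA.symm huv)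
      exact ⟨h3, hs3, (he1.trans he3).mono (by omega), fun h => h.elim, fun _ => hk3,
        fun h => h.elim⟩
    · simp only [hl1, hu, hv, if_false]
      exact ⟨h, hs1, he1.mono (by omega), fun h => h.elim, fun h => h.elim, fun h => h.elim⟩

theorem exists_foldl_connect (hA : Admissible R A) (u : V) (l : List V) (hs : Sound A h st)
    (hl : ∀ v ∈ l, v ∈ A u) :
    ∃ h', Sound A h' (l.foldl (fun st v => R.connect u v st) st) ∧
      Evolves (l.length * (3 * R.D + 12)) h h' st (l.foldl (fun st v => R.connect u v st) st) ∧
      ∀ v ∈ l, (u ∈ st.large → v ∈ h' u) ∧ (u ∈ st.large → v ∈ st.large →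
        (l.foldl (fun st v => R.connect u v st) st).helper s(u, v) ≠ none) := by
  induction l generalizing h st with
  | nil => exact ⟨h, hs, (Evolves.refl h st).mono (by simp), by simp⟩
  | cons v l ih =>
    obtain ⟨h1, hs1, he1, hk1, -, hh1⟩ := exists_connect hA hs (hl v (by simp))
    obtain ⟨h2, hs2, he2, hk2⟩ := ih hs1 (fun x hx => hl x (by simp [hx]))
    refine ⟨h2, hs2, (he1.trans he2).mono (by rw [List.length_cons]; ring_nf; omega), ?_⟩
    intro x hx
    rcases List.mem_cons.1 hx with rfl | hx
    · exact ⟨fun hu => he2.subset (hk1 hu), fun hu hv => he2.helper_mono _ (hh1 hu hv)⟩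
    · have := hk2 x hx
      rw [he1.large_eq] at this
      exact this

theorem exists_foldl_assignHelper (hA : Admissible R A) (l : List (Sym2 V)) (hs : Sound A h st)
    (hl : ∀ e ∈ l, ∃ a b, e = s(a, b) ∧ a ∈ st.large ∧ b ∈ st.large ∧ b ∈ A a) :
    Sound A h (l.foldl (fun st e => R.assignHelper e st) st) ∧
      Evolves (l.length * (R.D + 12)) h h st (l.foldl (fun st e => R.assignHelper e st) st) ∧
      ∀ e ∈ l, ∀ x, (l.foldl (fun st e => R.assignHelper e st) st).helper e = some x →
        x ∉ st.large := by
  induction l generalizing st with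
  | nil => exact ⟨hs, (Evolves.refl h st).mono (by simp), by simp⟩
  | cons e l ih =>
    obtain ⟨a, b, rfl, ha, hb, hab⟩ := hl e (by simp)
    obtain ⟨hs1, he1, y, hy, hy'⟩ := exists_assignHelper hA hs ha hb hab
    obtain ⟨hs2, he2, hk2⟩ := ih hs1 (fun e he => by
      rw [he1.large_eq]
      exact hl e (by simp [he]))
    refine ⟨hs2, (he1.trans he2).mono (by rw [List.length_cons]; ring_nf; omega), ?_⟩
    intro e he x hx
    rcases List.mem_cons.1 he with rfl | he
    · rcases he2.helper_new _ x hx with h1 | h1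
      · rw [hy, Option.some_inj] at h1
        exact h1 ▸ hy'
      · rwa [he1.large_eq] at h1
    · have := hk2 e he x hx
      rwa [he1.large_eq] at this

end Operations

end ReNet

namespace ReNet

variable {V : Type} [Fintype V] [LinearOrder V] {R : ReNet V}

/-- All pairs of partners, except possibly those in `E`, are connected. -/
structure Complete (E : Set (Sym2 V)) (h : V → List V) (st : R.State) : Prop where
  mem_hist : ∀ w ∈ st.large, ∀ k ∈ st.W w, s(w, k) ∉ E → k ∈ h w
  helper_ne_none : ∀ w ∈ st.large, ∀ k ∈ st.large, k ∈ st.W w → s(w, k) ∉ E →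
    st.helper s(w, k) ≠ none
  helper_small : ∀ e x, st.helper e = some x → x ∉ st.large
  mem_large : ∀ w, w ∈ st.large ↔ R.threshold < (st.W w).card

/-- The invariant of a ReNet between two requests. -/
structure Stable (h : V → List V) (st : R.State) : Prop where
  sound : Sound st.W h st
  complete : Complete ∅ h st
  admissible : Admissible R st.W

theorem Evolves.complete {E : Set (Sym2 V)} {b : ℕ} {h h' : V → List V} {st st' : R.State}
    (m : Evolves b h h' st st') (hc : Complete E h st) : Complete E h' st' where
  mem_hist w hw k hk hE := m.subset (hc.mem_hist w (m.large_eq ▸ hw) k (m.W_eq ▸ hk) hE)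
  helper_ne_none w hw k hk hwk hE :=
    m.helper_mono _ (hc.helper_ne_none w (m.large_eq ▸ hw) k (m.large_eq ▸ hk) (m.W_eq ▸ hwk) hE)
  helper_small e x hx := by
    rw [m.large_eq]
    exact (m.helper_new e x hx).elim (hc.helper_small e x) id
  mem_large w := by rw [m.large_eq, m.W_eq]; exact hc.mem_large w

/-! ### A small node becomes large. -/

section MakeLarge

variable {A : V → Finset V} {E : Set (Sym2 V)} {h : V → List V} {st : R.State}

theorem sound_insert_large (hs : Sound A h st) {u : V} (hu : u ∉ st.large)
    (hAu : R.threshold < (A u).card) :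
    Sound A h ({ st with
        large := insert u st.large
        ego := Function.update st.ego u R.bst.init } :
      R.State) where
  ego_eq w hw := by
    by_cases hwu : w = u
    · subst hwu
      rw [hs.hist_nil w hu]
      simp [SelfAdjustingBST.afterAccesses]
    · simp only [Function.update_of_ne hwu]
      exact hs.ego_eq w ((Finset.mem_insert.1 hw).resolve_left hwu)
  hist_nil w hw := hs.hist_nil w fun hw' => hw (Finset.mem_insert_of_mem hw')
  hist_sub := hs.hist_sub
  W_sub := hs.W_sub
  large_card w hw := by
    rcases Finset.mem_insert.1 hw with rfl | hw
    · exact hAu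
    · exact hs.large_card w hw
  helper_pair e x hx := by
    obtain ⟨a, b, h1, h2, h3, h4⟩ := hs.helper_pair e x hx
    exact ⟨a, b, h1, Finset.mem_insert_of_mem h2, Finset.mem_insert_of_mem h3, h4⟩
  helps_card := hs.helps_card

/-- The new ego-BST is still empty. In other trees the slot of `u` keeps its host, because no helper
is assigned yet and the default host is `u` itself. Only the direct links at `u` vanish; a pair may
be listed with `u` in either position, whence the factor two. -/
theorem linkChanges_insert_large (hs : Sound A h st) {u : V} (hu : u ∉ st.large)
    (hW : ∀ x, u ∈ st.W x → x ∈ st.W u) :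
    linkChanges st.network ({ st with
        large := insert u st.large
        ego := Function.update st.ego u R.bst.init } : R.State).network ≤ 2 * (st.W u).card := by
  rw [network_eq, network_eq]
  refine (linkChanges_add _ _ _ _).trans ?_
  have htrees : ∑ w ∈ st.large, (treeLinks (st.egoTree w)).map (Sym2.map (st.host w)) =
      ∑ w ∈ insert u st.large, (treeLinks (State.egoTree (R := R) { st with
        large := insert u st.large
        ego := Function.update st.ego u R.bst.init } w)).map
        (Sym2.map (State.host (R := R) { st with
        large := insert u st.large
        ego := Function.update st.ego u R.bst.init } w)) := by
    rw [Finset.sum_insert hu]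
    have h1 : treeLinks (State.egoTree (R := R) { st with
        large := insert u st.large
        ego := Function.update st.ego u R.bst.init } u) = 0 := by
      simp [State.egoTree, R.bst.tree_init, treeLinks, linksBelow]
    rw [h1, Multiset.map_zero, zero_add]
    refine Finset.sum_congr rfl fun w hw => ?_
    have hwu : w ≠ u := fun e => hu (e ▸ hw)
    have h2 : State.host (R := R) { st with
        large := insert u st.large
        ego := Function.update st.ego u R.bst.init } w = st.host w := by
      funext o
      rcases o with _ | k
      · rfl
      · simp only [State.host, Finset.mem_insert]
        by_cases hk : k = u
        · subst hk
          rw [if_pos (Or.inl rfl), if_neg hu, hs.helper_eq_none hu]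
          rfl
        · simp only [hk, false_or]
    rw [h2]
    simp only [State.egoTree, Function.update_of_ne hwu]
  rw [htrees, linkChanges_self, add_zero]
  refine (linkChanges_finset_map _ _ _).trans ?_
  dsimp only
  have h3 : ((Finset.univ.filter fun p : V × V =>
      p.1 < p.2 ∧ p.2 ∈ st.W p.1 ∧ p.1 ∉ insert u st.large ∧ p.2 ∉ insert u st.large) \
      (Finset.univ.filter fun p : V × V =>
      p.1 < p.2 ∧ p.2 ∈ st.W p.1 ∧ p.1 ∉ st.large ∧ p.2 ∉ st.large)) = ∅ := by
    ext p
    simp only [Finset.mem_sdiff, Finset.mem_filter, Finset.mem_univ, true_and, Finset.mem_insert,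
      Finset.notMem_empty, iff_false]
    tauto
  have h4 : ((Finset.univ.filter fun p : V × V =>
      p.1 < p.2 ∧ p.2 ∈ st.W p.1 ∧ p.1 ∉ st.large ∧ p.2 ∉ st.large) \
      (Finset.univ.filter fun p : V × V =>
      p.1 < p.2 ∧ p.2 ∈ st.W p.1 ∧ p.1 ∉ insert u st.large ∧ p.2 ∉ insert u st.large)) ⊆
      (st.W u).image (fun y => (u, y)) ∪ (st.W u).image (fun y => (y, u)) := by
    rintro ⟨x, y⟩ hp
    simp only [Finset.mem_sdiff, Finset.mem_filter, Finset.mem_univ, true_and, Finset.mem_insert,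
      Finset.mem_union, Finset.mem_image, Prod.mk.injEq] at hp ⊢
    obtain ⟨⟨h1, h2, h3, h4⟩, h5⟩ := hp
    by_cases hx : x = u
    · subst hx
      exact Or.inl ⟨y, h2, rfl, rfl⟩
    · have hy : y = u := by tauto
      subst hy
      exact Or.inr ⟨x, hW x h2, rfl, rfl⟩
  have h5 := (Finset.card_le_card h4).trans (Finset.card_union_le _ _)
  have h6 := Finset.card_image_le (s := st.W u) (f := fun y => (u, y))
  have h7 := Finset.card_image_le (s := st.W u) (f := fun y => (y, u))
  rw [h3, Finset.card_empty]
  omega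

/-- Connecting `u` to all its partners puts them into its history and provides helpers for the large
ones. The roles that `u` had as a helper then go to available nodes, which are small in the enlarged
network. -/
theorem exists_makeLarge (hA : Admissible R A) (hD : 1 ≤ R.D) (hs : Sound A h st)
    (hc : ∀ w ∈ st.large, ∀ k ∈ st.W w, s(w, k) ∉ E → k ∈ h w)
    (hc' : ∀ w ∈ st.large, ∀ k ∈ st.large, k ∈ st.W w → s(w, k) ∉ E → st.helper s(w, k) ≠ none)
    (hc'' : ∀ e x, st.helper e = some x → x ∉ st.large)
    {u : V} (hu : u ∉ st.large) (hcard : (st.W u).card = R.threshold + 1)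
    (hW : ∀ x, u ∈ st.W x → x ∈ st.W u)
    (hlarge : ∀ w, w ≠ u → (w ∈ st.large ↔ R.threshold < (st.W w).card)) :
    ∃ h', Sound A h' (R.makeLarge u st) ∧ Complete E h' (R.makeLarge u st) ∧
      Moves (112 * R.c * R.D) h h' st (R.makeLarge u st) ∧ (R.makeLarge u st).W = st.W ∧
      (R.makeLarge u st).large = insert u st.large := by
  have hAu : R.threshold < (A u).card :=
    lt_of_lt_of_le (by omega) (Finset.card_le_card (hs.W_sub u))
  have hs0 := sound_insert_large hs hu hAu
  have hl0 := linkChanges_insert_large hs hu hW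
  unfold makeLarge
  set st0 : R.State :=
    { st with
        large := insert u st.large
        ego := Function.update st.ego u R.bst.init } with hst0
  have hm0 : Moves (2 * (R.threshold + 1)) h h st st0 :=
    ⟨by
      have h1 : st0.hops = st.hops := rfl
      have h2 : st0.msgs = st.msgs := rfl
      rw [hcard] at hl0
      omega, fun w => ⟨[], by simp⟩⟩
  have hs1 := sound_notify hs0 1
  have he1 := evolves_notify h st0 1
  have hsort : ∀ v, v ∈ ((R.notify 1 st0).W u).sort (· ≤ ·) ↔ v ∈ st.W u :=
    fun v => Finset.mem_sort _
  have hlen : (((R.notify 1 st0).W u).sort (· ≤ ·)).length = R.threshold + 1 := by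
    rw [Finset.length_sort]; exact hcard
  obtain ⟨h2, hs2, he2, hk2⟩ := exists_foldl_connect hA u
    (((R.notify 1 st0).W u).sort (· ≤ ·)) hs1 fun v hv => hs.W_sub u ((hsort v).1 hv)
  dsimp only
  set st2 := (((R.notify 1 st0).W u).sort (· ≤ ·)).foldl (fun st v => R.connect u v st)
    (R.notify 1 st0) with hst2
  have hL2 : st2.large = insert u st.large := he2.large_eq
  have hW2 : st2.W = st.W := he2.W_eq
  set roles := ((((Finset.univ : Finset V).sort (· ≤ ·)).product
    ((Finset.univ : Finset V).sort (· ≤ ·))).filter fun p =>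
      p.1 < p.2 ∧ s(p.1, p.2) ∈ st2.helps u).map fun p => s(p.1, p.2) with hroles
  -- The condition `p.1 < p.2` lists each unordered pair once, and misses none because partners are
  -- distinct.
  have hmem : ∀ e, e ∈ roles ↔ e ∈ st2.helps u := by
    intro e
    simp only [hroles, List.mem_map, List.mem_filter, decide_eq_true_eq]
    constructor
    · rintro ⟨p, ⟨-, -, hp⟩, rfl⟩
      exact hp
    · intro he
      have hpair : ∀ a b : V, (a, b) ∈ ((Finset.univ : Finset V).sort (· ≤ ·)).product
          ((Finset.univ : Finset V).sort (· ≤ ·)) := fun a b =>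
        List.mem_product.2 ⟨(Finset.mem_sort _).2 (Finset.mem_univ a),
          (Finset.mem_sort _).2 (Finset.mem_univ b)⟩
      obtain ⟨a, b, rfl, -, -, hab⟩ := hs2.helper_pair e u (by
        simpa [State.helps] using he)
      have hne : a ≠ b := fun e => hA.irrefl a (by rw [← e] at hab; exact hab)
      rcases lt_or_gt_of_ne hne with hlt | hlt
      · exact ⟨(a, b), ⟨hpair a b, hlt, he⟩, rfl⟩
      · exact ⟨(b, a), ⟨hpair b a, hlt, Sym2.eq_swap (a := b) (b := a) ▸ he⟩, Sym2.eq_swap⟩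
  have hnodup : roles.Nodup := by
    apply List.Nodup.map_on
    · intro p hp q hq e
      simp only [List.mem_filter, decide_eq_true_eq] at hp hq
      rcases Sym2.eq_iff.1 e with ⟨h1, h2⟩ | ⟨h1, h2⟩
      · exact Prod.ext h1 h2
      · have h3 := hp.2.1
        have h4 := hq.2.1
        rw [h1, h2] at h3
        exact absurd h4 h3.not_gt
    · exact (List.Nodup.product (Finset.sort_nodup _ _) (Finset.sort_nodup _ _)).filter _
  have hrlen : roles.length ≤ 2 * R.c := by
    rw [← List.toFinset_card_of_nodup hnodup]
    refine le_trans (Finset.card_le_card ?_) (hs2.helps_card u)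
    intro e he
    exact (hmem e).1 (List.mem_toFinset.1 he)
  obtain ⟨hs3, he3, hk3⟩ := exists_foldl_assignHelper hA roles hs2 fun e he =>
    hs2.helper_pair e u (by simpa [State.helps] using (hmem e).1 he)
  have he := (he1.trans he2).trans he3
  refine ⟨h2, hs3, ⟨?_, ?_, ?_, ?_⟩, (hm0.trans he.toMoves).mono ?_, he.W_eq, he.large_eq⟩
  · intro w hw k hk hE
    rw [he.W_eq] at hk
    rw [he.large_eq] at hw
    apply he3.subset
    by_cases hwu : w = u
    · subst hwu
      exact (hk2 k ((hsort k).2 hk)).1 (Finset.mem_insert_self _ _)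
    · exact he2.subset (hc w ((Finset.mem_insert.1 hw).resolve_left hwu) k hk hE)
  · intro w hw k hk hwk hE
    rw [he.W_eq] at hwk
    rw [he.large_eq] at hw hk
    apply he3.helper_mono
    by_cases hwu : w = u
    · subst hwu
      exact (hk2 k ((hsort k).2 hwk)).2 (Finset.mem_insert_self _ _) hk
    · by_cases hku : k = u
      · subst hku
        rw [Sym2.eq_swap]
        exact (hk2 w ((hsort w).2 (hW w hwk))).2 (Finset.mem_insert_self _ _) hw
      · exact (he1.trans he2).helper_mono _ (hc' w ((Finset.mem_insert.1 hw).resolve_left hwu) k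
          ((Finset.mem_insert.1 hk).resolve_left hku) hwk hE)
  · intro e x hx
    rw [he3.large_eq]
    rcases he3.helper_new e x hx with h4 | h4
    · by_cases hxu : x = u
      · exact hk3 e ((hmem e).2 (by simpa [State.helps, ← hxu] using h4)) x hx
      · rw [hL2]
        rcases (he1.trans he2).helper_new e x h4 with h5 | h5
        · intro h6
          exact hc'' e x h5 ((Finset.mem_insert.1 h6).resolve_left hxu)
        · exact h5
    · exact h4
  · intro w
    rw [he.W_eq, he.large_eq]
    change w ∈ insert u st.large ↔ R.threshold < (st.W w).card
    by_cases hwu : w = u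
    · subst hwu
      simp [hcard]
    · rw [← hlarge w hwu]
      simp [hwu]
  -- With `θ = 4 c`, the sum of all contributions is `14 c D + 80 c + 4 D + 14`, at most `112 c D`
  -- as `c` and `D` are at least one.
  · rw [hlen]
    have h1 : roles.length * (R.D + 12) ≤ 2 * R.c * (R.D + 12) := Nat.mul_le_mul_right _ hrlen
    have h2 := hA.c_pos
    have h3 : R.D ≤ R.c * R.D := Nat.le_mul_of_pos_left _ h2
    have h4 : R.c ≤ R.c * R.D := Nat.le_mul_of_pos_right _ hD
    simp only [threshold]
    nlinarith

end MakeLarge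

/-! ### Working sets grow by one partner. -/

section AddPartner

variable {A : V → Finset V} {E : Set (Sym2 V)} {h : V → List V} {st : R.State}

theorem linkChanges_update_W (st : R.State) (u v : V) :
    linkChanges st.network
      ({ st with W := Function.update st.W u (insert v (st.W u)) } : R.State).network ≤ 1 := by
  rw [network_eq, network_eq]
  refine (linkChanges_add _ _ _ _).trans ?_
  have h0 : ∑ w ∈ st.large, (treeLinks (st.egoTree w)).map (Sym2.map (st.host w)) =
      ∑ w ∈ st.large, (treeLinks (State.egoTree (R := R)
        { st with W := Function.update st.W u (insert v (st.W u)) } w)).map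
        (Sym2.map (State.host (R := R)
          { st with W := Function.update st.W u (insert v (st.W u)) } w)) := rfl
  dsimp only
  rw [← h0, linkChanges_self, add_zero]
  refine (linkChanges_finset_map _ _ _).trans ?_
  have key : ∀ x y, y ∈ Function.update st.W u (insert v (st.W u)) x ↔
      y ∈ st.W x ∨ (x, y) = (u, v) := by
    intro x y
    by_cases hx : x = u
    · subst hx
      simp [or_comm]
    · simp [hx]
  have h1 : ∀ p : V × V, p.2 ∈ Function.update st.W u (insert v (st.W u)) p.1 ↔
      p.2 ∈ st.W p.1 ∨ p = (u, v) := fun p => key p.1 p.2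
  simp only [h1]
  have h3 : ((Finset.univ.filter fun p : V × V =>
      p.1 < p.2 ∧ p.2 ∈ st.W p.1 ∧ p.1 ∉ st.large ∧ p.2 ∉ st.large) \
      (Finset.univ.filter fun p : V × V =>
      p.1 < p.2 ∧ (p.2 ∈ st.W p.1 ∨ p = (u, v)) ∧ p.1 ∉ st.large ∧ p.2 ∉ st.large)) = ∅ := by
    ext p
    simp only [Finset.mem_sdiff, Finset.mem_filter, Finset.mem_univ, true_and,
      Finset.notMem_empty, iff_false]
    tauto
  have h4 : ((Finset.univ.filter fun p : V × V =>
      p.1 < p.2 ∧ (p.2 ∈ st.W p.1 ∨ p = (u, v)) ∧ p.1 ∉ st.large ∧ p.2 ∉ st.large) \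
      (Finset.univ.filter fun p : V × V =>
      p.1 < p.2 ∧ p.2 ∈ st.W p.1 ∧ p.1 ∉ st.large ∧ p.2 ∉ st.large)) ⊆ {(u, v)} := by
    intro p
    simp only [Finset.mem_sdiff, Finset.mem_filter, Finset.mem_univ, true_and,
      Finset.mem_singleton]
    tauto
  have h5 := Finset.card_le_card h4
  rw [Finset.card_singleton] at h5
  rw [h3, Finset.card_empty, zero_add]
  exact h5

/-- The two halves of a partnership are added one after the other, so the working sets are briefly
asymmetric; `hW` allows this for the single partner being added. The number `m` is one if the node
becomes large and zero otherwise. -/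
theorem exists_addPartner (hA : Admissible R A) (hD : 1 ≤ R.D) (hs : Sound A h st)
    (hc : Complete E h st) {u v : V} (huv : v ∈ A u) (hv : v ∉ st.W u) (hE : s(u, v) ∈ E)
    (hW : ∀ x, u ∈ st.W x → x ∈ st.W u ∨ x = v) :
    ∃ h' m, Sound A h' (R.addPartner u v st) ∧ Complete E h' (R.addPartner u v st) ∧
      Moves (1 + 112 * R.c * R.D * m) h h' st (R.addPartner u v st) ∧
      (R.addPartner u v st).W = Function.update st.W u (insert v (st.W u)) ∧
      (R.addPartner u v st).large.card = st.large.card + m := by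
  unfold addPartner
  dsimp only
  have huv' : u ≠ v := fun e => hA.irrefl u (by rw [← e] at huv; exact huv)
  have hl1 := linkChanges_update_W st u v
  set st1 : R.State := { st with W := Function.update st.W u (insert v (st.W u)) } with hst1
  have hm1 : Moves 1 h h st st1 :=
    ⟨by
      have h1 : st1.hops = st.hops := rfl
      have h2 : st1.msgs = st.msgs := rfl
      omega, fun w => ⟨[], by simp⟩⟩
  have hWu : st1.W u = insert v (st.W u) := Function.update_self ..
  have hWne : ∀ x, x ≠ u → st1.W x = st.W x := fun x hx => Function.update_of_ne hx ..
  have hs1 : Sound A h st1 :=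
    { hs with
      W_sub := fun w => by
        by_cases hw : w = u
        · subst hw
          rw [hWu]
          exact Finset.insert_subset huv (hs.W_sub w)
        · rw [hWne w hw]
          exact hs.W_sub w }
  have hmemW : ∀ w k, k ∈ st1.W w → s(w, k) ∉ E → k ∈ st.W w := by
    intro w k hk hE'
    by_cases hw : w = u
    · subst hw
      rw [hWu] at hk
      rcases Finset.mem_insert.1 hk with rfl | hk
      · exact absurd hE hE'
      · exact hk
    · rwa [hWne w hw] at hk
  have hcard : (st1.W u).card = (st.W u).card + 1 := by rw [hWu, Finset.card_insert_of_notMem hv]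
  split_ifs with hcond
  · obtain ⟨h', h1, h2, h3, h4, h5⟩ := exists_makeLarge (E := E) hA hD hs1
      (fun w hw k hk hE' => hc.mem_hist w hw k (hmemW w k hk hE') hE')
      (fun w hw k hk hwk hE' => hc.helper_ne_none w hw k hk (hmemW w k hwk hE') hE')
      hc.helper_small hcond.1 hcond.2
      (by
        intro x hx
        rw [hWu]
        by_cases hxu : x = u
        · exact absurd (hs1.W_sub x (by rw [hxu] at hx ⊢; exact hx) : u ∈ A x)
            (by rw [hxu]; exact hA.irrefl u)
        · rw [hWne x hxu] at hx
          rcases hW x hx with hx | rfl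
          · exact Finset.mem_insert_of_mem hx
          · exact Finset.mem_insert_self _ _)
      (by
        intro w hw
        rw [hWne w hw]
        exact hc.mem_large w)
    refine ⟨h', 1, h1, h2, (hm1.trans h3).mono (by omega), h4, ?_⟩
    rw [h5, Finset.card_insert_of_notMem hcond.1]
  · refine ⟨h, 0, hs1, ⟨fun w hw k hk hE' => hc.mem_hist w hw k (hmemW w k hk hE') hE',
      fun w hw k hk hwk hE' => hc.helper_ne_none w hw k hk (hmemW w k hwk hE') hE',
      hc.helper_small, ?_⟩, hm1.mono (by omega), rfl, rfl⟩
    intro w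
    by_cases hw : w = u
    · subst hw
      have h1 := hc.mem_large w
      change w ∈ st.large ↔ _
      rw [hcard]
      by_cases hwl : w ∈ st.large
      · have := h1.1 hwl
        exact ⟨fun _ => by omega, fun _ => hwl⟩
      · have h2 : ¬ R.threshold < (st.W w).card := fun h => hwl (h1.2 h)
        have h3 : (st1.W w).card ≠ R.threshold + 1 := fun h => hcond ⟨hwl, h⟩
        exact ⟨fun h => absurd h hwl, fun h => by omega⟩
    · rw [hWne w hw]
      exact hc.mem_large w

end AddPartner

/-! ### A new pair of partners in a network that is not full. -/

section AddRoute

variable {h : V → List V} {st : R.State}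

/-- The partner relation after adding the pair `u, v`. -/
def addPair (W : V → Finset V) (u v : V) : V → Finset V :=
  Function.update (Function.update W u (insert v (W u))) v
    (insert u (Function.update W u (insert v (W u)) v))

omit [Fintype V] in
theorem mem_addPair {W : V → Finset V} {u v x y : V} :
    y ∈ addPair W u v x ↔ y ∈ W x ∨ s(x, y) = s(u, v) := by
  unfold addPair
  rw [Sym2.eq_iff]
  by_cases h1 : x = v <;> by_cases h2 : x = u <;> by_cases h3 : u = v <;>
    simp_all [Function.update_apply] <;> tauto

theorem sum_card_addPair {W : V → Finset V} {u v : V} (huv : u ≠ v) (h1 : v ∉ W u)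
    (h2 : u ∉ W v) : ∑ x, (addPair W u v x).card = ∑ x, (W x).card + 2 := by
  have h3 : ∀ x, (addPair W u v x).card =
      (W x).card + ((if x = u then 1 else 0) + if x = v then 1 else 0) := by
    intro x
    unfold addPair
    by_cases hx : x = v
    · subst hx
      rw [Function.update_self, Function.update_of_ne huv.symm, Finset.card_insert_of_notMem h2]
      simp [huv.symm]
    · rw [Function.update_of_ne hx]
      by_cases hx' : x = u
      · subst hx'
        rw [Function.update_self, Finset.card_insert_of_notMem h1]
        simp [hx]
      · rw [Function.update_of_ne hx']
        simp [hx, hx']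
  simp only [h3, Finset.sum_add_distrib]
  simp

theorem Stable.admissible_addPair (hst : Stable h st) {u v : V} (huv : u ≠ v) (hv : v ∉ st.W u)
    (hfull : ¬ st.IsFull) : Admissible R (addPair st.W u v) where
  symm {x y} hxy := by
    rw [mem_addPair] at hxy ⊢
    rcases hxy with h1 | h1
    · exact Or.inl (hst.admissible.symm h1)
    · exact Or.inr (Sym2.eq_swap.trans h1)
  irrefl x hx := by
    rw [mem_addPair] at hx
    rcases hx with h1 | h1
    · exact hst.admissible.irrefl x h1
    · rcases Sym2.eq_iff.1 h1 with ⟨rfl, h2⟩ | ⟨rfl, h2⟩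
      · exact huv h2
      · exact huv h2.symm
  sum_le := by
    rw [sum_card_addPair huv hv fun h => hv (hst.admissible.symm h)]
    -- The total size of the working sets is even, so being below `2 c n` it leaves room for two
    -- more.
    have h1 := hst.admissible.two_mul_card_pairs
    simp only [State.IsFull, threshold, not_le] at hfull
    have h2 : 4 * R.c * Fintype.card V = 2 * (2 * (R.c * Fintype.card V)) := by ring
    have h3 : 2 * R.c * Fintype.card V = 2 * (R.c * Fintype.card V) := by ring
    omega
  c_pos := hst.admissible.c_pos

/-- Connecting a new pair of partners in a network that is not full. -/
theorem Stable.exists_addRoute (hst : Stable h st) (hD : 1 ≤ R.D) {u v : V} (huv : u ≠ v)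
    (hv : v ∉ st.W u) (hfull : ¬ st.IsFull) :
    ∃ h' m, Stable h' (R.connect u v (R.addPartner v u (R.addPartner u v st))) ∧
      Moves (3 * R.D + 14 + 112 * R.c * R.D * m) h h' st
        (R.connect u v (R.addPartner v u (R.addPartner u v st))) ∧
      (R.connect u v (R.addPartner v u (R.addPartner u v st))).W = addPair st.W u v ∧
      (R.connect u v (R.addPartner v u (R.addPartner u v st))).large.card =
        st.large.card + m := by
  have hA := hst.admissible_addPair huv hv hfull
  have hvu : u ∉ st.W v := fun h => hv (hst.admissible.symm h)
  -- The intermediate states are measured against the final partner relation, which is already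
  -- symmetric.
  have hs0 : Sound (addPair st.W u v) h st :=
    hst.sound.mono fun w x hx => mem_addPair.2 (Or.inl hx)
  -- The new pair is exempted from being connected until the final connection takes place.
  have hc0 : Complete {s(u, v)} h st :=
    ⟨fun w hw k hk _ => hst.complete.mem_hist w hw k hk (by simp),
      fun w hw k hk hwk _ => hst.complete.helper_ne_none w hw k hk hwk (by simp),
      hst.complete.helper_small, hst.complete.mem_large⟩
  obtain ⟨h1, m1, hs1, hc1, hm1, hW1, hl1⟩ := exists_addPartner hA hD hs0 hc0
    (u := u) (v := v) (mem_addPair.2 (Or.inr rfl)) hv rfl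
    (fun x hx => Or.inl (hst.admissible.symm hx))
  set st1 := R.addPartner u v st with hst1
  have hWu : st1.W u = insert v (st.W u) := by rw [hW1, Function.update_self]
  have hWne : ∀ x, x ≠ u → st1.W x = st.W x := fun x hx => by
    rw [hW1, Function.update_of_ne hx]
  obtain ⟨h2, m2, hs2, hc2, hm2, hW2, hl2⟩ := exists_addPartner hA hD hs1 hc1
    (u := v) (v := u) (mem_addPair.2 (Or.inr Sym2.eq_swap)) (by rwa [hWne v huv.symm])
    Sym2.eq_swap (by
      intro x hx
      by_cases hxu : x = u
      · exact Or.inr hxu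
      · rw [hWne x hxu] at hx
        rw [hWne v huv.symm]
        exact Or.inl (hst.admissible.symm hx))
  set st2 := R.addPartner v u st1 with hst2
  have hW2' : st2.W = addPair st.W u v := by rw [hW2, hW1]; rfl
  obtain ⟨h3, hs3, he3, hk1, hk2, hk3⟩ := exists_connect hA hs2 (u := u) (v := v)
    (mem_addPair.2 (Or.inr rfl))
  have hW3 := he3.W_eq.trans hW2'
  have hc3 := he3.complete hc2
  refine ⟨h3, m1 + m2, ⟨by rw [hW3]; exact hs3, ⟨?_, ?_, hc3.helper_small, hc3.mem_large⟩,
    by rw [hW3]; exact hA⟩, ((hm1.trans hm2).trans he3.toMoves).mono ?_, hW3, ?_⟩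
  · intro w hw k hk _
    by_cases hE : s(w, k) = s(u, v)
    · rw [he3.large_eq] at hw
      rcases Sym2.eq_iff.1 hE with ⟨rfl, rfl⟩ | ⟨rfl, rfl⟩
      · exact hk1 hw
      · exact hk2 hw
    · exact hc3.mem_hist w hw k hk hE
  · intro w hw k hk hwk _
    by_cases hE : s(w, k) = s(u, v)
    · rw [he3.large_eq] at hw hk
      rw [hE]
      rcases Sym2.eq_iff.1 hE with ⟨rfl, rfl⟩ | ⟨rfl, rfl⟩
      · exact hk3 hw hk
      · exact hk3 hk hw
    · exact hc3.helper_ne_none w hw k hk hwk hE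
  · apply le_of_eq
    ring
  · rw [he3.large_eq, hl2, hl1, add_assoc]

theorem Moves.totalCost_le {b : ℕ} {h' : V → List V} {st' : R.State} (hm : Moves b h h' st st')
    (w : V) : R.bst.totalCost R.bst.init (h w) ≤ R.bst.totalCost R.bst.init (h' w) := by
  obtain ⟨l, h1, -, -⟩ := hm.ext w
  rw [h1]
  exact R.bst.totalCost_le_append _ _

/-- The unsuccessful search of a large source is paid for by the insertion that follows. -/
theorem searchLen_add_histCost_le {h' : V → List V} {st' : R.State} (hst : Stable h st)
    (hst' : Stable h' st') {b : ℕ} (hm : Moves b h h' st st') {u v : V} (hu : u ∈ st.large)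
    (hv : v ∉ st.W u) (hW : st'.W = addPair st.W u v) :
    searchLen v (st.egoTree u) + histCost R h ≤ histCost R h' := by
  have hmono := hm.totalCost_le
  have hu' : u ∈ st'.large := by
    rw [hst'.complete.mem_large]
    refine ((hst.complete.mem_large u).1 hu).trans_le (Finset.card_le_card ?_)
    intro x hx
    rw [hW, mem_addPair]
    exact Or.inl hx
  obtain ⟨l, h1, h2, h3⟩ := hm.ext u
  have h4 : ∀ k ∈ l, k = v := by
    intro k hk
    have h5 : k ∈ st'.W u := hst'.sound.hist_sub u k (by rw [h1]; simp [hk])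
    rw [hW, mem_addPair] at h5
    rcases h5 with h5 | h5
    · exact absurd (hst.complete.mem_hist u hu k h5 (by simp)) (h3 k hk)
    · exact Sym2.congr_right.1 h5
  have h5 : v ∈ l := by
    have h6 : v ∈ h' u := hst'.complete.mem_hist u hu' v
      (by rw [hW, mem_addPair]; exact Or.inr rfl) (by simp)
    rw [h1] at h6
    exact (List.mem_append.1 h6).resolve_left fun h => hv (hst.sound.hist_sub u v h)
  -- The other partners are in the history of `u` already, so its only new access is the insertion
  -- of `v`, searched for in the very tree in which the search has failed.
  have h6 : l = [v] := by
    rcases l with _ | ⟨a, _ | ⟨b, l⟩⟩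
    · simp at h5
    · rw [h4 a (by simp)]
    · have ha := h4 a (by simp)
      have hb := h4 b (by simp)
      simp [ha, hb] at h2
  have h7 : searchLen v (st.egoTree u) + R.bst.totalCost R.bst.init (h u) ≤
      R.bst.totalCost R.bst.init (h' u) := by
    rw [h1, h6, SelfAdjustingBST.totalCost_append_singleton, State.egoTree, hst.sound.ego_eq u hu,
      SelfAdjustingBST.accessCost]
    omega
  simp only [histCost]
  rw [← Finset.add_sum_erase _ _ (Finset.mem_univ u),
    ← Finset.add_sum_erase _ (fun w => R.bst.totalCost R.bst.init (h' w)) (Finset.mem_univ u)]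
  have := Finset.sum_le_sum fun w (_ : w ∈ Finset.univ.erase u) => hmono w
  omega

end AddRoute

end ReNet

namespace ReNet

variable {V : Type} [Fintype V] [LinearOrder V] {R : ReNet V}

/-! ### Ports, links and routes of a stable network. -/

section Network

variable {h : V → List V} {st : R.State}

omit [Fintype V] in
theorem nodup_keys_egoTree (st : R.State) (w : V) : (keys (st.egoTree w)).Nodup :=
  (R.bst.isBST_tree (st.ego w)).nodup

omit [Fintype V] in
theorem ports_add (M N : Multiset (Sym2 V)) (v : V) : ports (M + N) v = ports M v + ports N v :=
  Multiset.countP_add _ _ _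

omit [Fintype V] in
theorem ports_sum {ι : Type} (s : Finset ι) (f : ι → Multiset (Sym2 V)) (v : V) :
    ports (∑ i ∈ s, f i) v = ∑ i ∈ s, ports (f i) v := by
  classical
  induction s using Finset.induction_on with
  | empty => simp [ports]
  | insert i s hi ih => rw [Finset.sum_insert hi, Finset.sum_insert hi, ports_add, ih]

theorem ports_direct_le (hst : Stable h st) (x : V) :
    ports ((Finset.univ.filter fun p : V × V =>
      p.1 < p.2 ∧ p.2 ∈ st.W p.1 ∧ p.1 ∉ st.large ∧ p.2 ∉ st.large).val.map
        fun p => s(p.1, p.2)) x ≤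
      if x ∈ st.large then 0 else (st.W x \ st.large).card := by
  rw [ports, Multiset.countP_map, ← Finset.filter_val, ← Finset.card_def, Finset.filter_filter]
  split_ifs with hx
  · rw [Nat.le_zero, Finset.card_eq_zero, Finset.filter_eq_empty_iff]
    rintro ⟨y, z⟩ -
    simp only [Sym2.mem_iff, not_and]
    rintro ⟨-, -, h1, h2⟩ (rfl | rfl)
    · exact h1 hx
    · exact h2 hx
  · have hsub : (Finset.univ.filter fun p : V × V =>
        (p.1 < p.2 ∧ p.2 ∈ st.W p.1 ∧ p.1 ∉ st.large ∧ p.2 ∉ st.large) ∧ x ∈ s(p.1, p.2)) ⊆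
        (st.W x \ st.large).image fun y => if x < y then (x, y) else (y, x) := by
      rintro ⟨y, z⟩ hp
      simp only [Finset.mem_filter, Finset.mem_univ, true_and, Sym2.mem_iff, Finset.mem_image,
        Finset.mem_sdiff] at hp ⊢
      obtain ⟨⟨h1, h2, h3, h4⟩, rfl | rfl⟩ := hp
      · exact ⟨z, ⟨h2, h4⟩, if_pos h1⟩
      · exact ⟨y, ⟨hst.admissible.symm h2, h3⟩, if_neg h1.not_gt⟩
    exact (Finset.card_le_card hsub).trans Finset.card_image_le

theorem Stable.mem_W_iff (hst : Stable h st) {w : V} (hw : w ∈ st.large) (k : V) :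
    k ∈ st.W w ↔ k ∈ keys (st.egoTree w) := by
  rw [hst.sound.mem_keys hw]
  exact ⟨fun hk => hst.complete.mem_hist w hw k hk (by simp), hst.sound.hist_sub w k⟩

theorem ports_tree_le (hst : Stable h st) {w : V} (hw : w ∈ st.large) (x : V) :
    ports ((treeLinks (st.egoTree w)).map (Sym2.map (st.host w))) x ≤
      (if w = x then 1 else 0) +
        3 * ((st.W w).filter fun k => st.host w (some k) = x).card := by
  refine (countP_map_le_sum _ _ _ ((st.W w).filter fun k => st.host w (some k) = x) ?_).trans
    (Nat.add_le_add ?_ ?_)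
  · intro e he k hk hkx
    rw [Finset.mem_filter, hst.mem_W_iff hw]
    refine ⟨?_, hkx⟩
    by_contra hnot
    exact Multiset.countP_eq_zero.1 (countP_treeLinks_eq_zero hnot) e he hk
  · have : st.host w none = w := rfl
    rw [this]
    split_ifs
    · exact countP_treeLinks_none _
    · exact le_rfl
  · rw [mul_comm, ← smul_eq_mul]
    exact Finset.sum_le_card_nsmul _ _ _ fun k _ =>
      countP_treeLinks_le (nodup_keys_egoTree st w) k

/-- A small node hosts its own slot in the tree of each large partner, and two slots for each pair
it helps. A large node hosts no slot: its slots are taken by helpers, and helpers are small. -/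
theorem card_slots_le (hst : Stable h st) (x : V) :
    ∑ w ∈ st.large, ((st.W w).filter fun k => st.host w (some k) = x).card ≤
      if x ∈ st.large then 0 else (st.W x ∩ st.large).card + 2 * (st.helps x).card := by
  have key : ∀ w ∈ st.large, ∀ k ∈ st.W w, st.host w (some k) = x →
      x ∉ st.large ∧ (k = x ∨ st.helper s(w, k) = some x) := by
    intro w hw k hk hx
    by_cases hkl : k ∈ st.large
    · obtain ⟨y, hy⟩ := Option.ne_none_iff_exists'.1
        (hst.complete.helper_ne_none w hw k hkl hk (by simp))
      simp only [State.host, hkl, if_true, hy, Option.getD_some] at hx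
      subst hx
      exact ⟨hst.complete.helper_small _ _ hy, Or.inr hy⟩
    · simp only [State.host, hkl, if_false] at hx
      subst hx
      exact ⟨hkl, Or.inl rfl⟩
  split_ifs with hx
  · rw [Nat.le_zero, Finset.sum_eq_zero_iff]
    intro w hw
    rw [Finset.card_eq_zero, Finset.filter_eq_empty_iff]
    intro k hk hkx
    exact (key w hw k hk hkx).1 hx
  · rw [← Finset.card_sigma]
    have hsub : (st.large.sigma fun w => (st.W w).filter fun k => st.host w (some k) = x) ⊆
        (st.W x ∩ st.large).image (fun w => (⟨w, x⟩ : Σ _ : V, V)) ∪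
          Finset.univ.filter fun p : Σ _ : V, V => s(p.1, p.2) ∈ st.helps x := by
      rintro ⟨w, k⟩ hp
      simp only [Finset.mem_sigma, Finset.mem_filter, Finset.mem_union, Finset.mem_image,
        Finset.mem_inter, Finset.mem_univ, true_and, State.helps] at hp ⊢
      rcases (key w hp.1 k hp.2.1 hp.2.2).2 with rfl | h1
      · exact Or.inl ⟨w, ⟨hst.admissible.symm hp.2.1, hp.1⟩, rfl⟩
      · exact Or.inr h1
    refine (Finset.card_le_card hsub).trans ((Finset.card_union_le _ _).trans
      (Nat.add_le_add Finset.card_image_le ?_))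
    refine Finset.card_le_mul_card_image_of_maps_to (f := fun p : Σ _ : V, V => s(p.1, p.2))
      (fun p hp => (Finset.mem_filter.1 hp).2) 2 ?_
    intro e _
    induction e with
    | _ a b =>
      have hsub : (Finset.univ.filter fun p : Σ _ : V, V => s(p.1, p.2) ∈ st.helps x).filter
          (fun p => s(p.1, p.2) = s(a, b)) ⊆ {⟨a, b⟩, ⟨b, a⟩} := by
        rintro ⟨y, z⟩ hp
        have := (Finset.mem_filter.1 hp).2
        rcases Sym2.eq_iff.1 this with ⟨rfl, rfl⟩ | ⟨rfl, rfl⟩ <;> simp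
      exact (Finset.card_le_card hsub).trans Finset.card_le_two

/-- The degree bound. -/
theorem Stable.ports_le (hst : Stable h st) (x : V) : ports st.network x ≤ R.maxDegree := by
  rw [network_eq, ports_add, ports_sum]
  have h1 := ports_direct_le hst x
  have h2 : ∑ w ∈ st.large, ports ((treeLinks (st.egoTree w)).map (Sym2.map (st.host w))) x ≤
      ∑ w ∈ st.large, ((if w = x then 1 else 0) +
        3 * ((st.W w).filter fun k => st.host w (some k) = x).card) :=
    Finset.sum_le_sum fun w hw => ports_tree_le hst hw x
  rw [Finset.sum_add_distrib, Finset.sum_ite_eq', ← Finset.mul_sum] at h2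
  have h3 := card_slots_le hst x
  have h4 := hst.sound.helps_card x
  have h5 := hst.complete.mem_large x
  have h6 := hst.admissible.c_pos
  have h7 : (st.W x \ st.large).card + (st.W x ∩ st.large).card = (st.W x).card :=
    Finset.card_sdiff_add_card_inter _ _
  -- A large node only uses the port to the root of its tree. A small one uses one port per small
  -- partner, three per large partner and six per helped pair: at most `3 * 4 c + 6 * 2 c = 24 c`.
  simp only [maxDegree, threshold] at h5 ⊢
  by_cases hx : x ∈ st.large
  · simp only [hx, if_true] at h1 h2 h3
    omega
  · simp only [hx, if_false, false_iff, not_lt] at h1 h2 h3 h5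
    omega

/-- Direct links and tree links are each bounded by the total size of the working sets, at most `2 c
n`. -/
theorem Stable.card_network_le (hst : Stable h st) :
    Multiset.card st.network ≤ 4 * R.c * Fintype.card V := by
  rw [network_eq, Multiset.card_add, Multiset.card_map, Multiset.card_sum]
  have h1 : (Finset.univ.filter fun p : V × V =>
      p.1 < p.2 ∧ p.2 ∈ st.W p.1 ∧ p.1 ∉ st.large ∧ p.2 ∉ st.large).card ≤
      ∑ x, (st.W x).card := by
    rw [← Finset.card_sigma]
    refine Finset.card_le_card_of_injOn (fun p => ⟨p.1, p.2⟩) ?_ ?_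
    · intro p hp
      simp only [Finset.coe_filter, Set.mem_ofPred_eq] at hp
      simp [hp.2.2.1]
    · intro p _ q _ e
      simp only [Sigma.mk.injEq, heq_eq_eq] at e
      exact Prod.ext e.1 e.2
  have h2 : ∀ w ∈ st.large, Multiset.card
      ((treeLinks (st.egoTree w)).map (Sym2.map (st.host w))) ≤ (st.W w).card := by
    intro w hw
    rw [Multiset.card_map, treeLinks, card_linksBelow,
      ← List.toFinset_card_of_nodup (nodup_keys_egoTree st w)]
    apply Finset.card_le_card
    intro k hk
    rw [hst.mem_W_iff hw]
    exact List.mem_toFinset.1 hk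
  have h3 := (Finset.sum_le_sum h2).trans
    (Finset.sum_le_sum_of_subset (f := fun w => (st.W w).card) (Finset.subset_univ st.large))
  have h4 := hst.admissible.sum_le
  rw [Finset.card_def] at h1
  have h5 : 4 * R.c * Fintype.card V = 2 * (2 * R.c * Fintype.card V) := by ring
  omega

theorem searchLen_egoTree_le (st : R.State) (w k : V) :
    searchLen k (st.egoTree w) ≤ Fintype.card V := by
  refine (searchLen_le_length _ _).trans ?_
  rw [← List.toFinset_card_of_nodup (nodup_keys_egoTree st w)]
  exact Finset.card_le_univ _

theorem mem_network_of_tree {w : V} (hw : w ∈ st.large) {e : Sym2 (Option V)}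
    (he : e ∈ treeLinks (st.egoTree w)) : Sym2.map (st.host w) e ∈ st.network := by
  rw [network_eq]
  refine Multiset.mem_add.2 (Or.inr ?_)
  rw [Multiset.mem_sum]
  exact ⟨w, hw, Multiset.mem_map_of_mem _ he⟩

theorem Stable.edist_host_le (hst : Stable h st) {w k : V} (hw : w ∈ st.large)
    (hk : k ∈ st.W w) :
    (linkGraph st.network).edist w (st.host w (some k)) ≤ searchLen k (st.egoTree w) :=
  edist_linkGraph_le_searchLen (st.host w) (p := none) (R.bst.isBST_tree _)
    (fun _ he => mem_network_of_tree hw he) ((hst.mem_W_iff hw k).1 hk)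

/-- Requests are routed along the links of the network. -/
theorem Stable.edist_le_routeLen (hst : Stable h st) {u v : V} (huv : v ∈ st.W u) :
    (linkGraph st.network).edist u v ≤ (R.routeLen u v st : ℕ∞) := by
  have hvu := hst.admissible.symm huv
  have hne : u ≠ v := fun e => hst.admissible.irrefl u (by rw [← e] at huv; exact huv)
  unfold routeLen
  by_cases hu : u ∈ st.large
  · by_cases hv : v ∈ st.large
    · simp only [hu, hv, not_true, false_and, if_false, if_true]
      have h1 := hst.edist_host_le hu huv
      have h2 := hst.edist_host_le hv hvu
      -- Both slots of a pair of large nodes are occupied by the same helper, at which the two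
      -- halves of the route meet.
      have h3 : st.host v (some u) = st.host u (some v) := by
        obtain ⟨y, hy⟩ := Option.ne_none_iff_exists'.1
          (hst.complete.helper_ne_none u hu v hv huv (by simp))
        have hy' : st.helper s(v, u) = some y := by rw [Sym2.eq_swap]; exact hy
        simp [State.host, hu, hv, hy, hy']
      rw [h3, SimpleGraph.edist_comm] at h2
      push_cast
      exact SimpleGraph.edist_triangle.trans (add_le_add h1 h2)
    · simp only [hu, hv, not_true, false_and, if_false, if_true, add_zero]
      have h1 := hst.edist_host_le hu huv
      simpa [State.host, hv] using h1
  · by_cases hv : v ∈ st.large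
    · simp only [hu, hv, not_true, and_false, if_false, if_true, zero_add]
      have h1 := hst.edist_host_le hv hvu
      rw [SimpleGraph.edist_comm]
      simpa [State.host, hu] using h1
    · simp only [hu, hv, not_false_eq_true, and_self, if_true, Nat.cast_one]
      apply edist_linkGraph_le_one
      rw [network_eq]
      refine Multiset.mem_add.2 (Or.inl ?_)
      rcases lt_or_gt_of_ne hne with hlt | hlt
      · exact Multiset.mem_map.2 ⟨(u, v), by simp [hlt, huv, hu, hv], rfl⟩
      · exact Multiset.mem_map.2 ⟨(v, u), by simp [hlt, hvu, hu, hv], Sym2.eq_swap⟩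

end Network

/-! ### Routing and adjusting as accesses. -/

section Route

variable {h : V → List V} {st : R.State}

theorem Stable.congr {st' : R.State} (hst : Stable h st) (h1 : st'.W = st.W)
    (h2 : st'.large = st.large) (h3 : st'.ego = st.ego) (h4 : st'.helper = st.helper) :
    Stable h st' where
  sound := by rw [h1]; exact hst.sound.congr h1 h2 h3 h4
  complete :=
    { mem_hist := by rw [h1, h2]; exact hst.complete.mem_hist
      helper_ne_none := by rw [h1, h2, h4]; exact hst.complete.helper_ne_none
      helper_small := by rw [h2, h4]; exact hst.complete.helper_small
      mem_large := by rw [h1, h2]; exact hst.complete.mem_large }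
  admissible := by rw [h1]; exact hst.admissible

/-- Adjusting the ego-BST of `w` after it was searched for `k`. -/
theorem Stable.exists_egoAdjust (hst : Stable h st) {w k : V} (hk : k ∈ st.W w) :
    ∃ h', Stable h' (R.egoAdjust w k st) ∧
      (if w ∈ st.large then searchLen k (st.egoTree w) else 0) +
        linkChanges st.network (R.egoAdjust w k st).network + histCost R h ≤ histCost R h' ∧
      (∀ x y, (h' x).count y ≤ (h x).count y + if x = w ∧ y = k then 1 else 0) ∧
      (R.egoAdjust w k st).W = st.W ∧ (R.egoAdjust w k st).large = st.large ∧
      (R.egoAdjust w k st).hops = st.hops ∧ (R.egoAdjust w k st).msgs = st.msgs ∧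
      ∀ x, x ≠ w → (R.egoAdjust w k st).ego x = st.ego x := by
  unfold egoAdjust
  split_ifs with hw
  · have hmem := (hst.mem_W_iff hw k).1 hk
    have hacc : R.bst.adjust k (st.ego w) = R.bst.access k (st.ego w) := (if_pos hmem).symm
    have hsub : ∀ x y, y ∈ h x → y ∈ Function.update h w (h w ++ [k]) x := by
      intro x y hy
      by_cases hx : x = w
      · subst hx
        simp [hy]
      · rwa [Function.update_of_ne hx]
    refine ⟨Function.update h w (h w ++ [k]),
      ⟨hst.sound.update_ego hw hk hacc st.hops st.msgs,
        ⟨fun x hx y hy hE => hsub x y (hst.complete.mem_hist x hx y hy hE),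
          hst.complete.helper_ne_none, hst.complete.helper_small, hst.complete.mem_large⟩,
        hst.admissible⟩, ?_, ?_, rfl, rfl, rfl, rfl, ?_⟩
    · have h1 := linkChanges_update_ego st w (R.bst.adjust k (st.ego w)) st.hops st.msgs
      rw [histCost_update_append, ← hst.sound.ego_eq w hw, SelfAdjustingBST.accessCost, ← hacc]
      simp only [State.egoTree] at h1 ⊢
      omega
    · intro x y
      by_cases hx : x = w
      · subst hx
        rw [Function.update_self, List.count_append, List.count_singleton]
        by_cases hy : y = k
        · simp [hy]
        · simp [hy, Ne.symm hy]
      · simp [Function.update_of_ne hx]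
    · intro x hx
      exact Function.update_of_ne hx ..
  · refine ⟨h, hst, ?_, fun x y => Nat.le_add_right _ _, rfl, rfl, rfl, rfl, fun _ _ => rfl⟩
    rw [linkChanges_self]
    omega

/-- Routing a request between partners. -/
theorem Stable.exists_route (hst : Stable h st) {u v : V} (huv : v ∈ st.W u) :
    ∃ h', Stable h' (R.route u v st) ∧
      (R.route u v st).hops + linkChanges st.network (R.route u v st).network + histCost R h ≤
        st.hops + 1 + histCost R h' ∧
      (∀ x y, (h' x).count y ≤ (h x).count y + if s(x, y) = s(u, v) then 1 else 0) ∧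
      (R.route u v st).W = st.W ∧ (R.route u v st).large = st.large ∧
      (R.route u v st).msgs = st.msgs ∧ histCost R h ≤ histCost R h' := by
  have hne : v ≠ u := fun e => hst.admissible.irrefl u (by rw [e] at huv; exact huv)
  unfold route
  set st0 : R.State := { st with hops := st.hops + R.routeLen u v st } with hst0
  have hs0 : Stable h st0 := hst.congr rfl rfl rfl rfl
  obtain ⟨h1, hs1, hc1, hn1, hW1, hl1, hh1, hm1, he1⟩ := hs0.exists_egoAdjust (w := u) (k := v) huv
  obtain ⟨h2, hs2, hc2, hn2, hW2, hl2, hh2, hm2, -⟩ := hs1.exists_egoAdjust (w := v) (k := u)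
    (by rw [hW1]; exact hst.admissible.symm huv)
  refine ⟨h2, hs2, ?_, ?_, hW2.trans hW1, hl2.trans hl1, hm2.trans hm1, by omega⟩
  · have h3 := linkChanges_triangle st.network (R.egoAdjust u v st0).network
      (R.egoAdjust v u (R.egoAdjust u v st0)).network
    have h4 : (R.egoAdjust u v st0).egoTree v = st.egoTree v := by
      simp only [State.egoTree]
      rw [he1 v hne]
    have h5 : st0.network = st.network := rfl
    have h6 : st0.hops = st.hops + R.routeLen u v st := rfl
    have h7 : st0.large = st.large := rfl
    have h8 : st0.egoTree u = st.egoTree u := rfl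
    rw [hh2, hh1, h6]
    rw [h4, hl1, h7] at hc2
    rw [h5, h7, h8] at hc1
    have h9 : R.routeLen u v st ≤ 1 + (if u ∈ st.large then searchLen v (st.egoTree u) else 0) +
        (if v ∈ st.large then searchLen u (st.egoTree v) else 0) := by
      unfold routeLen
      split_ifs <;> omega
    omega
  · intro x y
    have h3 := hn1 x y
    have h4 := hn2 x y
    have h5 : (if x = u ∧ y = v then 1 else 0) + (if x = v ∧ y = u then 1 else 0) ≤
        if s(x, y) = s(u, v) then 1 else 0 := by
      by_cases h6 : x = u ∧ y = v
      · have h7 : ¬ (x = v ∧ y = u) := fun h => hne (h.1.symm.trans h6.1)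
        rw [if_pos h6, if_neg h7, if_pos (Sym2.eq_iff.2 (Or.inl h6))]
      · by_cases h7 : x = v ∧ y = u
        · rw [if_neg h6, if_pos h7, if_pos (Sym2.eq_iff.2 (Or.inr h7))]
        · simp [h6, h7]
    omega

/-- A network without partners. -/
theorem stable_empty (hc : 1 ≤ R.c) (x y : ℕ) :
    Stable (fun _ => []) ({ R.init with hops := x, msgs := y } : R.State) where
  sound :=
    { ego_eq := fun w hw => by simp [init] at hw
      hist_nil := fun _ _ => rfl
      hist_sub := by simp
      W_sub := fun _ => subset_rfl
      large_card := fun w hw => by simp [init] at hw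
      helper_pair := fun e x hx => by simp [init] at hx
      helps_card := fun x => by simp [State.helps, init] }
  complete :=
    { mem_hist := fun w hw => by simp [init] at hw
      helper_ne_none := fun w hw => by simp [init] at hw
      helper_small := fun e x hx => by simp [init] at hx
      mem_large := by simp [init] }
  admissible :=
    { symm := by simp [init]
      irrefl := by simp [init]
      sum_le := by simp [init]
      c_pos := hc }

end Route

end ReNet

/-! ### Amortised cost of one request. -/

namespace ReNet

variable {V : Type} [Fintype V] [LinearOrder V] {R : ReNet V}

/-- The potential that pays for the changes of the partner relation. -/
def setupCost (st : R.State) : ℕ := 9 * ∑ x, (st.W x).card + 112 * R.c * st.large.card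

/-- The states at and after the routing of a request are as they should be. -/
def Step.IsSound (s : R.Step) : Prop :=
  (∃ h, Stable h s.routed ∧ s.req.2 ∈ s.routed.W s.req.1) ∧ ∃ h, Stable h s.after

theorem Step.isReset_iff {s : R.Step} :
    s.isReset = true ↔ s.req.2 ∉ s.before.W s.req.1 ∧ s.before.IsFull := by
  unfold Step.isReset
  exact decide_eq_true_iff

section Serve

variable {h : V → List V} {st : R.State}

theorem Moves.count_le {b : ℕ} {h h' : V → List V} {st st' : R.State} (m : Moves b h h' st st')
    (x y : V) : (h' x).count y ≤ max ((h x).count y) 1 := by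
  obtain ⟨l, h1, h2, h3⟩ := m.ext x
  rw [h1, List.count_append]
  by_cases hy : y ∈ l
  · rw [List.count_eq_zero_of_not_mem (h3 y hy), List.count_eq_one_of_mem h2 hy]
    simp
  · rw [List.count_eq_zero_of_not_mem hy]
    simp

/-- Setting up and routing a request between new partners. -/
theorem Stable.exists_serve_new (hst : Stable h st) (hD : 1 ≤ R.D) {u v : V} (huv : u ≠ v)
    (hv : v ∉ st.W u) (hfull : ¬ st.IsFull) (P : R.State)
    (hP : P = R.connect u v (R.addPartner v u (R.addPartner u v st))) :
    ∃ hr h', Stable hr P ∧ v ∈ P.W u ∧ Stable h' (R.route u v P) ∧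
      (R.route u v P).hops + (R.route u v P).msgs +
        linkChanges st.network (R.route u v P).network + R.D + histCost R h +
        R.D * setupCost st ≤
        st.hops + st.msgs + histCost R h' + 1 + R.D * setupCost (R.route u v P) ∧
      (if u ∈ st.large then searchLen v (st.egoTree u) else 0) + histCost R h ≤ histCost R h' ∧
      (∀ x y, (h' x).count y ≤ max ((h x).count y) 1 + if s(x, y) = s(u, v) then 1 else 0) ∧
      ∀ x y, y ∈ (R.route u v P).W x ↔ y ∈ st.W x ∨ s(x, y) = s(u, v) := by
  obtain ⟨h1, m, hs1, hm1, hW1, hl1⟩ := hst.exists_addRoute hD huv hv hfull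
  rw [← hP] at hs1 hm1 hW1 hl1
  have hvP : v ∈ P.W u := by rw [hW1, mem_addPair]; exact Or.inr rfl
  obtain ⟨h2, hs2, hc2, hn2, hW2, hl2, hmsg, hmono⟩ := hs1.exists_route hvP
  -- Two new entries in the working sets raise the potential by 18, enough for `4 D + 14` including
  -- the first notification; each node that becomes large brings its `112 c`.
  have hset : setupCost (R.route u v P) = setupCost st + 18 + 112 * R.c * m := by
    simp only [setupCost]
    rw [hW2, hl2, hW1, hl1, sum_card_addPair huv hv fun h => hv (hst.admissible.symm h)]
    ring
  refine ⟨h1, h2, hs1, hvP, hs2, ?_, ?_, ?_, ?_⟩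
  · have h3 := hm1.cost
    have h4 := linkChanges_triangle st.network P.network (R.route u v P).network
    have h5 : R.D * setupCost (R.route u v P) =
        R.D * setupCost st + 18 * R.D + 112 * R.c * R.D * m := by
      rw [hset]; ring
    rw [hmsg, h5]
    omega
  · refine le_trans ?_ hmono
    split_ifs with hu
    · exact searchLen_add_histCost_le hst hs1 hm1 hu hv hW1
    · rw [zero_add]
      exact Finset.sum_le_sum fun w _ => hm1.totalCost_le w
  · intro x y
    exact (hn2 x y).trans (Nat.add_le_add_right (hm1.count_le x y) _)
  · intro x y
    rw [hW2, hW1, mem_addPair]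

/-- A request that does not cause a reset. -/
theorem Stable.exists_serve (hst : Stable h st) (hD : 1 ≤ R.D) {u v : V} (huv : u ≠ v)
    (hres : (R.serve st (u, v)).isReset = false) :
    ∃ h', (R.serve st (u, v)).IsSound ∧ Stable h' (R.serve st (u, v)).after ∧
      (R.serve st (u, v)).cost + 2 * histCost R h + R.D * setupCost st ≤
        2 * histCost R h' + R.D * setupCost (R.serve st (u, v)).after + 1 ∧
      (∀ x y, (h' x).count y ≤ max ((h x).count y) 1 + if s(x, y) = s(u, v) then 1 else 0) ∧
      ∀ x y, y ∈ (R.serve st (u, v)).after.W x ↔ y ∈ st.W x ∨ s(x, y) = s(u, v) := by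
  rw [← Bool.not_eq_true, Step.isReset_iff, not_and] at hres
  simp only [Step.IsSound, Step.cost, serve]
  by_cases hv : v ∈ st.W u
  · have hprep : R.prepare u v st = { st with hops := 0, msgs := 0 } := if_pos hv
    have hs0 : Stable h (R.prepare u v st) := by
      rw [hprep]
      exact hst.congr rfl rfl rfl rfl
    have hv' : v ∈ (R.prepare u v st).W u := by rw [hprep]; exact hv
    obtain ⟨h2, hs2, hc2, hn2, hW2, hl2, hmsg, hmono⟩ := hs0.exists_route hv'
    refine ⟨h2, ⟨⟨h, hs0, hv'⟩, h2, hs2⟩, hs2, ?_, ?_, ?_⟩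
    · have h3 : setupCost (R.route u v (R.prepare u v st)) = setupCost st := by
        simp only [setupCost]
        rw [hW2, hl2, hprep]
      have h4 : (R.prepare u v st).hops = 0 := by rw [hprep]
      have h5 : (R.prepare u v st).msgs = 0 := by rw [hprep]
      have h6 : (R.prepare u v st).network = st.network := by rw [hprep]; rfl
      rw [h3, hmsg, h5]
      rw [h4, h6] at hc2
      omega
    · intro x y
      exact (hn2 x y).trans (Nat.add_le_add_right (le_max_left _ _) _)
    · intro x y
      rw [hW2, hprep]
      constructor
      · exact Or.inl
      · rintro (h1 | h1)
        · exact h1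
        · rcases Sym2.eq_iff.1 h1 with ⟨rfl, rfl⟩ | ⟨rfl, rfl⟩
          · exact hv
          · exact hst.admissible.symm hv
  · have hfull := hres hv
    set st1 : R.State := R.notify 1 { st with
      hops := 0 + if u ∈ st.large then searchLen v (st.egoTree u) else 0
      msgs := 0 } with hst1
    have hprep : R.prepare u v st = R.connect u v (R.addPartner v u (R.addPartner u v st1)) := by
      rw [show R.prepare u v st = R.addRoute u v { st with
        hops := 0 + if u ∈ st.large then searchLen v (st.egoTree u) else 0
        msgs := 0 } from if_neg hv]
      unfold addRoute
      dsimp only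
      rw [if_neg (show ¬ st1.IsFull from hfull)]
    have hs1 : Stable h st1 := hst.congr rfl rfl rfl rfl
    obtain ⟨hr, h2, hsr, hvr, hs2, hc2, hu2, hn2, hW2⟩ :=
      hs1.exists_serve_new hD huv (show v ∉ st1.W u from hv) (show ¬ st1.IsFull from hfull) _ hprep
    refine ⟨h2, ⟨⟨hr, hsr, hvr⟩, h2, hs2⟩, hs2, ?_, hn2, hW2⟩
    have h3 : st1.network = st.network := rfl
    have h4 : st1.hops = 0 + if u ∈ st.large then searchLen v (st.egoTree u) else 0 := rfl
    have h5 : st1.msgs = 0 + 1 * R.D := rfl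
    have h6 : setupCost st1 = setupCost st := rfl
    -- The unsuccessful search is charged a second time to the growth of the histories. This is why
    -- their cost enters with the factor two.
    change (if u ∈ st.large then searchLen v (st.egoTree u) else 0) + _ ≤ _ at hu2
    rw [h3, h4, h5, h6] at hc2
    omega

/-- A request that causes a reset. -/
theorem Stable.exists_serve_reset (hst : Stable h st) (hD : 1 ≤ R.D) {u v : V} (huv : u ≠ v)
    (hres : (R.serve st (u, v)).isReset = true) :
    ∃ h', (R.serve st (u, v)).IsSound ∧ Stable h' (R.serve st (u, v)).after ∧
      (R.serve st (u, v)).cost ≤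
        2 * histCost R h' + R.D * setupCost (R.serve st (u, v)).after + 1 +
          6 * R.c * Fintype.card V ∧
      (∀ x y, (h' x).count y ≤ 1 + if s(x, y) = s(u, v) then 1 else 0) ∧
      ∀ x y, y ∈ (R.serve st (u, v)).after.W x ↔ s(x, y) = s(u, v) := by
  rw [Step.isReset_iff] at hres
  obtain ⟨hv, hfull⟩ := hres
  simp only [Step.IsSound, Step.cost, serve]
  set st1 : R.State := { R.init with
    hops := 0 + if u ∈ st.large then searchLen v (st.egoTree u) else 0
    msgs := 0 + 1 * R.D + Fintype.card V } with hst1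
  have hprep : R.prepare u v st = R.connect u v (R.addPartner v u (R.addPartner u v st1)) := by
    rw [show R.prepare u v st = R.addRoute u v { st with
      hops := 0 + if u ∈ st.large then searchLen v (st.egoTree u) else 0
      msgs := 0 } from if_neg hv]
    unfold addRoute
    dsimp only
    rw [if_pos (show State.IsFull (R.notify 1 { st with
      hops := 0 + if u ∈ st.large then searchLen v (st.egoTree u) else 0
      msgs := 0 }) from hfull)]
    rfl
  have hc := hst.admissible.c_pos
  have hn : 0 < Fintype.card V := Fintype.card_pos_iff.2 ⟨u⟩
  have hs1 : Stable (fun _ => []) st1 := stable_empty hc _ _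
  have hfull1 : ¬ st1.IsFull := by
    have : ∑ x, (st1.W x).card = 0 := Finset.sum_eq_zero fun x _ => rfl
    simp only [State.IsFull, this, threshold, not_le]
    positivity
  obtain ⟨hr, h2, hsr, hvr, hs2, hc2, -, hn2, hW2⟩ :=
    hs1.exists_serve_new hD huv (show v ∉ st1.W u by simp [hst1, init]) hfull1 _ hprep
  refine ⟨h2, ⟨⟨hr, hsr, hvr⟩, h2, hs2⟩, hs2, ?_, ?_, ?_⟩
  · have h3 : st1.network = 0 := by
      rw [network_eq]
      simp [hst1, init]
    -- The change passes through the empty network. Removing at most `4 c n` links, the failed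
    -- search of at most `n` nodes and the broadcast make up the `6 c n`.
    have h4 := linkChanges_triangle st.network 0 (R.route u v (R.prepare u v st)).network
    have h5 := linkChanges_le_card st.network 0
    have h6 := hst.card_network_le
    have h7 : st1.hops = 0 + if u ∈ st.large then searchLen v (st.egoTree u) else 0 := rfl
    have h8 : st1.msgs = 0 + 1 * R.D + Fintype.card V := rfl
    have h9 : (if u ∈ st.large then searchLen v (st.egoTree u) else 0) ≤ Fintype.card V := by
      split_ifs
      · exact searchLen_egoTree_le st u v
      · exact Nat.zero_le _
    have h10 : Fintype.card V ≤ R.c * Fintype.card V := Nat.le_mul_of_pos_left _ hc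
    rw [h3, h7, h8] at hc2
    rw [Multiset.card_zero] at h5
    rw [mul_assoc] at h6 ⊢
    omega
  · intro x y
    simpa using hn2 x y
  · intro x y
    rw [hW2]
    simp [hst1, init]

end Serve

end ReNet

/-! ### Reset windows. -/

namespace ReNet

variable {V : Type} [Fintype V] [LinearOrder V] {R : ReNet V}

/-- The state after a sequence of requests. -/
def stateAfter (R : ReNet V) (st : R.State) (σ : List (V × V)) : R.State :=
  σ.foldl (fun st r => (R.serve st r).after) st

theorem run_append (st : R.State) (σ τ : List (V × V)) :
    R.run st (σ ++ τ) = R.run st σ ++ R.run (R.stateAfter st σ) τ := by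
  induction σ generalizing st with
  | nil => rfl
  | cons r σ ih => simp [run, stateAfter, ih]

theorem requests_run (st : R.State) (σ : List (V × V)) : requests (R.run st σ) = σ := by
  induction σ generalizing st with
  | nil => rfl
  | cons r σ ih =>
    have := ih (R.serve st r).after
    simp only [requests] at this
    simp only [run, requests, List.map_cons, this]
    rfl

theorem length_run (st : R.State) (σ : List (V × V)) : (R.run st σ).length = σ.length := by
  conv_rhs => rw [← requests_run (R := R) st σ]
  simp [requests]

theorem exists_of_run_eq_append {st : R.State} {σ : List (V × V)} {a b : List R.Step}
    (h : R.run st σ = a ++ b) :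
    ∃ σ₁ σ₂, σ = σ₁ ++ σ₂ ∧ a = R.run st σ₁ ∧ b = R.run (R.stateAfter st σ₁) σ₂ := by
  refine ⟨σ.take a.length, σ.drop a.length, (List.take_append_drop _ _).symm, ?_⟩
  have h1 := run_append (R := R) st (σ.take a.length) (σ.drop a.length)
  rw [List.take_append_drop, h] at h1
  refine List.append_inj h1 ?_
  have h2 := congrArg List.length h
  rw [length_run, List.length_append] at h2
  rw [length_run, List.length_take]
  omega

/-- The state `st` is reached by the requests `τ` since the last reset, at cost `k`. -/
structure Tracks (h : V → List V) (st : R.State) (τ : List (V × V)) (k : ℕ) : Prop where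
  stable : Stable h st
  mem_W : ∀ x y, y ∈ st.W x ↔ (x, y) ∈ τ ∨ (y, x) ∈ τ
  count_le : ∀ x y, (h x).count y ≤ τ.count (x, y) + τ.count (y, x) + 1
  cost_le : k ≤ 2 * histCost R h + R.D * setupCost st + τ.length + 6 * R.c * Fintype.card V

omit [Fintype V] in
theorem count_append_pair {τ : List (V × V)} {u v : V} (huv : u ≠ v) (x y : V) :
    (τ ++ [(u, v)]).count (x, y) + (τ ++ [(u, v)]).count (y, x) =
      τ.count (x, y) + τ.count (y, x) + if s(x, y) = s(u, v) then 1 else 0 := by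
  simp only [List.count_append, List.count_singleton, Sym2.eq_iff, beq_iff_eq, Prod.mk.injEq]
  by_cases h1 : x = u ∧ y = v
  · obtain ⟨rfl, rfl⟩ := h1
    simp [huv, huv.symm]
    omega
  · by_cases h2 : x = v ∧ y = u
    · obtain ⟨rfl, rfl⟩ := h2
      simp [huv, huv.symm]
      omega
    · have h3 : ¬ (u = x ∧ v = y) := fun h => h1 ⟨h.1.symm, h.2.symm⟩
      have h4 : ¬ (u = y ∧ v = x) := fun h => h2 ⟨h.2.symm, h.1.symm⟩
      simp [h1, h2, h3, h4]

omit [Fintype V] in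
theorem mem_append_pair_iff {τ : List (V × V)} {u v x y : V} :
    ((x, y) ∈ τ ++ [(u, v)] ∨ (y, x) ∈ τ ++ [(u, v)]) ↔
      ((x, y) ∈ τ ∨ (y, x) ∈ τ) ∨ s(x, y) = s(u, v) := by
  simp only [List.mem_append, List.mem_singleton, Prod.mk.injEq, Sym2.eq_iff]
  tauto

theorem Tracks.serve {h : V → List V} {st : R.State} {τ : List (V × V)} {k : ℕ}
    (ht : Tracks h st τ k) (hD : 1 ≤ R.D) {r : V × V} (hr : r.1 ≠ r.2)
    (hres : (R.serve st r).isReset = false) :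
    (R.serve st r).IsSound ∧
      ∃ h', Tracks h' (R.serve st r).after (τ ++ [r]) (k + (R.serve st r).cost) := by
  obtain ⟨u, v⟩ := r
  replace hr : u ≠ v := hr
  obtain ⟨h', hsnd, hs, hc, hn, hW⟩ := ht.stable.exists_serve hD hr hres
  refine ⟨hsnd, h', hs, ?_, ?_, ?_⟩
  · intro x y
    rw [hW, ht.mem_W, mem_append_pair_iff]
  · intro x y
    rw [count_append_pair hr]
    have h1 := hn x y
    have h2 := ht.count_le x y
    omega
  · have h1 := ht.cost_le
    rw [List.length_append, List.length_singleton]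
    omega

theorem tracks_init (hc : 1 ≤ R.c) : Tracks (fun _ => []) R.init [] 0 where
  stable := stable_empty hc 0 0
  mem_W := by simp [init]
  count_le := by simp
  cost_le := Nat.zero_le _

/-- A reset starts a new window. -/
theorem Stable.tracks_serve_reset {h : V → List V} {st : R.State} (hst : Stable h st)
    (hD : 1 ≤ R.D) {r : V × V} (hr : r.1 ≠ r.2) (hres : (R.serve st r).isReset = true) :
    (R.serve st r).IsSound ∧
      ∃ h', Tracks h' (R.serve st r).after [r] (R.serve st r).cost := by
  obtain ⟨u, v⟩ := r
  replace hr : u ≠ v := hr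
  obtain ⟨h', hsnd, hs, hc, hn, hW⟩ := hst.exists_serve_reset hD hr hres
  refine ⟨hsnd, h', hs, ?_, ?_, ?_⟩
  · intro x y
    have := mem_append_pair_iff (τ := []) (u := u) (v := v) (x := x) (y := y)
    simp only [List.nil_append, List.not_mem_nil, or_self, false_or] at this
    rw [hW, this]
  · intro x y
    have h1 := count_append_pair (τ := []) hr x y
    simp only [List.nil_append, List.count_nil, zero_add] at h1
    have h2 := hn x y
    omega
  · rw [List.length_singleton]
    omega

theorem Tracks.run {h : V → List V} {st : R.State} {τ : List (V × V)} {k : ℕ}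
    (ht : Tracks h st τ k) (hD : 1 ≤ R.D) (σ : List (V × V)) (hσ : ∀ r ∈ σ, r.1 ≠ r.2)
    (hres : ∀ s ∈ R.run st σ, s.isReset = false) :
    (∀ s ∈ R.run st σ, s.IsSound) ∧
      ∃ h', Tracks h' (R.stateAfter st σ) (τ ++ σ) (k + totalCost (R.run st σ)) := by
  induction σ generalizing h st τ k with
  | nil => exact ⟨by simp [ReNet.run], h, by simpa [stateAfter, ReNet.run, totalCost] using ht⟩
  | cons r σ ih =>
    -- Serving a request extends the tracked window and adds its cost to `k`.
    obtain ⟨h1, h', ht'⟩ := ht.serve hD (hσ r (by simp)) (hres _ (by simp [ReNet.run]))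
    obtain ⟨h2, h'', ht''⟩ := ih ht' (fun r hr => hσ r (by simp [hr]))
      fun s hs => hres s (by simp [ReNet.run, hs])
    refine ⟨?_, h'', ?_⟩
    · intro s hs
      rcases List.mem_cons.1 hs with rfl | hs
      · exact h1
      · exact h2 s hs
    · simpa [stateAfter, ReNet.run, totalCost, add_assoc] using ht''

theorem isReset_eq_false_of_isChain {s : R.Step} {l : List R.Step}
    (h : List.IsChain (fun _ s' : R.Step => (!s'.isReset) = true) (s :: l)) :
    ∀ s' ∈ l, s'.isReset = false := by
  induction l generalizing s with
  | nil => simp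
  | cons a l ih =>
    rw [List.isChain_cons_cons] at h
    intro s' hs'
    rcases List.mem_cons.1 hs' with rfl | hs'
    · simpa using h.1
    · exact ih h.2 s' hs'

/-- A reset takes place only after many different requests. -/
theorem Tracks.length_ge {h : V → List V} {st : R.State} {τ σ : List (V × V)} {k δ : ℕ}
    (ht : Tracks h st τ k) {r : V × V} (hres : (R.serve st r).isReset = true)
    (hσ : τ ++ [r] <:+: σ) (hsp : IsSparse R.c δ σ) : δ ≤ τ.length := by
  obtain ⟨u, v⟩ := r
  by_contra hlt
  have h1 := hsp _ hσ (by rw [List.length_append, List.length_singleton]; omega)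
  obtain ⟨hv, hfull⟩ := Step.isReset_iff.1 hres
  change v ∉ st.W u at hv
  change st.IsFull at hfull
  have h2 := ht.stable.admissible.two_mul_card_pairs
  -- A full network has at least `c n` pairs, each requested since the last reset, and the pair that
  -- triggers the reset is new: too many for a sparse stretch of length `δ`.
  have h3 : insert s(u, v) (Finset.univ.filter fun e : Sym2 V =>
      ∃ a b, e = s(a, b) ∧ b ∈ st.W a) ⊆
      (τ ++ [(u, v)]).toFinset.image fun p => s(p.1, p.2) := by
    intro e he
    simp only [Finset.mem_insert, Finset.mem_filter, Finset.mem_univ, true_and,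
      Finset.mem_image, List.mem_toFinset] at he ⊢
    rcases he with rfl | ⟨a, b, rfl, hab⟩
    · exact ⟨(u, v), by simp, rfl⟩
    · rcases (ht.mem_W a b).1 hab with h4 | h4
      · exact ⟨(a, b), by simp [h4], rfl⟩
      · exact ⟨(b, a), by simp [h4], Sym2.eq_swap⟩
  have h4 := (Finset.card_le_card h3).trans Finset.card_image_le
  rw [Finset.card_insert_of_notMem] at h4
  · simp only [State.IsFull, threshold] at hfull
    have h5 : 4 * R.c * Fintype.card V = 4 * (R.c * Fintype.card V) := by ring
    omega
  · simp only [Finset.mem_filter, Finset.mem_univ, true_and, not_exists, not_and]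
    intro a b e hab
    rcases Sym2.eq_iff.1 e with ⟨h5, h6⟩ | ⟨h5, h6⟩
    · exact hv (by simpa [h5, h6] using hab)
    · exact hv (by simpa [h5, h6] using ht.stable.admissible.symm hab)

/-- What holds for every reset window. -/
def WindowSound (w : List R.Step) : Prop :=
  (∀ s ∈ w, s.IsSound) ∧ ∃ h, ∃ st : R.State, Tracks h st (requests w) (totalCost w)

/-- Every window starts afresh, from the empty network or by a reset, which is what `hstart` keeps
through the induction. A window followed by another one ends just before a reset and is therefore
long. -/
theorem windows_sound (hD : 1 ≤ R.D) {δ : ℕ} (ws : List (List R.Step)) {h : V → List V}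
    {st : R.State} (hst : Stable h st) {σ : List (V × V)} (hrun : R.run st σ = ws.flatten)
    (hσ : ∀ r ∈ σ, r.1 ≠ r.2) (hsp : IsSparse R.c δ σ)
    (hstart : Tracks h st [] 0 ∨ ∀ r τ, σ = r :: τ → (R.serve st r).isReset = true)
    (hne : ∀ w ∈ ws, w ≠ [])
    (hchain : ∀ w ∈ ws, List.IsChain (fun _ s : R.Step => (!s.isReset) = true) w)
    (hcut : List.IsChain (fun a b : List R.Step => ∃ (_ : a ≠ []) (hb : b ≠ []),
      (!(b.head hb).isReset) = false) ws) :
    (∀ w ∈ ws, WindowSound w) ∧ ∀ w ∈ ws.dropLast, δ ≤ w.length := by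
  induction ws generalizing h st σ with
  | nil => simp
  | cons w ws ih =>
    rw [List.flatten_cons] at hrun
    obtain ⟨σ₁, σ₂, rfl, rfl, hrun2⟩ := exists_of_run_eq_append hrun
    have hσ₁ : ∀ r ∈ σ₁, r.1 ≠ r.2 := fun r hr => hσ r (by simp [hr])
    rcases σ₁ with _ | ⟨r, σ₁⟩
    · exact absurd rfl (hne _ List.mem_cons_self)
    have hnores := isReset_eq_false_of_isChain (hchain _ List.mem_cons_self)
    obtain ⟨hsnd, h', ht⟩ : (R.serve st r).IsSound ∧
        ∃ h', Tracks h' (R.serve st r).after [r] (R.serve st r).cost := by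
      by_cases hres : (R.serve st r).isReset = true
      · exact hst.tracks_serve_reset hD (hσ₁ r (by simp)) hres
      · rcases hstart with h0 | h0
        · simpa using h0.serve hD (hσ₁ r (by simp)) (by simpa using hres)
        · exact absurd (h0 r (σ₁ ++ σ₂) rfl) hres
    obtain ⟨hsnd', h'', ht'⟩ := ht.run hD σ₁ (fun r hr => hσ₁ r (by simp [hr])) hnores
    have hT : Tracks h'' (R.stateAfter st (r :: σ₁)) (r :: σ₁)
        (totalCost (R.run st (r :: σ₁))) := by
      simpa [stateAfter, ReNet.run, totalCost] using ht'
    have hfirst : WindowSound (R.run st (r :: σ₁)) := by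
      refine ⟨?_, h'', _, by rw [requests_run]; exact hT⟩
      intro s hs
      rcases List.mem_cons.1 hs with rfl | hs
      · exact hsnd
      · exact hsnd' s hs
    have hnext : ∀ r₂ τ, σ₂ = r₂ :: τ →
        (R.serve (R.stateAfter st (r :: σ₁)) r₂).isReset = true := by
      rintro r₂ τ rfl
      rcases ws with _ | ⟨w₂, ws⟩
      · simp [ReNet.run] at hrun2
      · rw [List.isChain_cons_cons] at hcut
        obtain ⟨-, hb, hhead⟩ := hcut.1
        rcases w₂ with _ | ⟨s, w₂⟩
        · exact absurd rfl hb
        · simp only [List.flatten_cons, List.cons_append, ReNet.run, List.cons.injEq] at hrun2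
          rw [List.head_cons, hrun2.1] at hhead
          simpa using hhead
    obtain ⟨h3, h4⟩ := ih hT.stable hrun2.symm (fun r hr => hσ r (by simp [hr]))
      (fun τ hτ => hsp τ (hτ.trans (List.suffix_append _ _).isInfix)) (Or.inr hnext)
      (fun w hw => hne w (by simp [hw])) (fun w hw => hchain w (by simp [hw])) hcut.tail
    refine ⟨?_, ?_⟩
    · intro w hw
      rcases List.mem_cons.1 hw with rfl | hw
      · exact hfirst
      · exact h3 w hw
    · rcases ws with _ | ⟨w₂, ws⟩
      · simp
      · intro w hw
        rw [List.dropLast_cons_cons] at hw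
        rcases List.mem_cons.1 hw with rfl | hw
        · rw [length_run]
          rcases σ₂ with _ | ⟨r₂, τ⟩
          · have := hne w₂ (by simp)
            simp [ReNet.run] at hrun2
            exact absurd hrun2.1 this
          · refine hT.length_ge (hnext r₂ τ rfl) ⟨[], τ, ?_⟩ hsp
            simp
        · exact h4 w hw

/-- The reset windows of a run are sound, and all but the last are long. -/
theorem windows_spec (hc : 1 ≤ R.c) (hD : 1 ≤ R.D) {δ : ℕ} {σ : List (V × V)}
    (hσ : ∀ r ∈ σ, r.1 ≠ r.2) (hsp : IsSparse R.c δ σ) :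
    (∀ w ∈ R.windows σ, WindowSound w) ∧ (∀ w ∈ (R.windows σ).dropLast, δ ≤ w.length) ∧
      (R.windows σ).flatten = R.run R.init σ := by
  have hflat : (R.windows σ).flatten = R.run R.init σ := List.flatten_splitBy _ _
  obtain ⟨h1, h2⟩ := windows_sound hD (R.windows σ) (tracks_init hc).stable hflat.symm hσ hsp
    (Or.inl (tracks_init hc)) (fun w hw => List.ne_nil_of_mem_splitBy hw)
    (fun w hw => List.isChain_of_mem_splitBy hw)
    (List.isChain_getLast_head_splitBy (fun _ s : R.Step => !s.isReset) (R.run R.init σ))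
  exact ⟨h1, h2, hflat⟩

/-- The cost of a window in terms of conditional distributions `p` of the destination given the
source and `q` of the source given the destination. -/
theorem Tracks.cost_le_of_distribution {h : V → List V} {st : R.State} {τ : List (V × V)} {k K : ℕ}
    (ht : Tracks h st τ k) (hD : 1 ≤ R.D) (hK : R.bst.IsStaticallyOptimal K) (p q : V → V → ℝ)
    (hp : ∀ x y, 0 ≤ p x y) (hq : ∀ x y, 0 ≤ q x y) (hp1 : ∀ x, ∑ y, p x y ≤ 1)
    (hq1 : ∀ x, ∑ y, q x y ≤ 1) (hpos : ∀ r ∈ τ, 0 < p r.1 r.2 ∧ 0 < q r.2 r.1) :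
    (k : ℝ) ≤ τ.length + 136 * R.c * (Fintype.card V * R.D : ℕ) +
      4 * K * (τ.map fun r => 4 + (-Real.logb 2 (p r.1 r.2) + -Real.logb 2 (q r.2 r.1))).sum := by
  -- One tree per node has to serve it both as a source and as a destination. Averaging the two
  -- distributions costs one extra step of depth.
  have hsum : ∀ w, ∑ y, (p w y + q w y) / 2 ≤ 1 := by
    intro w
    rw [← Finset.sum_div, Finset.sum_add_distrib]
    have := hp1 w
    have := hq1 w
    linarith
  choose T hT hkeys hlen using fun w => exists_tree_searchLen_le (fun y => (p w y + q w y) / 2)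
    (fun y => by have := hp w y; have := hq w y; positivity) (hsum w)
  have hT1 : ∀ r ∈ τ, (searchLen r.2 (T r.1) : ℝ) ≤ 2 - Real.logb 2 (p r.1 r.2) := by
    intro r hr
    obtain ⟨h1, h2⟩ := hpos r hr
    have h3 : p r.1 r.2 / 2 ≤ (p r.1 r.2 + q r.1 r.2) / 2 := by
      have := hq r.1 r.2
      linarith
    have h4 := Real.logb_le_logb_of_le one_lt_two (by positivity) h3
    rw [Real.logb_div h1.ne' two_ne_zero, Real.logb_self_eq_one one_lt_two] at h4
    have h5 := hlen r.1 r.2 (lt_of_lt_of_le (by positivity) h3)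
    linarith
  have hT2 : ∀ r ∈ τ, (searchLen r.1 (T r.2) : ℝ) ≤ 2 - Real.logb 2 (q r.2 r.1) := by
    intro r hr
    obtain ⟨h1, h2⟩ := hpos r hr
    have h3 : q r.2 r.1 / 2 ≤ (p r.2 r.1 + q r.2 r.1) / 2 := by
      have := hp r.2 r.1
      linarith
    have h4 := Real.logb_le_logb_of_le one_lt_two (by positivity) h3
    rw [Real.logb_div h2.ne' two_ne_zero, Real.logb_self_eq_one one_lt_two] at h4
    have h5 := hlen r.2 r.1 (lt_of_lt_of_le (by positivity) h3)
    linarith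
  have hmem : ∀ w, ∀ y ∈ h w, y ∈ st.W w := ht.stable.sound.hist_sub
  have hkeysT : ∀ w, ∀ y ∈ h w, y ∈ keys (T w) := by
    intro w y hy
    rw [hkeys]
    have h1 := hp w y
    have h2 := hq w y
    rcases (ht.mem_W w y).1 (hmem w y hy) with h3 | h3
    · have := (hpos _ h3).1
      positivity
    · have := (hpos _ h3).2
      positivity
  -- A partner may be accessed once more than it is requested, for its insertion; since it was
  -- requested at least once, a factor two suffices.
  have hcount : ∀ w y, (h w).count y ≤ 2 * (τ.count (w, y) + τ.count (y, w)) := by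
    intro w y
    by_cases hy : y ∈ h w
    · have h1 := ht.count_le w y
      have h2 : 1 ≤ τ.count (w, y) + τ.count (y, w) := by
        rcases (ht.mem_W w y).1 (hmem w y hy) with h3 | h3
        · have := List.count_pos_iff.2 h3
          omega
        · have := List.count_pos_iff.2 h3
          omega
      omega
    · rw [List.count_eq_zero_of_not_mem hy]
      exact Nat.zero_le _
  have htree : ∀ w, (R.bst.totalCost R.bst.init (h w) : ℝ) ≤
      K * ∑ y, 2 * ((τ.count (w, y) : ℝ) + τ.count (y, w)) * searchLen y (T w) := by
    intro w
    have h1 := hK (h w) (T w) (hT w) (hkeysT w)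
    have h2 : ((h w).map fun y => searchLen y (T w)).sum ≤
        ∑ y, 2 * (τ.count (w, y) + τ.count (y, w)) * searchLen y (T w) := by
      rw [Finset.sum_list_map_count]
      refine (Finset.sum_le_sum_of_subset (Finset.subset_univ _)).trans
        (Finset.sum_le_sum fun y _ => ?_)
      rw [smul_eq_mul]
      exact Nat.mul_le_mul_right _ (hcount w y)
    have h3 := h1.trans (Nat.mul_le_mul_left K h2)
    exact_mod_cast h3
  have hhist : (histCost R h : ℝ) ≤ 2 * K * (τ.map fun r =>
      4 + (-Real.logb 2 (p r.1 r.2) + -Real.logb 2 (q r.2 r.1))).sum := by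
    have h1 : (histCost R h : ℝ) ≤
        ∑ w, K * ∑ y, 2 * ((τ.count (w, y) : ℝ) + τ.count (y, w)) * searchLen y (T w) := by
      rw [histCost, Nat.cast_sum]
      exact Finset.sum_le_sum fun w _ => htree w
    have h2 : ∑ w, (K : ℝ) * ∑ y, 2 * ((τ.count (w, y) : ℝ) + τ.count (y, w)) *
        searchLen y (T w) = 2 * K * ((τ.map fun r => (searchLen r.2 (T r.1) : ℝ)).sum +
          (τ.map fun r => (searchLen r.1 (T r.2) : ℝ)).sum) := by
      rw [sum_map_eq_sum_count τ fun x y => (searchLen y (T x) : ℝ),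
        sum_map_eq_sum_count τ fun x y => (searchLen x (T y) : ℝ),
        Finset.sum_comm (f := fun x y => (τ.count (x, y) : ℝ) * (searchLen x (T y) : ℝ)),
        ← Finset.sum_add_distrib, Finset.mul_sum]
      refine Finset.sum_congr rfl fun w _ => ?_
      rw [← Finset.sum_add_distrib, Finset.mul_sum, Finset.mul_sum]
      refine Finset.sum_congr rfl fun y _ => ?_
      ring
    rw [h2] at h1
    refine h1.trans (mul_le_mul_of_nonneg_left ?_ (by positivity))
    rw [← List.sum_map_add]
    refine List.sum_le_sum fun r hr => ?_
    have := hT1 r hr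
    have := hT2 r hr
    linarith
  -- `9 * 2 + 112 = 130`; the reset adds 6 to give 136.
  have hset : setupCost st ≤ 130 * (R.c * Fintype.card V) := by
    have h1 := ht.stable.admissible.sum_le
    have h2 : R.c * st.large.card ≤ R.c * Fintype.card V :=
      Nat.mul_le_mul_left _ (Finset.card_le_univ _)
    simp only [setupCost]
    rw [mul_assoc] at h1 ⊢
    omega
  have hk : k ≤ 2 * histCost R h + τ.length + 136 * R.c * (Fintype.card V * R.D) := by
    have h1 := ht.cost_le
    have h2 := Nat.mul_le_mul_left R.D hset
    have h3 : R.c * Fintype.card V ≤ R.c * Fintype.card V * R.D := Nat.le_mul_of_pos_right _ hD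
    have h4 : R.D * (130 * (R.c * Fintype.card V)) = 130 * (R.c * Fintype.card V * R.D) := by ring
    have h5 : 136 * R.c * (Fintype.card V * R.D) = 136 * (R.c * Fintype.card V * R.D) := by ring
    rw [mul_assoc 6] at h1
    omega
  have hk' : (k : ℝ) ≤ 2 * histCost R h + τ.length +
      136 * R.c * (Fintype.card V * R.D : ℕ) := by exact_mod_cast hk
  linarith

end ReNet

/-! ### Summing over the windows. -/

namespace ReNet

variable {V : Type} [Fintype V] [LinearOrder V] {R : ReNet V}

theorem totalCost_flatten (ws : List (List R.Step)) :
    totalCost ws.flatten = (ws.map totalCost).sum := by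
  simp only [totalCost, List.map_flatten, List.sum_flatten, List.map_map]
  rfl

omit [Fintype V] in
theorem requests_flatten (ws : List (List R.Step)) :
    requests ws.flatten = (ws.map requests).flatten := by
  simp only [requests, List.map_flatten]
  rfl

/-- If all windows but the last are long, then a cost per window is amortised. -/
theorem length_mul_le {β : Type} (ws : List (List β)) {δ a N : ℕ}
    (hlong : ∀ w ∈ ws.dropLast, δ ≤ w.length) (hδ : δ ≤ (ws.map List.length).sum)
    (hN : N ≤ a * δ) : ws.length * N ≤ 2 * a * (ws.map List.length).sum := by
  have h1 := List.card_nsmul_le_sum (ws.dropLast.map List.length) δ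
    (by intro x hx; obtain ⟨w, hw, rfl⟩ := List.mem_map.1 hx; exact hlong w hw)
  have h2 : (ws.dropLast.map List.length).sum ≤ (ws.map List.length).sum :=
    ((List.dropLast_sublist ws).map _).sum_le_sum (by simp)
  rw [List.length_map, List.length_dropLast, smul_eq_mul] at h1
  -- All windows but the last have total length at least `δ` times their number, and the last is
  -- charged to the whole sequence, hence the two.
  have h3 : ws.length * δ ≤ 2 * (ws.map List.length).sum := by
    rcases Nat.eq_zero_or_pos ws.length with h0 | h0
    · simp [h0]
    · obtain ⟨k, hk⟩ : ∃ k, ws.length = k + 1 := ⟨ws.length - 1, by omega⟩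
      rw [hk] at h1 ⊢
      simp only [Nat.add_sub_cancel] at h1
      rw [add_mul, one_mul]
      omega
  calc ws.length * N ≤ ws.length * (a * δ) := Nat.mul_le_mul_left _ hN
    _ = a * (ws.length * δ) := by ring
    _ ≤ a * (2 * (ws.map List.length).sum) := Nat.mul_le_mul_left _ h3
    _ = 2 * a * (ws.map List.length).sum := by ring

theorem totalCost_run_le (hc : 1 ≤ R.c) (hD : 1 ≤ R.D) {δ a : ℕ} {σ : List (V × V)}
    (hσ : ∀ r ∈ σ, r.1 ≠ r.2) (hsp : IsSparse R.c δ σ) (hδ : δ ≤ σ.length)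
    (hn : Fintype.card V * R.D ≤ a * δ) (X : List R.Step → ℝ)
    (hX : ∀ w ∈ R.windows σ, (totalCost w : ℝ) ≤
      w.length + 136 * R.c * (Fintype.card V * R.D : ℕ) + X w) :
    (totalCost (R.run R.init σ) : ℝ) ≤
      ((R.windows σ).map fun w => (1 + 272 * R.c * a) * (w.length : ℝ) + X w).sum := by
  obtain ⟨-, hlong, hflat⟩ := windows_spec hc hD hσ hsp
  have hlen : ((R.windows σ).map List.length).sum = σ.length := by
    rw [← List.length_flatten, hflat, length_run]
  have h1 := length_mul_le (R.windows σ) hlong (by rw [hlen]; exact hδ) hn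
  have h2 : ((R.windows σ).length : ℝ) * (Fintype.card V * R.D : ℕ) ≤
      2 * a * ((R.windows σ).map List.length).sum := by exact_mod_cast h1
  have h3 : (((R.windows σ).map List.length).sum : ℝ) =
      ((R.windows σ).map fun w => (w.length : ℝ)).sum := by
    rw [Nat.cast_list_sum, List.map_map]
    rfl
  rw [← hflat, totalCost_flatten, Nat.cast_list_sum, List.map_map]
  have h4 := List.sum_le_sum hX
  simp only [List.sum_map_add, List.sum_map_mul_left, List.map_const', List.sum_replicate,
    nsmul_eq_mul] at h4 ⊢
  refine le_trans (le_of_eq ?_) (h4.trans ?_)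
  · rfl
  · rw [h3] at h2
    have h5 : (0 : ℝ) ≤ 136 * R.c := by positivity
    have h6 := mul_le_mul_of_nonneg_left h2 h5
    linarith

/-- The comparison distribution may come from any sequence containing the requests of the window:
the window itself for the local bounds, the whole sequence for the global one. -/
theorem WindowSound.cost_le {w : List R.Step} (hw : WindowSound w) (hD : 1 ≤ R.D) {K : ℕ}
    (hK : R.bst.IsStaticallyOptimal K) (σ : List (V × V)) (hσ : ∀ r ∈ requests w, r ∈ σ) :
    (totalCost w : ℝ) ≤ w.length + 136 * R.c * (Fintype.card V * R.D : ℕ) +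
      4 * K * ((requests w).map fun r => 4 + (-Real.logb 2 (condFreq σ r.1 r.2) +
        -Real.logb 2 (condFreq (σ.map Prod.swap) r.2 r.1))).sum := by
  obtain ⟨-, h, st, ht⟩ := hw
  have := ht.cost_le_of_distribution hD hK (condFreq σ) (condFreq (σ.map Prod.swap))
    (condFreq_nonneg _) (condFreq_nonneg _) (sum_condFreq_le _) (sum_condFreq_le _)
    fun r hr => ⟨condFreq_pos (hσ r hr), condFreq_swap_pos (hσ r hr)⟩
  rwa [requests, List.length_map] at this

theorem sum_information (σ : List (V × V)) :
    (σ.map fun r => 4 + (-Real.logb 2 (condFreq σ r.1 r.2) +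
        -Real.logb 2 (condFreq (σ.map Prod.swap) r.2 r.1))).sum =
      σ.length * (4 + (entropyDstGivenSrc 2 σ + entropySrcGivenDst 2 σ)) := by
  rw [List.sum_map_add, List.sum_map_add, ← length_mul_entropyDstGivenSrc,
    ← length_mul_entropySrcGivenDst]
  simp
  ring

/-- The entropy bounds for a single window, for the windows together, and overall. -/
theorem entropy_bounds (hc : 1 ≤ R.c) (hD : 1 ≤ R.D) {K : ℕ} (hK : R.bst.IsStaticallyOptimal K)
    {δ a : ℕ} {σ : List (V × V)} (hσ : ∀ r ∈ σ, r.1 ≠ r.2) (hsp : IsSparse R.c δ σ)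
    (hδ : δ ≤ σ.length) (hn : Fintype.card V * R.D ≤ a * δ) {C : ℝ}
    (hC : 1 + 272 * R.c * a + 16 * K ≤ C) :
    (∀ w ∈ R.windows σ, δ ≤ w.length → (totalCost w : ℝ) ≤ C * w.length *
      (1 + entropyDstGivenSrc 2 (requests w) + entropySrcGivenDst 2 (requests w))) ∧
    (totalCost (R.run R.init σ) : ℝ) ≤ C * ((R.windows σ).map fun w => w.length *
      (1 + entropyDstGivenSrc 2 (requests w) + entropySrcGivenDst 2 (requests w))).sum ∧
    (totalCost (R.run R.init σ) : ℝ) ≤ C * (σ.length *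
      (1 + entropyDstGivenSrc 2 σ + entropySrcGivenDst 2 σ)) := by
  obtain ⟨hw, -, hflat⟩ := windows_spec hc hD hσ hsp
  have hlocal : ∀ w ∈ R.windows σ, (totalCost w : ℝ) ≤
      w.length + 136 * R.c * (Fintype.card V * R.D : ℕ) + 4 * K * (w.length *
        (4 + (entropyDstGivenSrc 2 (requests w) + entropySrcGivenDst 2 (requests w)))) := by
    intro w hmem
    have h1 := (hw w hmem).cost_le hD hK (requests w) fun _ h => h
    rwa [sum_information, requests, List.length_map] at h1
  have hbound : ∀ (m H H' : ℝ), 0 ≤ m → 0 ≤ H → 0 ≤ H' →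
      (1 + 272 * R.c * a) * m + 4 * K * (m * (4 + (H + H'))) ≤ C * (m * (1 + H + H')) := by
    intro m H H' hm hH hH'
    have h1 := mul_le_mul_of_nonneg_right hC (by positivity : 0 ≤ m * (1 + H + H'))
    refine le_trans ?_ h1
    have h2 : 0 ≤ (1 + 272 * (R.c : ℝ) * a) * (m * (H + H')) := by positivity
    have h3 : 0 ≤ (K : ℝ) * (m * (H + H')) := by positivity
    linarith
  have hH : ∀ τ : List (V × V), 0 ≤ entropyDstGivenSrc 2 τ := entropyDstGivenSrc_nonneg one_lt_two
  have hH' : ∀ τ : List (V × V), 0 ≤ entropySrcGivenDst 2 τ := entropySrcGivenDst_nonneg one_lt_two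
  refine ⟨?_, ?_, ?_⟩
  · intro w hmem hlen
    have h1 := hlocal w hmem
    have h2 : ((Fintype.card V * R.D : ℕ) : ℝ) ≤ a * w.length := by
      exact_mod_cast hn.trans (Nat.mul_le_mul_left a hlen)
    have h3 := hbound w.length _ _ (Nat.cast_nonneg _) (hH (requests w)) (hH' (requests w))
    have h4 := mul_le_mul_of_nonneg_left h2 (by positivity : (0 : ℝ) ≤ 136 * R.c)
    have h5 : (0 : ℝ) ≤ R.c * (a * w.length) := by positivity
    rw [mul_assoc]
    linarith
  · refine (totalCost_run_le hc hD hσ hsp hδ hn _ hlocal).trans ?_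
    rw [← List.sum_map_mul_left]
    exact List.sum_le_sum fun w _ => hbound _ _ _ (Nat.cast_nonneg _) (hH _) (hH' _)
  · have hreq : σ = ((R.windows σ).map requests).flatten := by
      rw [← requests_flatten, hflat, requests_run]
    have hglobal : ∀ w ∈ R.windows σ, (totalCost w : ℝ) ≤ _ := fun w hmem =>
      (hw w hmem).cost_le hD hK σ fun r hr => by
        rw [hreq]
        exact List.mem_flatten.2 ⟨_, List.mem_map_of_mem hmem, hr⟩
    refine (totalCost_run_le hc hD hσ hsp hδ hn _ hglobal).trans ?_
    refine le_trans (le_of_eq ?_)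
      (hbound σ.length _ _ (Nat.cast_nonneg _) (hH σ) (hH' σ))
    rw [← sum_information, List.sum_map_add, List.sum_map_mul_left, List.sum_map_mul_left]
    congr 2
    · rw [← length_run (R := R) R.init σ, ← hflat, List.length_flatten, Nat.cast_list_sum,
        List.map_map]
      rfl
    · generalize (fun r : V × V => 4 + (-Real.logb 2 (condFreq σ r.1 r.2) +
        -Real.logb 2 (condFreq (σ.map Prod.swap) r.2 r.1))) = f
      rw [congrArg (List.map f) hreq, List.map_flatten, List.sum_flatten, List.map_map,
        List.map_map]
      rfl

/-- Static optimality, from the entropy bound. -/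
theorem avgCost_le_optFixedCost {σ : List (V × V)} (hσ : ∀ r ∈ σ, r.1 ≠ r.2) {C Δ : ℕ}
    (hΔ : 2 ≤ Δ)
    (h : R.avgCost σ ≤ C * (1 + entropyDstGivenSrc 2 σ + entropySrcGivenDst 2 σ)) :
    ENNReal.ofReal (R.avgCost σ) ≤ (C * (5 * Δ) : ℕ) * optFixedCost Δ σ := by
  rcases eq_or_ne σ [] with rfl | hne
  · simp [avgCost]
  have hΔ' : (1 : ℝ) < Δ := by exact_mod_cast (by omega : 1 < Δ)
  set M := max (entropyDstGivenSrc Δ σ) (entropySrcGivenDst Δ σ) with hM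
  have h1 : entropyDstGivenSrc Δ σ ≤ M := le_max_left _ _
  have h2 : entropySrcGivenDst Δ σ ≤ M := le_max_right _ _
  have hM0 : 0 ≤ M := (entropyDstGivenSrc_nonneg hΔ' σ).trans h1
  -- Changing the base of the entropies from 2 to `Δ` costs a factor `log Δ`, crudely bounded by
  -- `Δ`.
  have hlog : Real.logb 2 Δ ≤ Δ := by
    rw [Real.logb_le_iff_le_rpow one_lt_two (by linarith), Real.rpow_natCast]
    exact_mod_cast (Nat.lt_two_pow_self (n := Δ)).le
  have hlog0 : 0 ≤ Real.logb 2 Δ := Real.logb_nonneg one_lt_two hΔ'.le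
  have h3 : R.avgCost σ ≤ C * (Δ * (1 + 2 * M)) := by
    refine h.trans (mul_le_mul_of_nonneg_left ?_ (Nat.cast_nonneg C))
    rw [entropyDstGivenSrc_two hΔ', entropySrcGivenDst_two hΔ']
    have h4 := mul_le_mul hlog h1 (entropyDstGivenSrc_nonneg hΔ' σ) (by positivity)
    have h5 := mul_le_mul hlog h2 (entropySrcGivenDst_nonneg hΔ' σ) (by positivity)
    linarith
  have h4 := entropy_le_optFixedCost hΔ σ hσ
  have h5 := one_le_optFixedCost Δ hσ hne
  calc ENNReal.ofReal (R.avgCost σ) ≤ ENNReal.ofReal (C * (Δ * (1 + 2 * M))) :=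
        ENNReal.ofReal_le_ofReal h3
    _ = C * (Δ * (1 + 2 * ENNReal.ofReal M)) := by
        rw [ENNReal.ofReal_mul (by positivity), ENNReal.ofReal_mul (by positivity),
          ENNReal.ofReal_add (by positivity) (by positivity), ENNReal.ofReal_mul (by positivity),
          ENNReal.ofReal_natCast, ENNReal.ofReal_natCast, ENNReal.ofReal_one,
          ENNReal.ofReal_ofNat]
    -- The optimum is at least one and at least half of the larger entropy.
    _ ≤ C * (Δ * (optFixedCost Δ σ + 2 * (2 * optFixedCost Δ σ))) := by gcongr
    _ = (C * (5 * Δ) : ℕ) * optFixedCost Δ σ := by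
        push_cast
        ring

end ReNet

theorem mainTheorem1 :
    (∀ c K a : ℕ, 1 ≤ c → ∃ C : ℕ,
      ∀ (V : Type) [Fintype V] [LinearOrder V] (R : ReNet V) (δ : ℕ) (σ : List (V × V)),
        R.c = c → 1 ≤ R.D → R.bst.IsStaticallyOptimal K →
        (∀ r ∈ σ, r.1 ≠ r.2) → IsSparse c δ σ →
        δ ≤ σ.length → Fintype.card V * R.D ≤ a * δ →
        -- the degree bound `Δ = 6θ = 24c` of the ReNet
        R.maxDegree = 24 * c ∧
        (∀ s ∈ R.run R.init σ, ∀ v,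
          ports s.routed.network v ≤ R.maxDegree ∧ ports s.after.network v ≤ R.maxDegree) ∧
        -- requests are routed along the links of the network
        (∀ s ∈ R.run R.init σ, (linkGraph s.routed.network).edist s.req.1 s.req.2 ≤
          (R.routeLen s.req.1 s.req.2 s.routed : ℕ∞)) ∧
        -- static optimality among networks of degree at most `Δ`
        ENNReal.ofReal (R.avgCost σ) ≤ C * optFixedCost R.maxDegree σ ∧
        -- the entropy bound on the reset windows
        (∀ w ∈ (R.windows σ).dropLast, δ ≤ w.length) ∧
        (∀ w ∈ R.windows σ, δ ≤ w.length →
          (ReNet.totalCost w : ℝ) ≤ C * w.length * (1 + entropyDstGivenSrc 2 (ReNet.requests w) +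
            entropySrcGivenDst 2 (ReNet.requests w))) ∧
        -- the entropy bound for the whole sequence, window by window and overall
        (ReNet.totalCost (R.run R.init σ) : ℝ) ≤ C * ((R.windows σ).map fun w =>
          w.length * (1 + entropyDstGivenSrc 2 (ReNet.requests w) +
            entropySrcGivenDst 2 (ReNet.requests w))).sum ∧
        R.avgCost σ ≤ C * (1 + entropyDstGivenSrc 2 σ + entropySrcGivenDst 2 σ)) ∧
    -- the entropy lower bound for fixed networks
    (∃ C : ℕ, ∀ (Δ : ℕ) (V : Type) [Fintype V] [LinearOrder V] (σ : List (V × V)), 2 ≤ Δ →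
      (∀ r ∈ σ, r.1 ≠ r.2) →
      ENNReal.ofReal (max (entropyDstGivenSrc Δ σ) (entropySrcGivenDst Δ σ)) ≤
        C * optFixedCost Δ σ) ∧
    -- splay trees are statically optimal
    (∃ K : ℕ, ∀ (V : Type) [LinearOrder V], (splayTree V).IsStaticallyOptimal K) := by
  refine ⟨?_, ⟨2, fun Δ V _ _ σ hΔ hσ => by exact_mod_cast entropy_le_optFixedCost hΔ σ hσ⟩,
    ⟨151, fun V _ => splayTree_isStaticallyOptimal V⟩⟩
  intro c K a hc
  -- The first factor is the constant of the entropy bounds, the second the loss in passing to the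
  -- optimal fixed network of degree `24 c`.
  refine ⟨(1 + 272 * c * a + 16 * K) * (5 * (24 * c)), ?_⟩
  intro V _ _ R δ σ hRc hD hK hσ hsp hδ hn
  subst hRc
  have hdeg : R.maxDegree = 24 * R.c := by
    simp only [ReNet.maxDegree, ReNet.threshold]
    ring
  obtain ⟨hw, hlong, hflat⟩ := ReNet.windows_spec hc hD hσ hsp
  have hstep : ∀ s ∈ R.run R.init σ, s.IsSound := by
    intro s hs
    rw [← hflat] at hs
    obtain ⟨w, hmem, hs⟩ := List.mem_flatten.1 hs
    exact (hw w hmem).1 s hs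
  have havg : ∀ {C : ℝ}, (ReNet.totalCost (R.run R.init σ) : ℝ) ≤ C * (σ.length *
      (1 + entropyDstGivenSrc 2 σ + entropySrcGivenDst 2 σ)) →
      0 ≤ C → R.avgCost σ ≤ C * (1 + entropyDstGivenSrc 2 σ + entropySrcGivenDst 2 σ) := by
    intro C h hC
    have h1 := entropyDstGivenSrc_nonneg one_lt_two σ
    have h2 := entropySrcGivenDst_nonneg one_lt_two σ
    refine div_le_of_le_mul₀ (Nat.cast_nonneg _) (by positivity) (h.trans (le_of_eq ?_))
    ring
  have hC : (1 + 272 * R.c * a + 16 * K : ℝ) ≤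
      ((1 + 272 * R.c * a + 16 * K) * (5 * (24 * R.c)) : ℕ) := by
    exact_mod_cast Nat.le_mul_of_pos_right _ (by omega)
  obtain ⟨h1, h2, h3⟩ := ReNet.entropy_bounds hc hD hK hσ hsp hδ hn hC
  refine ⟨hdeg, ?_, ?_, ?_, hlong, h1, h2, havg h3 (Nat.cast_nonneg _)⟩
  · intro s hs v
    obtain ⟨⟨h, hr, -⟩, h', ha⟩ := hstep s hs
    exact ⟨hr.ports_le v, ha.ports_le v⟩
  · intro s hs
    obtain ⟨⟨h, hr, hmem⟩, -⟩ := hstep s hs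
    exact hr.edist_le_routeLen hmem
  · have h4 := (ReNet.entropy_bounds hc hD hK hσ hsp hδ hn le_rfl).2.2
    have h5 := havg h4 (by positivity)
    have h6 := ReNet.avgCost_le_optFixedCost (R := R) hσ (C := 1 + 272 * R.c * a + 16 * K)
      (Δ := 24 * R.c) (by omega) (by push_cast; exact h5)
    rw [hdeg]
    exact h6
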